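/- Let $\Bbbk=\mathbb Z[X,Y,Z^{\pm1}]/(X^2-1,\,Y^2-1)$ and $\lambda\big((a,b),(a',b')\big)=X^{aa'}Y^{bb'}Z^{ab'-a'b}$. Let $D$ be a diagram of an oriented link $L$ with enumerated crossings, $n_-$ of them negative, and with an arrow at each crossing connecting the two strands of its type $0$ resolution. For $\xi\in\{0,1\}^n$ let $D_\xi$ be the resolution of $D$ and $|\xi|=\sum_i\xi_i$. Let $A=\Bbbk v_+\oplus\Bbbk v_-$ with $\deg v_+=(1,0)$, $\deg v_-=(0,-1)$, and let $\mathcal F(D_\xi)=A^{\otimes k}$, where the $k$ circles of $D_\xi$ are ordered arbitrarily. An edge $\zeta:\xi\to\xi'$ of the cube is a saddle, which merges two circles or splits one; $\mathcal F(D_\zeta)$ is the merge $$v_+\otimes v_+\mapsto v_+,\quad v_+\otimes v_-\mapsto v_-,\quad v_-\otimes v_+\mapsto XZ\,v_-,\quad v_-\otimes v_-\mapsto 0$$ (the arrow points from the first circle to the second one) or the split $$v_+\mapsto v_-\otimes v_++YZ\,v_+\otimes v_-,\qquad v_-\mapsto v_-\otimes v_-$$ (the first new circle is on the right of the arrow),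 tensored with the identity of the remaining factors, after the factors involved have been moved to the front, and the resulting ones back to their places, with the symmetry $m\otimes n\mapsto\lambda(\deg m,\deg n)\,n\otimes m$. Let $\epsilon$ be a sign assignment: invertible scalars $\epsilon(\zeta)\in\Bbbk^*$ such that $\delta\epsilon=-\psi$ (written multiplicatively), where $\psi$ is the commutation cocycle of the cube of saddle cobordisms, $W_{1*}W_{*0}=\psi\,W_{*1}W_{0*}$ on each face. On the faces that split a circle and merge it back, where this relation allows both $1$ and $XY$, fix that $\psi=1$ on the faces of one of the two types (distinguished by the mutual position of the two arrows) and $\psi=XY$ on those of the other type. The generalized Khovanov complex is $\mathcal FK\!h(D)^i=\bigoplus_{|\xi|=i+n_-}\mathcal F(D_\xi)$ with differential $\sum_\zeta\epsilon(\zeta)\mathcal F(D_\zeta)$, and for a $\Bbbk$-module $M$ let $\mathcal H^i(L;M)$ be the $i$-th homology of $\mathcal FK\!h(D)\otimes_\Bbbk M$. Then for every $\Bbbk$-module structure on the abelian group $\mathbb Z$ (there are eight of them, $X$, $Y$, $Z$ acting as $\pm1$) and every $i\in\mathbb Z$ there are isomorphisms of abelian groups 1. $\mathcal H^i(L;\mathbb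 Z)\cong \mathrm{Kh}^i_{ev}(L)$, the even Khovanov homology (Khovanov's original theory), if $XY$ acts on $\mathbb Z$ as the identity; 2. $\mathcal H^i(L;\mathbb Z)\cong \mathrm{Kh}^i_{odd}(L)$, the odd Khovanov homology of Ozsváth, Rasmussen and Szabó, otherwise. Here all groups are computed from the same diagram $D$; the arrows, orders of circles and sign assignments (of either type) are arbitrary, and are chosen independently for the generalized and for the odd complex. -/

import Mathlib

noncomputable section

/-! ### The coefficient ring -/

/-- The group of monomials `X^a Y^b Z^c` with `a, b` modulo `2` and `c` an integer. -/
abbrev ChronoMonomial : Type :=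
  Multiplicative (ZMod 2) × Multiplicative (ZMod 2) × Multiplicative ℤ

/-- The ring `ℤ[X, Y, Z, Z⁻¹]/(X² - 1, Y² - 1)`, as the integral group ring of the group of
monomials. -/
abbrev ChronoRing : Type := MonoidAlgebra ℤ ChronoMonomial

namespace ChronoRing

/-- The monomial `X^a Y^b Z^c`. -/
def mono (a b c : ℤ) : ChronoRing :=
  MonoidAlgebra.of ℤ ChronoMonomial
    (Multiplicative.ofAdd (a : ZMod 2), Multiplicative.ofAdd (b : ZMod 2), Multiplicative.ofAdd c)

def X : ChronoRing := mono 1 0 0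
def Y : ChronoRing := mono 0 1 0
def Z : ChronoRing := mono 0 0 1

/-- `λ((a, b), (a', b')) = X^(a a') Y^(b b') Z^(a b' - a' b)`. -/
def lam (p q : ℤ × ℤ) : ChronoRing :=
  mono (p.1 * q.1) (p.2 * q.2) (p.1 * q.2 - q.1 * p.2)

theorem mono_mul (a b c a' b' c' : ℤ) :
    mono a b c * mono a' b' c' = mono (a + a') (b + b') (c + c') := by
  simp only [mono, ← map_mul, Prod.mk_mul_mk, ← ofAdd_add]
  push_cast
  rfl

theorem mono_zero : mono 0 0 0 = 1 := by
  simp only [mono, Int.cast_zero, ofAdd_zero]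
  exact map_one (MonoidAlgebra.of ℤ ChronoMonomial)

theorem XY_mul_XY : (X * Y) * (X * Y) = 1 := by
  rw [← mono_zero]
  simp only [X, Y, mono_mul]
  simp only [mono, Int.cast_add, Int.cast_one, Int.cast_zero, zero_add, add_zero]
  rfl

/-- The product `XY` as an invertible element. -/
def XYunit : ChronoRingˣ := ⟨X * Y, X * Y, XY_mul_XY, XY_mul_XY⟩

end ChronoRing

/-! ### Link diagrams

A diagram is recorded by an (extended) planar diagram code. The four ends of the crossing `c` are
numbered `0, 1, 2, 3` counterclockwise, starting with the incoming end of the lower strand, and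
`arc c k` is the arc of the diagram that contains the end `k`. An arc without ends is a component
of the diagram that has no crossings. -/

structure PDCode where
  /-- number of crossings -/
  crossings : ℕ
  /-- number of arcs -/
  arcs : ℕ
  arc : Fin crossings → Fin 4 → Fin arcs
  /-- whether the crossing is positive -/
  positive : Fin crossings → Bool

namespace PDCode

variable (P : PDCode)

/-- Whether the orientation of the link enters the crossing through the given end: the lower strand
runs from `0` to `2`, the upper one from `3` to `1` at a positive crossing and from `1` to `3` at a
negative one. -/
def incoming (c : Fin P.crossings) : Fin 4 → Bool :=
  ![true, !P.positive c, false, P.positive c]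

/-- The regions of the underlying 4-valent graph: the corner `(c, k)` lies between the ends `k` and
`k + 1` of `c`; if the end `k` of `c` and the end `l + 1` of `c'` are the two ends of an arc, then
the corners `(c, k)` and `(c', l)` lie on the same side of this arc. -/
def Region : Type :=
  Quot fun p q : Fin P.crossings × Fin 4 =>
    p ≠ (q.1, q.2 + 1) ∧ P.arc p.1 p.2 = P.arc q.1 (q.2 + 1)

/-- The connected components of the underlying 4-valent graph (crossingless circles excluded). -/
def GraphComponent : Type :=
  Quot fun c c' : Fin P.crossings => ∃ k l, P.arc c k = P.arc c' l

end PDCode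

/-- An oriented link diagram. -/
structure LinkDiagram extends PDCode where
  /-- two different ends of an arc are an incoming one and an outgoing one -/
  ends : ∀ p q : Fin crossings × Fin 4, p ≠ q → arc p.1 p.2 = arc q.1 q.2 →
    toPDCode.incoming p.1 p.2 ≠ toPDCode.incoming q.1 q.2
  /-- every end of an arc at a crossing has an opposite end -/
  opposite : ∀ p : Fin crossings × Fin 4, ∃ q, p ≠ q ∧ arc p.1 p.2 = arc q.1 q.2
  /-- Each component of the graph is embedded in the sphere: since it is 4-valent, this is Euler's
  formula `V - E + F = 2`, summed over all components, with `E = 2 V`. -/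
  planar : Nat.card toPDCode.Region = crossings + 2 * Nat.card toPDCode.GraphComponent

namespace LinkDiagram

variable (D : LinkDiagram)

/-- Vertices of the cube of resolutions; `false` and `true` stand for `0` and `1`. -/
abbrev Cube : Type := Fin D.crossings → Bool

/-- Resolutions: type 0 connects the ends `0, 1` and the ends `2, 3` of a crossing, type 1 connects
`1, 2` and `3, 0`. -/
def Joined (ξ : D.Cube) (e e' : Fin D.arcs) : Prop :=
  ∃ c, if ξ c = true
    then (e = D.arc c 1 ∧ e' = D.arc c 2) ∨ (e = D.arc c 3 ∧ e' = D.arc c 0)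
    else (e = D.arc c 0 ∧ e' = D.arc c 1) ∨ (e = D.arc c 2 ∧ e' = D.arc c 3)

/-- The circles of the resolution `D_ξ`. -/
def Circle (ξ : D.Cube) : Type := Quot (D.Joined ξ)

/-- The circle that contains the arc `e`. -/
def circ (ξ : D.Cube) (e : Fin D.arcs) : D.Circle ξ := Quot.mk _ e

instance (ξ : D.Cube) : Finite (D.Circle ξ) := Finite.of_surjective (D.circ ξ) Quot.mk_surjective

instance (ξ : D.Cube) : Fintype (D.Circle ξ) := Fintype.ofFinite _

instance (ξ : D.Cube) : DecidableEq (D.Circle ξ) := Classical.decEq _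

/-- The edge `ζ : ξ → ξ'` of the cube, in the direction of the crossing `c`. -/
def IsEdge (c : Fin D.crossings) (ξ ξ' : D.Cube) : Prop :=
  ξ c = false ∧ ξ' = Function.update ξ c true

def weight (ξ : D.Cube) : ℕ := (Finset.univ.filter fun c => ξ c = true).card

/-- The number `n_-` of negative crossings. -/
def negativeCrossings : ℕ := (Finset.univ.filter fun c => D.positive c = false).card

/-- Vertices of the cube in homological degree `i`. -/
abbrev Level (i : ℤ) : Type := {ξ : D.Cube // (D.weight ξ : ℤ) = i + D.negativeCrossings}

open Classical in
instance (i : ℤ) : Fintype (D.Level i) := Fintype.ofFinite _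

/-! ### Complexes from cubes

A cube of modules is given by modules `V ξ` and, for every edge `ξ → ξ'` in the direction `c`, a map
`edge c ξ ξ'` (its values at other pairs are not used). -/

section Cubes

variable {R : Type} [CommRing R] {V : D.Cube → Type} [∀ ξ, AddCommGroup (V ξ)]
  [∀ ξ, Module R (V ξ)]

open Classical in
/-- The differential from degree `i` to degree `j` (zero unless `j = i + 1`), in which the edge maps
are multiplied by `ε`. -/
def differential (edge : Fin D.crossings → ∀ ξ ξ' : D.Cube, V ξ →ₗ[R] V ξ')
    (ε : D.Cube → Fin D.crossings → Rˣ) (i j : ℤ) :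
    (∀ ξ : D.Level i, V ξ) →ₗ[R] (∀ ξ' : D.Level j, V ξ') :=
  LinearMap.pi fun ξ' => ∑ ξ : D.Level i, ∑ c : Fin D.crossings,
    if D.IsEdge c ξ ξ' then ((ε ξ c : Rˣ) : R) • (edge c ξ ξ' ∘ₗ LinearMap.proj ξ) else 0

/-- An arrow at each crossing, across the two strands of its type 0 resolution, orients the
saddles: for `false` the arrow runs from the strand `0, 1` to the strand `2, 3`, for `true` the
other way. The first strand consists of the ends `tail, tail + 1`, and the second one of
`tail + 2, tail + 3`; in the type 1 resolution the strand on the right of the arrow consists of the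
ends `tail + 1, tail + 2`, and the strand on the left of `tail + 3, tail`. -/
def tail (arrow : Fin D.crossings → Bool) (c : Fin D.crossings) : Fin 4 :=
  if arrow c then 2 else 0

/-- The faces of the cube in which a circle is split and then merged back, in directions `c` and
`c'` (one arc is inside the circle, the other one outside, and their ends interlace). -/
def IsLadybug (ξ : D.Cube) (c c' : Fin D.crossings) : Prop :=
  D.circ ξ (D.arc c 0) = D.circ ξ (D.arc c 2) ∧
  D.circ ξ (D.arc c' 0) = D.circ ξ (D.arc c' 2) ∧
  D.circ (Function.update ξ c true) (D.arc c' 0) ≠ D.circ (Function.update ξ c true) (D.arc c' 2)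

/-- The two types of such faces, with arrows: whether the part of the circle on the right of the
arrow of `c` contains the tail or the head of the arrow of `c'`. -/
def LadybugTail (arrow : Fin D.crossings → Bool) (ξ : D.Cube) (c c' : Fin D.crossings) : Prop :=
  D.circ (Function.update ξ c true) (D.arc c' (D.tail arrow c')) =
    D.circ (Function.update ξ c true) (D.arc c (D.tail arrow c + 1))

open Classical in
/-- Sign assignments: scaled by `ε`, the cube anticommutes, i.e. `δε = -ψ` where
`W_{1*} W_{*0} = ψ W_{*1} W_{0*}` on every face. The composition of a split with a merge is
annihilated by `1 - p` (`p = XY`, or `p = -1` in the odd case), so that this relation leaves the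
choice between `ψ = 1` and `ψ = p` on the faces above; there `ψ = 1` for one type
of the faces and `ψ = p` for the other, according to the convention `conv`. -/
structure IsSignAssignment (edge : Fin D.crossings → ∀ ξ ξ' : D.Cube, V ξ →ₗ[R] V ξ')
    (p : Rˣ) (arrow : Fin D.crossings → Bool) (conv : Bool)
    (ε : D.Cube → Fin D.crossings → Rˣ) : Prop where
  anticommute : ∀ (ξ ξ₁ ξ₂ ξ₁₂ : D.Cube) (c c' : Fin D.crossings), c ≠ c' →
    D.IsEdge c ξ ξ₁ → D.IsEdge c' ξ₁ ξ₁₂ → D.IsEdge c' ξ ξ₂ → D.IsEdge c ξ₂ ξ₁₂ →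
    ((ε ξ c * ε ξ₁ c' : Rˣ) : R) • (edge c' ξ₁ ξ₁₂ ∘ₗ edge c ξ ξ₁) =
      -(((ε ξ c' * ε ξ₂ c : Rˣ) : R) • (edge c ξ₂ ξ₁₂ ∘ₗ edge c' ξ ξ₂))
  ladybug : ∀ (ξ ξ₁ ξ₂ ξ₁₂ : D.Cube) (c c' : Fin D.crossings), c ≠ c' →
    D.IsEdge c ξ ξ₁ → D.IsEdge c' ξ₁ ξ₁₂ → D.IsEdge c' ξ ξ₂ → D.IsEdge c ξ₂ ξ₁₂ →
    D.IsLadybug ξ c c' →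
    ε ξ c * ε ξ₁ c' =
      -((if (D.LadybugTail arrow ξ c c' ↔ conv = true) then 1 else p) * (ε ξ c' * ε ξ₂ c))

end Cubes

/-- The homology of `A → B → C` at `B`: the kernel modulo the image. -/
abbrev homologyAt {R A B C : Type} [CommRing R] [AddCommGroup A] [AddCommGroup B] [AddCommGroup C]
    [Module R A] [Module R B] [Module R C] (f : A →ₗ[R] B) (g : B →ₗ[R] C) : Type :=
  LinearMap.ker g ⧸ (LinearMap.range f).submoduleOf (LinearMap.ker g)

/-! ### Tensor powers of a module with basis `v₊, v₋`

A basis of the tensor product over the circles of `D_ξ` consists of labelings of circles;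
`true` and `false` stand for `v₊` and `v₋`. -/

abbrev Labeling (ξ : D.Cube) : Type := D.Circle ξ → Bool

section Saddle

variable {R : Type} [CommRing R]

open Classical in
/-- The matrix entry, at labelings `s` and `s'`, of the map that merges or splits circles at the
crossing `c`, with the ends of `c` numbered from `t`, and is the identity at all other circles.
The map merges the circle of the end `t` (first factor) with the one of the end `t + 2` (second
factor) if they are different, and splits it otherwise into the circles of the end `t + 1` (first
factor) and of the end `t + 3` (second factor). The numbers `μ x y z` and `Δ x y z` are the
coefficients of the merge and the split, at `z` in the image of `x ⊗ y`, and at `y ⊗ z` in the image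
of `x`. -/
def saddleEntry (μ Δ : Bool → Bool → Bool → R) (t : Fin 4) (c : Fin D.crossings) (ξ ξ' : D.Cube)
    (s : D.Labeling ξ) (s' : D.Labeling ξ') : R :=
  let a := D.circ ξ (D.arc c t)
  let b := D.circ ξ (D.arc c (t + 2))
  let a' := D.circ ξ' (D.arc c (t + 1))
  let b' := D.circ ξ' (D.arc c (t + 3))
  if ∀ e, D.circ ξ e ≠ a → D.circ ξ e ≠ b → s (D.circ ξ e) = s' (D.circ ξ' e) then
    if a ≠ b then μ (s a) (s b) (s' a') else Δ (s a) (s' a') (s' b')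
  else 0

end Saddle

/-! ### Generalized Khovanov homology -/

/-- The `ℤ × ℤ`-degree: `(1, 0)` for `v₊` and `(0, -1)` for `v₋`. -/
def chDeg : Bool → ℤ × ℤ
  | true => (1, 0)
  | false => (0, -1)

/-- `v₊ ⊗ v₊ ↦ v₊`, `v₊ ⊗ v₋ ↦ v₋`, `v₋ ⊗ v₊ ↦ XZ v₋`, `v₋ ⊗ v₋ ↦ 0`. -/
def chMerge : Bool → Bool → Bool → ChronoRing
  | true, true, true => 1
  | true, false, false => 1
  | false, true, false => ChronoRing.X * ChronoRing.Z
  | _, _, _ => 0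

/-- `v₊ ↦ v₋ ⊗ v₊ + YZ v₊ ⊗ v₋`, `v₋ ↦ v₋ ⊗ v₋`. -/
def chSplit : Bool → Bool → Bool → ChronoRing
  | true, false, true => 1
  | true, true, false => ChronoRing.Y * ChronoRing.Z
  | false, false, false => 1
  | _, _, _ => 0

open Classical in
/-- The coefficient by which the symmetry `τ(m ⊗ n) = λ(deg m, deg n) n ⊗ m` multiplies the basis
element of a labeling `s` when the order of the factors changes from `r` to `r'`: one factor for
each pair of circles whose order is reversed. Orders are given by injective maps to `ℕ`. -/
def reorder {ξ : D.Cube} (r r' : D.Circle ξ → ℕ) (s : D.Labeling ξ) : ChronoRing :=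
  ∏ x, ∏ y, if r x < r y ∧ r' y < r' x then ChronoRing.lam (chDeg (s x)) (chDeg (s y)) else 1

open Classical in
/-- The order with the circle `a` first, the circle `b` second, and then all other circles, ordered
by their smallest arcs. -/
def frontOrder {ξ : D.Cube} (a b x : D.Circle ξ) : ℕ :=
  if x = a then 0 else if x = b then 1
  else 2 + sInf {k : ℕ | ∃ e : Fin D.arcs, D.circ ξ e = x ∧ (e : ℕ) = k}

/-- The image of the saddle cobordism `D_ζ` under the chronological TQFT: the factors are permuted
with the symmetry so that those which take part come first, then the merge `A ⊗ A → A` or the split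
`A → A ⊗ A` is applied, tensored with the identity on the right, and the factors are permuted again.
The arrow of a merge points from the first circle to the second one; the first circle produced by a
split is the one on the right of the arrow. -/
def genEdge (order : ∀ ξ : D.Cube, D.Circle ξ → ℕ) (arrow : Fin D.crossings → Bool)
    (c : Fin D.crossings) (ξ ξ' : D.Cube) :
    (D.Labeling ξ → ChronoRing) →ₗ[ChronoRing] (D.Labeling ξ' → ChronoRing) :=
  let t := D.tail arrow c
  Matrix.mulVecLin (Matrix.of fun s' s =>
    D.reorder (order ξ) (D.frontOrder (D.circ ξ (D.arc c t)) (D.circ ξ (D.arc c (t + 2)))) s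
    * D.saddleEntry chMerge chSplit t c ξ ξ' s s'
    * D.reorder
        (D.frontOrder (D.circ ξ' (D.arc c (t + 1))) (D.circ ξ' (D.arc c (t + 3)))) (order ξ') s')

/-- The homology `ℋ^i(L; M)` of the generalized Khovanov complex of `D` tensored with a module `M`
over the coefficient ring. -/
abbrev genHomology (order : ∀ ξ : D.Cube, D.Circle ξ → ℕ) (arrow : Fin D.crossings → Bool)
    (ε : D.Cube → Fin D.crossings → ChronoRingˣ)
    (M : Type) [AddCommGroup M] [Module ChronoRing M] (i : ℤ) : Type :=
  homologyAt ((D.differential (D.genEdge order arrow) ε (i - 1) i).rTensor M)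
    ((D.differential (D.genEdge order arrow) ε i (i + 1)).rTensor M)

/-! ### Even Khovanov homology -/

/-- Khovanov's algebra: `v₊` is the unit, `v₋ v₋ = 0`. -/
def evenMerge : Bool → Bool → Bool → ℤ
  | true, true, true => 1
  | true, false, false => 1
  | false, true, false => 1
  | _, _, _ => 0

/-- `v₊ ↦ v₋ ⊗ v₊ + v₊ ⊗ v₋`, `v₋ ↦ v₋ ⊗ v₋`. -/
def evenSplit : Bool → Bool → Bool → ℤ
  | true, false, true => 1
  | true, true, false => 1
  | false, false, false => 1
  | _, _, _ => 0

def evenEdge (c : Fin D.crossings) (ξ ξ' : D.Cube) :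
    (D.Labeling ξ → ℤ) →ₗ[ℤ] (D.Labeling ξ' → ℤ) :=
  Matrix.mulVecLin (Matrix.of fun s' s => D.saddleEntry evenMerge evenSplit 0 c ξ ξ' s s')

/-- The standard signs: `-1` to the number of `1`s before the coordinate that changes. -/
def evenSign (ξ : D.Cube) (c : Fin D.crossings) : ℤˣ :=
  (-1) ^ (Finset.univ.filter fun c' => c' < c ∧ ξ c' = true).card

/-- The even Khovanov homology group `Kh_ev^i`. -/
abbrev evenHomology (i : ℤ) : Type :=
  homologyAt (D.differential D.evenEdge D.evenSign (i - 1) i)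
    (D.differential D.evenEdge D.evenSign i (i + 1))

/-! ### Odd Khovanov homology -/

/-- The exterior algebra of the free abelian group on the circles of `D_ξ`. -/
abbrev OddModule (ξ : D.Cube) : Type := ExteriorAlgebra ℤ (D.Circle ξ →₀ ℤ)

/-- Sends a circle of `D_ξ` to a circle of `D_ξ'` with a common arc. If circles are merged this is the
projection, and if a circle is split this is a section of the projection in the other direction. -/
def carry (ξ ξ' : D.Cube) (x : D.Circle ξ) : D.Circle ξ' := D.circ ξ' (Quot.out x)

open Classical in
/-- A merge is the homomorphism of exterior algebras that identifies the two circles. A split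
takes a lift to the exterior algebra over the new circles and multiplies it by `a₁ - a₂`, where
`a₁` and `a₂` are the circles on the right and on the left of the arrow (the choice of the lift
does not matter). -/
def oddEdge (arrow : Fin D.crossings → Bool) (c : Fin D.crossings) (ξ ξ' : D.Cube) :
    D.OddModule ξ →ₗ[ℤ] D.OddModule ξ' :=
  let t := D.tail arrow c
  let lift : D.OddModule ξ →ₗ[ℤ] D.OddModule ξ' :=
    (ExteriorAlgebra.map (Finsupp.lmapDomain ℤ ℤ (D.carry ξ ξ'))).toLinearMap
  if D.circ ξ (D.arc c t) ≠ D.circ ξ (D.arc c (t + 2)) then lift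
  else
    LinearMap.mulLeft ℤ
      (ExteriorAlgebra.ι ℤ (Finsupp.single (D.circ ξ' (D.arc c (t + 1))) 1) -
        ExteriorAlgebra.ι ℤ (Finsupp.single (D.circ ξ' (D.arc c (t + 3))) 1)) ∘ₗ lift

/-- The odd Khovanov homology group `Kh_odd^i`. -/
abbrev oddHomology (arrow : Fin D.crossings → Bool) (ε : D.Cube → Fin D.crossings → ℤˣ) (i : ℤ) :
    Type :=
  homologyAt (D.differential (D.oddEdge arrow) ε (i - 1) i)
    (D.differential (D.oddEdge arrow) ε i (i + 1))

end LinkDiagram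

end

/-! ### Planarity: cycles of arcs modulo 2 bound chains of regions. -/

noncomputable section

namespace LinkDiagram

variable (D : LinkDiagram)

/-! ### Ends of arcs -/

/-! A module structure on `ℤ` is a ring homomorphism that sends X, Y, Z to signs x, y, z, so
tensoring specializes the cube to a cube of free abelian groups. Put w = xz and p = xy. The symmetry
of two factors becomes a product of three signs: x always, w if the labels differ, p if both labels
are v₋. The first depends on the orders only and becomes a sign of the edge. The second is removed,
together with the w in merges and splits, by a diagonal change of basis (`gauge`), at the cost of
one more sign of the edge. What is left (`redEdge`) depends on p alone: for p = 1 it is Khovanov's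
cube, for p = -1 it is the cube of exterior algebras written in bases of monomials. Hence the
specialized cube is isomorphic to the even or the odd one up to a sign on each edge
(`IsSpecialization.intertwines_even`, `IsSpecialization.intertwines_odd`).

Signs of edges matter only through their products around faces: a cocycle of signs on a cube is the
coboundary of signs on vertices (`exists_vertex_signs`), and these correct the isomorphism
(`Intertwines.nonempty_homology_equiv`). The transported sign assignment makes the target cube
anticommute, which determines the sign of each face on which the composition of two edges differs
from its negative. In the even theory this is every face, because the matrices are nonnegative
(`Anticommutes.faceSign_even`). In the odd theory it is every face except those that split a circle
and merge it back, where the composition is zero (`IsFace.oddEdge_oddEdge_ne_zero`).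

On these exceptional faces the prescribed values of the sign assignment are followed through the
comparison. The gauge contributes nothing: its edge signs do not involve y, so they can be computed
for y = x, where the theory is even and all face signs are known
(`IsSpecialization.faceSign_edgeSign`). Reversing an arrow changes the type of the face and its sign
together (`faceSign_arrowSign`). If the two complexes follow opposite conventions, a sign -1 on all
exceptional faces remains. It is absorbed by an automorphism of the odd cube up to edge signs:
planarity gives a checkerboard colouring and, from it, a linear involution of the span of the
circles that scales the difference of two circles meeting at a corner by the colour of the corner. A
split is then scaled by the colour of its crossing, and the two crossings of an exceptional face,
whose arcs lie on different sides of the circle, have opposite colours (`IsLadybug.colour`). -/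

abbrev End : Type := Fin D.crossings × Fin 4

/-- The arc of an end. -/
def arcOf (p : D.End) : Fin D.arcs := D.arc p.1 p.2

/-- The other end of the same arc. -/
def partner (p : D.End) : D.End := (D.opposite p).choose

theorem partner_ne (p : D.End) : D.partner p ≠ p := (D.opposite p).choose_spec.1.symm

theorem arcOf_partner (p : D.End) : D.arcOf (D.partner p) = D.arcOf p :=
  (D.opposite p).choose_spec.2.symm

/-- An arc has at most two ends. -/
theorem eq_or_eq_partner {p q : D.End} (h : D.arcOf p = D.arcOf q) : q = p ∨ q = D.partner p := by
  by_contra! hne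
  -- Three different ends of one arc would give three pairwise different Booleans.
  have h1 := D.ends p q hne.1.symm h
  have h2 := D.ends p (D.partner p) (D.partner_ne p).symm (D.arcOf_partner p).symm
  have h3 := D.ends q (D.partner p) hne.2 (h.symm.trans (D.arcOf_partner p).symm)
  revert h1 h2 h3
  generalize D.incoming p.1 p.2 = a
  generalize D.incoming q.1 q.2 = b
  generalize D.incoming (D.partner p).1 (D.partner p).2 = c
  revert a b c
  decide

theorem partner_partner (p : D.End) : D.partner (D.partner p) = p := by
  rcases D.eq_or_eq_partner (D.arcOf_partner p) with h | h
  · exact absurd h.symm (D.partner_ne p)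
  · exact h.symm

theorem partner_injective : Function.Injective D.partner :=
  Function.Involutive.injective D.partner_partner

/-! ### The first homology of a planar diagram -/

abbrev Region : Type := D.toPDCode.Region

def region (p : D.End) : D.Region := Quot.mk _ p

instance : Finite D.Region := Finite.of_surjective D.region Quot.mk_surjective

instance : Finite D.GraphComponent :=
  Finite.of_surjective (Quot.mk _ : Fin D.crossings → D.GraphComponent) Quot.mk_surjective

instance : Fintype D.Region := Fintype.ofFinite _

instance : Fintype D.GraphComponent := Fintype.ofFinite _

theorem region_partner (p : D.End) :
    D.region (D.partner p) = D.region (p.1, p.2 - 1) := by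
  refine Quot.sound ⟨?_, ?_⟩
  · simpa using D.partner_ne p
  · simpa [arcOf] using D.arcOf_partner p

theorem region_partner_sub (p : D.End) :
    D.region ((D.partner p).1, (D.partner p).2 - 1) = D.region p := by
  rw [← D.region_partner, D.partner_partner]

/-- The boundary of a chain of regions, as a function of ends. -/
def regionBoundary : (D.Region → ZMod 2) →ₗ[ZMod 2] (D.End → ZMod 2) where
  toFun f p := f (D.region p) + f (D.region (p.1, p.2 - 1))
  map_add' f g := by ext p; simp only [Pi.add_apply]; ring
  map_smul' r f := by ext p; simp only [Pi.smul_apply, smul_eq_mul, RingHom.id_apply]; ring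

@[simp]
theorem regionBoundary_apply (f : D.Region → ZMod 2) (p : D.End) :
    D.regionBoundary f p = f (D.region p) + f (D.region (p.1, p.2 - 1)) := rfl

/-- Chains of arcs, as functions of ends. -/
def arcChains : Submodule (ZMod 2) (D.End → ZMod 2) where
  carrier := {g | ∀ p, g (D.partner p) = g p}
  add_mem' := fun ha hb p => by simp only [Pi.add_apply, ha p, hb p]
  zero_mem' := fun _ => rfl
  smul_mem' := fun r a ha p => by simp only [Pi.smul_apply, ha p]

/-- The boundary of a chain of arcs. -/
def arcBoundary : D.arcChains →ₗ[ZMod 2] (Fin D.crossings → ZMod 2) :=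
  (LinearMap.pi fun c => ∑ k : Fin 4, LinearMap.proj (c, k)) ∘ₗ D.arcChains.subtype

@[simp]
theorem arcBoundary_apply (g : D.arcChains) (c : Fin D.crossings) :
    D.arcBoundary g c = ∑ k : Fin 4, g.1 (c, k) := by
  simp [arcBoundary]

theorem regionBoundary_mem (f : D.Region → ZMod 2) : D.regionBoundary f ∈ D.arcChains := by
  intro p
  simp only [regionBoundary_apply]
  rw [D.region_partner_sub, D.region_partner, add_comm]

theorem arcBoundary_regionBoundary (f : D.Region → ZMod 2) :
    D.arcBoundary ⟨D.regionBoundary f, D.regionBoundary_mem f⟩ = 0 := by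
  ext c
  have h (x y z w : ZMod 2) : x + w + (y + x) + (z + y) + (w + z) = 0 := by
    revert x y z w; decide
  simp only [arcBoundary_apply, regionBoundary_apply, Fin.sum_univ_four, Pi.zero_apply]
  exact h _ _ _ _

theorem eq_of_regionBoundary_eq_zero {f : D.Region → ZMod 2} (hf : D.regionBoundary f = 0)
    (p : D.End) : f (D.region (p.1, p.2 - 1)) = f (D.region p) := by
  have h := congrFun hf p
  simp only [regionBoundary_apply, Pi.zero_apply] at h
  exact (CharTwo.add_eq_zero.mp h).symm

theorem eq_corner_zero {f : D.Region → ZMod 2} (hf : D.regionBoundary f = 0)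
    (c : Fin D.crossings) (k : Fin 4) : f (D.region (c, k)) = f (D.region (c, 0)) := by
  have h1 := D.eq_of_regionBoundary_eq_zero hf (c, 1)
  have h2 := D.eq_of_regionBoundary_eq_zero hf (c, 2)
  have h3 := D.eq_of_regionBoundary_eq_zero hf (c, 3)
  simp only [Fin.reduceSub, sub_self] at h1 h2 h3
  fin_cases k
  · rfl
  · exact h1.symm
  · exact (h1.trans h2).symm
  · exact (h1.trans (h2.trans h3)).symm

/-- A chain without boundary has equal values on both sides of each arc, so it is constant around
crossings and along components; its values at one corner per component determine it. -/
theorem finrank_ker_regionBoundary_le :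
    Module.finrank (ZMod 2) (LinearMap.ker D.regionBoundary) ≤ Nat.card D.GraphComponent := by
  let L : (D.Region → ZMod 2) →ₗ[ZMod 2] (D.GraphComponent → ZMod 2) :=
    LinearMap.pi fun C => LinearMap.proj (D.region (Quot.out C, 0))
  have hL : Function.Injective (L ∘ₗ (LinearMap.ker D.regionBoundary).subtype) := by
    rw [← LinearMap.ker_eq_bot, LinearMap.ker_eq_bot']
    rintro ⟨f, hf⟩ h
    have hf' : D.regionBoundary f = 0 := hf
    have key : ∀ c c' : Fin D.crossings, (∃ k l, D.arc c k = D.arc c' l) →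
        f (D.region (c, 0)) = f (D.region (c', 0)) := by
      rintro c c' ⟨k, l, hkl⟩
      rcases D.eq_or_eq_partner (p := (c, k)) (q := (c', l)) hkl with e | e
      · cases e; rfl
      · rw [← D.eq_corner_zero hf' c (k - 1), ← D.eq_corner_zero hf' c' l, e, D.region_partner]
    let F : D.GraphComponent → ZMod 2 := Quot.lift (fun c => f (D.region (c, 0))) key
    ext r
    obtain ⟨⟨c, k⟩, rfl⟩ := Quot.exists_rep r
    have h1 : F (Quot.mk _ c) = 0 := by
      rw [← Quot.out_eq (Quot.mk _ c : D.GraphComponent)]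
      exact congrFun h (Quot.mk _ c)
    exact (D.eq_corner_zero hf' c k).trans h1
  have := LinearMap.finrank_le_finrank_of_injective hL
  simpa [Nat.card_eq_fintype_card] using this

/-- Of the two ends of an arc one is incoming, and a crossing has two incoming ends; a chain is
determined by its values there. -/
theorem finrank_arcChains_le : Module.finrank (ZMod 2) D.arcChains ≤ 2 * D.crossings := by
  let inEnd : Fin D.crossings × Bool → D.End := fun x =>
    (x.1, if x.2 then 0 else if D.positive x.1 then 3 else 1)
  have hin : ∀ p : D.End, D.incoming p.1 p.2 = true → ∃ x, inEnd x = p := by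
    rintro ⟨c, k⟩ h
    by_cases hc : D.positive c = true <;> fin_cases k <;>
      simp [PDCode.incoming, hc, inEnd] at h ⊢
  let L : (D.End → ZMod 2) →ₗ[ZMod 2] (Fin D.crossings × Bool → ZMod 2) :=
    LinearMap.funLeft (ZMod 2) (ZMod 2) inEnd
  have hL : Function.Injective (L ∘ₗ D.arcChains.subtype) := by
    rw [← LinearMap.ker_eq_bot, LinearMap.ker_eq_bot']
    rintro ⟨g, hg⟩ h
    ext p
    have key : ∀ q : D.End, D.incoming q.1 q.2 = true → g q = 0 := by
      intro q hq
      obtain ⟨x, rfl⟩ := hin q hq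
      exact congrFun h x
    by_cases hp : D.incoming p.1 p.2 = true
    · exact key p hp
    · have h2 := D.ends p (D.partner p) (D.partner_ne p).symm (D.arcOf_partner p).symm
      refine (hg p).symm.trans (key _ ?_)
      revert h2 hp
      generalize D.incoming p.1 p.2 = a
      generalize D.incoming (D.partner p).1 (D.partner p).2 = b
      revert a b
      decide
  have := LinearMap.finrank_le_finrank_of_injective hL
  simpa [mul_comm] using this

/-- An arc between two different crossings has their sum as its boundary, so their classes agree,
and one class per component spans the quotient. -/
theorem finrank_quotient_range_arcBoundary_le :
    Module.finrank (ZMod 2) ((Fin D.crossings → ZMod 2) ⧸ LinearMap.range D.arcBoundary) ≤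
      Nat.card D.GraphComponent := by
  classical
  let e : Fin D.crossings → (Fin D.crossings → ZMod 2) ⧸ LinearMap.range D.arcBoundary :=
    fun c => Submodule.Quotient.mk (Pi.single c 1)
  have key : ∀ c c' : Fin D.crossings, (∃ k l, D.arc c k = D.arc c' l) → e c = e c' := by
    rintro c c' ⟨k, l, hkl⟩
    rcases D.eq_or_eq_partner (p := (c, k)) (q := (c', l)) hkl with h | h
    · cases h; rfl
    · refine (Submodule.Quotient.eq _).mpr ⟨⟨Pi.single (c, k) 1 + Pi.single (c', l) 1, ?_⟩, ?_⟩
      · intro p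
        have h' : D.partner (c', l) = (c, k) := by rw [h, D.partner_partner]
        have e1 : D.partner p = (c, k) ↔ p = (c', l) := by
          rw [← h']; exact D.partner_injective.eq_iff
        have e2 : D.partner p = (c', l) ↔ p = (c, k) := by
          rw [h]; exact D.partner_injective.eq_iff
        simp only [Pi.add_apply, Pi.single_apply, e1, e2]
        rw [add_comm]
      · ext d
        have hs (x y : Fin D.crossings) (m : Fin 4) :
            ∑ j : Fin 4, (Pi.single (x, m) 1 : D.End → ZMod 2) (y, j) =
              (Pi.single x 1 : Fin D.crossings → ZMod 2) y := by
          by_cases hxy : y = x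
          · subst hxy
            rw [Finset.sum_eq_single m]
            · simp
            · intro j _ hj
              simp [hj]
            · simp
          · simp [hxy]
        simp only [arcBoundary_apply, Pi.add_apply, Finset.sum_add_distrib, hs, Pi.sub_apply]
        rw [CharTwo.sub_eq_add]
  let F : D.GraphComponent → (Fin D.crossings → ZMod 2) ⧸ LinearMap.range D.arcBoundary :=
    Quot.lift e key
  have hspan : Submodule.span (ZMod 2) (Set.range F) = ⊤ := by
    rw [eq_top_iff]
    rintro x -
    obtain ⟨v, rfl⟩ := Submodule.Quotient.mk_surjective _ x
    rw [pi_eq_sum_univ' v, ← Submodule.mkQ_apply, map_sum]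
    simp only [map_smul]
    refine Submodule.sum_mem _ fun i _ => Submodule.smul_mem _ _ (Submodule.subset_span ?_)
    exact ⟨Quot.mk _ i, rfl⟩
  have h1 := finrank_range_le_card (R := ZMod 2) F
  rw [Set.finrank, hspan, finrank_top] at h1
  rwa [Nat.card_eq_fintype_card]

/-- Every cycle of arcs bounds a chain of regions. -/
theorem exists_region_function (u : Fin D.arcs → ZMod 2)
    (hu : ∀ c, ∑ k, u (D.arc c k) = 0) :
    ∃ f : D.Region → ZMod 2, ∀ p : D.End,
      f (D.region p) + f (D.region (p.1, p.2 - 1)) = u (D.arcOf p) := by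
  let B : (D.Region → ZMod 2) →ₗ[ZMod 2] D.arcChains :=
    D.regionBoundary.codRestrict D.arcChains D.regionBoundary_mem
  have hle : LinearMap.range B ≤ LinearMap.ker D.arcBoundary := by
    rintro _ ⟨f, rfl⟩
    exact D.arcBoundary_regionBoundary f
  have hker : LinearMap.ker B = LinearMap.ker D.regionBoundary := by
    ext f
    simp [B, LinearMap.mem_ker]
  have h1 := LinearMap.finrank_range_add_finrank_ker B
  have h2 := LinearMap.finrank_range_add_finrank_ker D.arcBoundary
  have h3 := Submodule.finrank_quotient_add_finrank (LinearMap.range D.arcBoundary)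
  have h4 := D.finrank_ker_regionBoundary_le
  have h5 := D.finrank_arcChains_le
  have h6 := D.finrank_quotient_range_arcBoundary_le
  have h7 : Nat.card D.Region = D.crossings + 2 * Nat.card D.GraphComponent := D.planar
  rw [hker] at h1
  simp only [Module.finrank_fintype_fun_eq_card, ← Nat.card_eq_fintype_card,
    Nat.card_fin] at h1 h3
  -- With n crossings and C components, Euler's formula gives the range dimension at least (n + 2C)
  -- - C, while the kernel has dimension at most 2n - (n - C).
  have heq : LinearMap.range B = LinearMap.ker D.arcBoundary :=
    Submodule.eq_of_le_of_finrank_le hle (by omega)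
  have hmem : (⟨fun p => u (D.arcOf p), fun p => congrArg u (D.arcOf_partner p)⟩ : D.arcChains) ∈
      LinearMap.ker D.arcBoundary := by
    rw [LinearMap.mem_ker]
    ext c
    simpa [arcOf] using hu c
  rw [← heq] at hmem
  obtain ⟨f, hf⟩ := hmem
  exact ⟨f, fun p => congrFun (congrArg Subtype.val hf) p⟩

end LinkDiagram

end
-- Circles as cycles of a permutation, and the effect of a saddle on them.
noncomputable section

/-! ### Composing a permutation with a transposition -/

namespace Equiv.Perm

variable {α : Type*} [Finite α] [DecidableEq α] {f : Equiv.Perm α} {x y : α}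

/-- The transposition closes the segment f x, …, fᵏ x = y into a cycle of its own, and for minimal k
this segment does not contain x. -/
theorem SameCycle.not_mul_swap (hxy : x ≠ y) (h : f.SameCycle x y) :
    ¬ (f * Equiv.swap x y).SameCycle x y := by
  intro hg
  obtain ⟨n, hn⟩ := hg.symm.exists_nat_pow_eq
  have hex : ∃ k : ℕ, (f ^ k) x = y := h.exists_nat_pow_eq
  classical
  let k := Nat.find hex
  have hk : (f ^ k) x = y := Nat.find_spec hex
  have hmin : ∀ j < k, (f ^ j) x ≠ y := fun j hj => Nat.find_min hex hj
  have hk0 : 0 < k := by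
    rcases Nat.eq_zero_or_pos k with h0 | h0
    · rw [h0] at hk; exact absurd hk hxy
    · exact h0
  have hx : ∀ i, 1 ≤ i → i ≤ k → (f ^ i) x ≠ x := by
    intro i h1 h2 hi
    refine hmin (k - i) (by omega) ?_
    have : (f ^ (k - i)) ((f ^ i) x) = y := by
      rw [← Equiv.Perm.mul_apply, ← pow_add, Nat.sub_add_cancel h2, hk]
    rwa [hi] at this
  have hT : ∀ m : ℕ, ∃ i, 1 ≤ i ∧ i ≤ k ∧ ((f * Equiv.swap x y) ^ m) y = (f ^ i) x := by
    intro m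
    induction m with
    | zero => exact ⟨k, hk0, le_rfl, by simpa using hk.symm⟩
    | succ m ih =>
      obtain ⟨i, h1, h2, hi⟩ := ih
      rw [pow_succ', Equiv.Perm.mul_apply, hi, Equiv.Perm.mul_apply]
      rcases eq_or_lt_of_le h2 with rfl | h3
      · exact ⟨1, le_rfl, hk0, by rw [hk, Equiv.swap_apply_right, pow_one]⟩
      · refine ⟨i + 1, by omega, h3, ?_⟩
        rw [Equiv.swap_apply_of_ne_of_ne (hx i h1 h2) (hmin i h3), pow_succ',
          Equiv.Perm.mul_apply]
  obtain ⟨i, h1, h2, hi⟩ := hT n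
  exact hx i h1 h2 (hi.symm.trans hn)

/-- From y the product jumps to f x and then follows the f-cycle of x, which avoids y, until it
reaches x. -/
theorem sameCycle_mul_swap (h : ¬ f.SameCycle x y) : (f * Equiv.swap x y).SameCycle x y := by
  have hex : ∃ k : ℕ, 0 < k ∧ (f ^ k) x = x := by
    obtain ⟨m, hm, hm'⟩ := (isOfFinOrder_of_finite f).exists_pow_eq_one
    exact ⟨m, hm, by rw [hm']; rfl⟩
  classical
  let k := Nat.find hex
  have hk : 0 < k ∧ (f ^ k) x = x := Nat.find_spec hex
  have hmin : ∀ j < k, 0 < j → (f ^ j) x ≠ x := fun j hj h0 h1 => Nat.find_min hex hj ⟨h0, h1⟩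
  have key : ∀ j, 1 ≤ j → j ≤ k → ((f * Equiv.swap x y) ^ j) y = (f ^ j) x := by
    intro j h1
    induction j, h1 using Nat.le_induction with
    | base => intro _; simp
    | succ j h1 ih =>
      intro h2
      rw [pow_succ', Equiv.Perm.mul_apply, ih (by omega), Equiv.Perm.mul_apply,
        Equiv.swap_apply_of_ne_of_ne (hmin j (by omega) (by omega)), pow_succ',
        Equiv.Perm.mul_apply]
      intro e
      exact h ⟨j, by simpa using e⟩
  refine SameCycle.symm ⟨k, ?_⟩
  rw [zpow_natCast, key k hk.1 le_rfl, hk.2]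

end Equiv.Perm

namespace LinkDiagram

variable (D : LinkDiagram)

/-! ### The checkerboard colouring -/

/-- Every crossing has even degree, so the sum of all arcs is a cycle modulo 2; a chain of regions
that it bounds changes its value across each arc. -/
theorem exists_colour : ∃ χ : D.End → ℤˣ,
    (∀ p : D.End, χ (p.1, p.2 - 1) = -χ p) ∧ ∀ p, χ (D.partner p) = -χ p := by
  obtain ⟨f, hf⟩ := D.exists_region_function (fun _ => 1)
    (fun c => by simp only [Finset.sum_const, Finset.card_univ, Fintype.card_fin]; decide)
  have key : ∀ a b : ZMod 2, a + b = 1 →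
      (if b = 0 then (1 : ℤˣ) else -1) = -(if a = 0 then 1 else -1) := by decide
  refine ⟨fun p => if f (D.region p) = 0 then 1 else -1, fun p => key _ _ (hf p), fun p => ?_⟩
  have := key _ _ (hf p)
  rwa [← D.region_partner] at this

/-- A checkerboard colouring of the corners. The ends `p` with `colour p = 1` are the heads of the
arcs in an orientation that alternates at each crossing. -/
def colour : D.End → ℤˣ := D.exists_colour.choose

theorem colour_sub_one (p : D.End) : D.colour (p.1, p.2 - 1) = -D.colour p :=
  D.exists_colour.choose_spec.1 p

theorem colour_partner (p : D.End) : D.colour (D.partner p) = -D.colour p :=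
  D.exists_colour.choose_spec.2 p

theorem colour_add_one (c : Fin D.crossings) (k : Fin 4) :
    D.colour (c, k + 1) = -D.colour (c, k) := by
  have := D.colour_sub_one (c, k + 1)
  simp only [add_sub_cancel_right] at this
  rw [this, neg_neg]

theorem colour_corner (c : Fin D.crossings) (k : Fin 4) :
    D.colour (c, k) = if k = 0 ∨ k = 2 then D.colour (c, 0) else -D.colour (c, 0) := by
  have h0 := D.colour_add_one c 0
  have h1 := D.colour_add_one c 1
  have h2 := D.colour_add_one c 2
  simp only [Fin.reduceAdd] at h0 h1 h2
  fin_cases k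
  · simp
  · simpa using h0
  · simp [h1, h0]
  · simp [h2, h1, h0]

/-! ### Circles of resolutions -/

/-- The end that is connected to a given one at a crossing of a resolution. -/
def turn (ξ : D.Cube) (p : D.End) : D.End :=
  (p.1, if ξ p.1 then ![3, 2, 1, 0] p.2 else ![1, 0, 3, 2] p.2)

@[simp]
theorem turn_turn (ξ : D.Cube) (p : D.End) : D.turn ξ (D.turn ξ p) = p := by
  obtain ⟨c, k⟩ := p
  by_cases h : ξ c = true <;> fin_cases k <;> simp [turn, h]

theorem colour_turn (ξ : D.Cube) (p : D.End) : D.colour (D.turn ξ p) = -D.colour p := by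
  obtain ⟨c, k⟩ := p
  rw [turn, D.colour_corner c k, D.colour_corner]
  by_cases h : ξ c = true <;> fin_cases k <;> simp [h]

theorem Joined.exists_end {ξ : D.Cube} {e e' : Fin D.arcs} (h : D.Joined ξ e e') :
    ∃ p, D.arcOf p = e ∧ D.arcOf (D.turn ξ p) = e' := by
  obtain ⟨c, hc⟩ := h
  by_cases hξ : ξ c = true
  · simp only [hξ, if_true] at hc
    rcases hc with ⟨rfl, rfl⟩ | ⟨rfl, rfl⟩
    · exact ⟨(c, 1), rfl, by simp [turn, arcOf, hξ]⟩
    · exact ⟨(c, 3), rfl, by simp [turn, arcOf, hξ]⟩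
  · simp only [hξ] at hc
    rcases hc with ⟨rfl, rfl⟩ | ⟨rfl, rfl⟩
    · exact ⟨(c, 0), rfl, by simp [turn, arcOf, hξ]⟩
    · exact ⟨(c, 2), rfl, by simp [turn, arcOf, hξ]⟩

theorem circ_turn (ξ : D.Cube) (p : D.End) :
    D.circ ξ (D.arcOf (D.turn ξ p)) = D.circ ξ (D.arcOf p) := by
  obtain ⟨c, k⟩ := p
  by_cases hξ : ξ c = true
  · have h1 : D.circ ξ (D.arc c 1) = D.circ ξ (D.arc c 2) :=
      Quot.sound ⟨c, by simp [hξ]⟩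
    have h2 : D.circ ξ (D.arc c 3) = D.circ ξ (D.arc c 0) :=
      Quot.sound ⟨c, by simp [hξ]⟩
    fin_cases k <;> simp [turn, arcOf, hξ, h1, h2]
  · have h1 : D.circ ξ (D.arc c 0) = D.circ ξ (D.arc c 1) :=
      Quot.sound ⟨c, by simp [hξ]⟩
    have h2 : D.circ ξ (D.arc c 2) = D.circ ξ (D.arc c 3) :=
      Quot.sound ⟨c, by simp [hξ]⟩
    fin_cases k <;> simp [turn, arcOf, hξ, h1, h2]

variable {D} in
theorem eq_of_circ_eq {ξ : D.Cube} {α : Sort*} (F : Fin D.arcs → α)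
    (hF : ∀ p, F (D.arcOf (D.turn ξ p)) = F (D.arcOf p)) {e e' : Fin D.arcs}
    (h : D.circ ξ e = D.circ ξ e') : F e = F e' := by
  have hF' : ∀ e e', D.Joined ξ e e' → F e = F e' := by
    intro e e' hj
    obtain ⟨p, rfl, rfl⟩ := hj.exists_end
    exact (hF p).symm
  exact congrArg (Quot.lift F hF') h

/-! ### Walking along the circles -/

/-- The ends at which the alternating orientation enters a crossing. -/
abbrev Head : Type := {p : D.End // D.colour p = 1}

/-- The permutation whose cycles are the circles. -/
def walk (ξ : D.Cube) : Equiv.Perm D.Head where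
  toFun p := ⟨D.partner (D.turn ξ p), by rw [D.colour_partner, D.colour_turn, neg_neg, p.2]⟩
  invFun p := ⟨D.turn ξ (D.partner p), by rw [D.colour_turn, D.colour_partner, neg_neg, p.2]⟩
  left_inv p := Subtype.ext (by simp [D.partner_partner])
  right_inv p := Subtype.ext (by simp [D.partner_partner])

theorem walk_apply (ξ : D.Cube) (p : D.Head) :
    (D.walk ξ p : D.End) = D.partner (D.turn ξ p) := rfl

variable {D} in
theorem Head.ext_arc {p q : D.Head} (h : D.arcOf p = D.arcOf q) : p = q := by
  rcases D.eq_or_eq_partner h with h' | h'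
  · exact Subtype.ext h'.symm
  · have := q.2
    rw [h', D.colour_partner, p.2] at this
    exact absurd this (by decide)

theorem circ_walk (ξ : D.Cube) (p : D.Head) :
    D.circ ξ (D.arcOf (D.walk ξ p)) = D.circ ξ (D.arcOf p) := by
  rw [walk_apply, D.arcOf_partner, D.circ_turn]

/-- Reachability along `walk` is well defined on arcs, since an arc has only one head, and it is
invariant under every turn; so it is constant on circles. -/
theorem circ_eq_iff_sameCycle (ξ : D.Cube) (p q : D.Head) :
    D.circ ξ (D.arcOf p) = D.circ ξ (D.arcOf q) ↔ (D.walk ξ).SameCycle p q := by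
  constructor
  · intro h
    let F : Fin D.arcs → Prop := fun e => ∀ r : D.Head, D.arcOf r = e → (D.walk ξ).SameCycle p r
    have hFr : ∀ r : D.Head, F (D.arcOf r) ↔ (D.walk ξ).SameCycle p r := by
      intro r
      exact ⟨fun hr => hr r rfl, fun hr s hs => by rwa [Head.ext_arc hs]⟩
    have hpos : ∀ r : D.Head, F (D.arcOf (D.turn ξ r)) = F (D.arcOf r) := by
      intro r
      rw [← D.arcOf_partner (D.turn ξ r), ← D.walk_apply, hFr, hFr,
        Equiv.Perm.sameCycle_apply_right]
    have hF : ∀ r, F (D.arcOf (D.turn ξ r)) = F (D.arcOf r) := by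
      intro r
      rcases Int.units_eq_one_or (D.colour r) with hr | hr
      · exact hpos ⟨r, hr⟩
      · have := hpos ⟨D.turn ξ r, by rw [D.colour_turn, hr, neg_neg]⟩
        simp only [turn_turn] at this
        exact this.symm
    have := eq_of_circ_eq F hF h
    rw [← hFr, ← this]
    exact (hFr p).2 (Equiv.Perm.SameCycle.refl _ _)
  · intro h
    obtain ⟨n, rfl⟩ := h.exists_nat_pow_eq
    induction n with
    | zero => rfl
    | succ n ih =>
      rw [pow_succ', Equiv.Perm.mul_apply, D.circ_walk]
      exact ih ⟨n, by simp⟩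

/-! ### Saddles -/

variable {D}

theorem IsEdge.apply_false {c : Fin D.crossings} {ξ ξ' : D.Cube} (h : D.IsEdge c ξ ξ') :
    ξ c = false := h.1

theorem IsEdge.apply_true {c : Fin D.crossings} {ξ ξ' : D.Cube} (h : D.IsEdge c ξ ξ') :
    ξ' c = true := by rw [h.2]; simp

theorem IsEdge.apply_of_ne {c d : Fin D.crossings} {ξ ξ' : D.Cube} (h : D.IsEdge c ξ ξ')
    (hd : d ≠ c) : ξ' d = ξ d := by rw [h.2, Function.update_of_ne hd]

theorem circ_of_false {c : Fin D.crossings} {ξ : D.Cube} (h : ξ c = false) :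
    D.circ ξ (D.arc c 0) = D.circ ξ (D.arc c 1) ∧ D.circ ξ (D.arc c 2) = D.circ ξ (D.arc c 3) :=
  ⟨Quot.sound ⟨c, by simp [h]⟩, Quot.sound ⟨c, by simp [h]⟩⟩

theorem circ_of_true {c : Fin D.crossings} {ξ : D.Cube} (h : ξ c = true) :
    D.circ ξ (D.arc c 1) = D.circ ξ (D.arc c 2) ∧ D.circ ξ (D.arc c 3) = D.circ ξ (D.arc c 0) :=
  ⟨Quot.sound ⟨c, by simp [h]⟩, Quot.sound ⟨c, by simp [h]⟩⟩

theorem IsEdge.turn_of_ne {c : Fin D.crossings} {ξ ξ' : D.Cube} (h : D.IsEdge c ξ ξ')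
    {p : D.End} (hp : p.1 ≠ c) : D.turn ξ' p = D.turn ξ p := by
  simp only [turn, h.apply_of_ne hp]

/-- The alternating orientation enters a crossing at two opposite ends and leaves at the other two;
the two resolutions differ in which entrance leads to which exit. -/
theorem IsEdge.walk_eq {c : Fin D.crossings} {ξ ξ' : D.Cube} (h : D.IsEdge c ξ ξ')
    {k : Fin 4} (h0 : D.colour (c, k) = 1) (h2 : D.colour (c, k + 2) = 1) :
    D.walk ξ' = D.walk ξ * Equiv.swap ⟨(c, k), h0⟩ ⟨(c, k + 2), h2⟩ := by
  ext1 p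
  rw [Equiv.Perm.mul_apply]
  apply Subtype.ext
  by_cases e0 : p = ⟨(c, k), h0⟩
  · rw [e0, Equiv.swap_apply_left]
    simp only [walk_apply, turn, h.apply_false, h.apply_true, if_true]
    fin_cases k <;> rfl
  by_cases e2 : p = ⟨(c, k + 2), h2⟩
  · rw [e2, Equiv.swap_apply_right]
    simp only [walk_apply, turn, h.apply_false, h.apply_true, if_true]
    fin_cases k <;> rfl
  rw [Equiv.swap_apply_of_ne_of_ne e0 e2]
  simp only [walk_apply]
  rw [h.turn_of_ne]
  intro hp
  obtain ⟨⟨d, j⟩, hj⟩ := p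
  obtain rfl : d = c := hp
  simp only [Subtype.mk.injEq, Prod.mk.injEq, true_and] at e0 e2
  rw [D.colour_corner] at h0 h2 hj
  revert e0 e2 h0 h2 hj
  generalize D.colour (d, 0) = x
  revert x j k
  decide

/-- Multiplication by a transposition either cuts a cycle or joins two. This excludes saddles that
turn one circle into one circle, and it rests on planarity through the alternating orientation. -/
theorem IsEdge.circ_ne_iff {c : Fin D.crossings} {ξ ξ' : D.Cube} (h : D.IsEdge c ξ ξ') :
    D.circ ξ (D.arc c 0) = D.circ ξ (D.arc c 2) ↔ D.circ ξ' (D.arc c 1) ≠ D.circ ξ' (D.arc c 3) := by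
  obtain ⟨hf0, hf2⟩ := circ_of_false h.apply_false
  obtain ⟨ht1, ht3⟩ := circ_of_true h.apply_true
  have key : ∀ k : Fin 4, D.colour (c, k) = 1 → D.colour (c, k + 2) = 1 →
      (D.circ ξ (D.arc c k) = D.circ ξ (D.arc c (k + 2)) ↔
        D.circ ξ' (D.arc c k) ≠ D.circ ξ' (D.arc c (k + 2))) := by
    intro k h0 h2
    have e := D.circ_eq_iff_sameCycle ξ ⟨(c, k), h0⟩ ⟨(c, k + 2), h2⟩
    have e' := D.circ_eq_iff_sameCycle ξ' ⟨(c, k), h0⟩ ⟨(c, k + 2), h2⟩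
    simp only [arcOf] at e e'
    rw [e, ne_eq, e', h.walk_eq h0 h2]
    refine ⟨fun hs => hs.not_mul_swap ?_, fun hs => ?_⟩
    · intro hk
      simp at hk
    · by_contra hn
      exact hs (Equiv.Perm.sameCycle_mul_swap hn)
  rcases Int.units_eq_one_or (D.colour (c, 0)) with h0 | h0
  · have := key 0 h0 (by rw [D.colour_corner]; simpa using h0)
    rw [zero_add] at this
    rw [this, ht1, ← ht3]
    exact ne_comm
  · have := key 1 (by rw [D.colour_corner]; simp [h0]) (by rw [D.colour_corner]; simp [h0])
    simp only [Fin.reduceAdd] at this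
    rw [hf0, hf2, this]

/-- Turns away from `c` are common to both resolutions of an edge in this direction, so `F` may be
built from the circles of the other resolution. -/
theorem eq_of_circ_eq_of_crossing {ξ : D.Cube} (c : Fin D.crossings) {α : Sort*}
    (F : Fin D.arcs → α) (b : α) (hc : ∀ k, F (D.arc c k) = b)
    (hF : ∀ p : D.End, p.1 ≠ c → F (D.arcOf (D.turn ξ p)) = F (D.arcOf p)) {e e' : Fin D.arcs}
    (h : D.circ ξ e = D.circ ξ e') : F e = F e' := by
  refine eq_of_circ_eq F (fun p => ?_) h
  by_cases hp : p.1 = c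
  · obtain ⟨d, k⟩ := p
    obtain rfl : d = c := hp
    exact (hc _).trans (hc _).symm
  · exact hF p hp

/-- The arcs of the circles that take part in a saddle. -/
theorem IsEdge.mem_iff {c : Fin D.crossings} {ξ ξ' : D.Cube} (h : D.IsEdge c ξ ξ')
    (e : Fin D.arcs) :
    (D.circ ξ e = D.circ ξ (D.arc c 0) ∨ D.circ ξ e = D.circ ξ (D.arc c 2)) ↔
      (D.circ ξ' e = D.circ ξ' (D.arc c 1) ∨ D.circ ξ' e = D.circ ξ' (D.arc c 3)) := by
  obtain ⟨hf0, hf2⟩ := circ_of_false h.apply_false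
  obtain ⟨ht1, ht3⟩ := circ_of_true h.apply_true
  constructor
  · let F : Fin D.arcs → Prop := fun e =>
      D.circ ξ' e = D.circ ξ' (D.arc c 1) ∨ D.circ ξ' e = D.circ ξ' (D.arc c 3)
    have hc : ∀ k, F (D.arc c k) = True := by
      intro k
      refine eq_true ?_
      fin_cases k
      exacts [Or.inr ht3.symm, Or.inl rfl, Or.inl ht1.symm, Or.inr rfl]
    have hF : ∀ p : D.End, p.1 ≠ c → F (D.arcOf (D.turn ξ p)) = F (D.arcOf p) := by
      intro p hp
      simp only [F, ← h.turn_of_ne hp, D.circ_turn]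
    rintro (he | he)
    · exact of_eq_true ((eq_of_circ_eq_of_crossing c F True hc hF he).trans (hc 0))
    · exact of_eq_true ((eq_of_circ_eq_of_crossing c F True hc hF he).trans (hc 2))
  · let F : Fin D.arcs → Prop := fun e =>
      D.circ ξ e = D.circ ξ (D.arc c 0) ∨ D.circ ξ e = D.circ ξ (D.arc c 2)
    have hc : ∀ k, F (D.arc c k) = True := by
      intro k
      refine eq_true ?_
      fin_cases k
      exacts [Or.inl rfl, Or.inl hf0.symm, Or.inr rfl, Or.inr hf2.symm]
    have hF : ∀ p : D.End, p.1 ≠ c → F (D.arcOf (D.turn ξ' p)) = F (D.arcOf p) := by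
      intro p hp
      simp only [F, h.turn_of_ne hp, D.circ_turn]
    rintro (he | he)
    · exact of_eq_true ((eq_of_circ_eq_of_crossing c F True hc hF he).trans (hc 1))
    · exact of_eq_true ((eq_of_circ_eq_of_crossing c F True hc hF he).trans (hc 3))

/-- Away from the saddle, the circles of both resolutions are the same. -/
theorem IsEdge.circ_eq_iff {c : Fin D.crossings} {ξ ξ' : D.Cube} (h : D.IsEdge c ξ ξ')
    {e : Fin D.arcs} (h0 : D.circ ξ e ≠ D.circ ξ (D.arc c 0))
    (h2 : D.circ ξ e ≠ D.circ ξ (D.arc c 2)) (e' : Fin D.arcs) :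
    D.circ ξ e' = D.circ ξ e ↔ D.circ ξ' e' = D.circ ξ' e := by
  obtain ⟨hf0, hf2⟩ := circ_of_false h.apply_false
  obtain ⟨ht1, ht3⟩ := circ_of_true h.apply_true
  have h13 := (not_congr (h.mem_iff e)).1 (not_or.2 ⟨h0, h2⟩)
  rw [not_or] at h13
  constructor
  · let F : Fin D.arcs → Prop := fun f => D.circ ξ' f = D.circ ξ' e
    have hc : ∀ k, F (D.arc c k) = False := by
      intro k
      refine eq_false fun hk => ?_
      fin_cases k
      · exact h13.2 (hk.symm.trans ht3.symm)
      · exact h13.1 hk.symm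
      · exact h13.1 (hk.symm.trans ht1.symm)
      · exact h13.2 hk.symm
    have hF : ∀ p : D.End, p.1 ≠ c → F (D.arcOf (D.turn ξ p)) = F (D.arcOf p) := by
      intro p hp
      simp only [F, ← h.turn_of_ne hp, D.circ_turn]
    intro he
    exact of_eq_true ((eq_of_circ_eq_of_crossing c F False hc hF he).trans (eq_true rfl))
  · let F : Fin D.arcs → Prop := fun f => D.circ ξ f = D.circ ξ e
    have hc : ∀ k, F (D.arc c k) = False := by
      intro k
      refine eq_false fun hk => ?_
      fin_cases k
      · exact h0 hk.symm
      · exact h0 (hk.symm.trans hf0.symm)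
      · exact h2 hk.symm
      · exact h2 (hk.symm.trans hf2.symm)
    have hF : ∀ p : D.End, p.1 ≠ c → F (D.arcOf (D.turn ξ' p)) = F (D.arcOf p) := by
      intro p hp
      simp only [F, h.turn_of_ne hp, D.circ_turn]
    intro he
    exact of_eq_true ((eq_of_circ_eq_of_crossing c F False hc hF he).trans (eq_true rfl))

end LinkDiagram

end
-- The twist of the odd cube, and the exceptional faces.
noncomputable section

/-! ### Exterior algebras -/

namespace ExteriorAlgebra

variable {R M N : Type*} [CommRing R] [AddCommGroup M] [AddCommGroup N] [Module R M] [Module R N]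

/-- The maps agree modulo `d`, and left multiplication by `ι d` does not see the difference, because
`ι d` anticommutes with generators and squares to zero. -/
theorem ι_mul_map_congr {f g : M →ₗ[R] N} {d : N} (h : ∀ x, f x - g x ∈ Submodule.span R {d})
    (v : ExteriorAlgebra R M) : ι R d * map f v = ι R d * map g v := by
  induction v using CliffordAlgebra.left_induction with
  | algebraMap r => simp only [AlgHom.commutes]
  | add x y hx hy => simp only [map_add, mul_add, hx, hy]
  | ι_mul x m hx =>
    obtain ⟨r, hr⟩ := Submodule.mem_span_singleton.1 (h m)
    have hfm : f m = g m + r • d := by rw [hr]; abel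
    have hs (y : N) : ι R d * ι R y = -(ι R y * ι R d) :=
      eq_neg_of_add_eq_zero_left (ι_add_mul_swap d y)
    change ι R d * map f (ι R m * x) = ι R d * map g (ι R m * x)
    rw [map_mul, map_mul, map_apply_ι, map_apply_ι, ← mul_assoc, ← mul_assoc, hfm, map_add,
      map_smul, mul_add, mul_smul_comm, ι_sq_zero, smul_zero, add_zero, hs, neg_mul, neg_mul,
      mul_assoc, mul_assoc, hx]

end ExteriorAlgebra

namespace LinkDiagram

variable (D : LinkDiagram)

/-! ### Connected components of the diagram -/

/-- One arc is chosen in each connected component. It normalizes the twist, which is otherwise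
prescribed only on differences within a component. -/
def base (e : Fin D.arcs) : Fin D.arcs :=
  Quot.out (Quot.mk (fun e e' => ∃ c k l, e = D.arc c k ∧ e' = D.arc c l) e)

theorem base_arc (c : Fin D.crossings) (k l : Fin 4) : D.base (D.arc c k) = D.base (D.arc c l) :=
  congrArg Quot.out (Quot.sound ⟨c, k, l, rfl, rfl⟩)

theorem base_base (e : Fin D.arcs) : D.base (D.base e) = D.base e :=
  congrArg Quot.out (Quot.out_eq _)

variable {D} in
theorem eq_of_base {A : Type*} [AddCommGroup A] {g h : Fin D.arcs → A}
    (hb : ∀ e, g (D.base e) = h (D.base e))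
    (hd : ∀ c k, g (D.arc c k) - g (D.arc c (k + 1)) = h (D.arc c k) - h (D.arc c (k + 1))) :
    g = h := by
  have hstep : ∀ c k, g (D.arc c k) - h (D.arc c k) = g (D.arc c 0) - h (D.arc c 0) := by
    intro c k
    have h0 := hd c 0
    have h1 := hd c 1
    have h2 := hd c 2
    simp only [Fin.reduceAdd] at h0 h1 h2
    rw [sub_eq_sub_iff_sub_eq_sub] at h0 h1 h2
    fin_cases k
    · rfl
    · exact h0.symm
    · exact (h0.trans h1).symm
    · exact (h0.trans (h1.trans h2)).symm
  have key : ∀ e e' : Fin D.arcs, (∃ c k l, e = D.arc c k ∧ e' = D.arc c l) →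
      g e - h e = g e' - h e' := by
    rintro _ _ ⟨c, k, l, rfl, rfl⟩
    rw [hstep c k, hstep c l]
  ext e
  have h1 : Quot.lift (fun e => g e - h e) key
      (Quot.mk (fun e e' => ∃ c k l, e = D.arc c k ∧ e' = D.arc c l) (D.base e)) = 0 :=
    sub_eq_zero.2 (hb e)
  rw [base, Quot.out_eq] at h1
  exact sub_eq_zero.1 h1

/-! ### A linear involution that separates the two colours -/

/-- The circle `y` is a cycle modulo 2, so it bounds a chain of regions, with indicator `F`. An arc
has one side in this chain if it lies on `y`, and none or both otherwise; the position is this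
number of sides, times a sign `s`. Passing a corner changes it by one when exactly one of the two
arcs is on `y`, and `s` makes the direction of the change agree with the colour. -/
theorem exists_position (ξ : D.Cube) (y : D.Circle ξ) : ∃ pos : Fin D.arcs → ℤ, ∀ c k,
    pos (D.arc c k) - pos (D.arc c (k + 1)) = D.colour (c, k) *
      ((if D.circ ξ (D.arc c k) = y then 1 else 0) -
        (if D.circ ξ (D.arc c (k + 1)) = y then 1 else 0)) := by
  classical
  let u : Fin D.arcs → ZMod 2 := fun e => if D.circ ξ e = y then 1 else 0
  have hu : ∀ c, ∑ k, u (D.arc c k) = 0 := by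
    intro c
    have key : ∀ a b : ZMod 2, a + a + b + b = 0 := by decide
    have key' : ∀ a b : ZMod 2, a + b + b + a = 0 := by decide
    rw [Fin.sum_univ_four]
    by_cases hc : ξ c = true
    · obtain ⟨h1, h2⟩ := D.circ_of_true hc
      simp only [u, h1, h2]
      exact key' _ _
    · obtain ⟨h1, h2⟩ := D.circ_of_false (Bool.eq_false_iff.2 hc)
      simp only [u, h1, h2]
      exact key _ _
  obtain ⟨f, hf⟩ := D.exists_region_function u hu
  let prev : D.End → D.End := fun p => (p.1, p.2 - 1)
  let F : D.End → ℤ := fun p => if f (D.region p) = 0 then 0 else 1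
  have hF01 : ∀ p, F p = 0 ∨ F p = 1 := fun p => by
    by_cases h : f (D.region p) = 0 <;> simp [F, h]
  have hF : ∀ p, D.circ ξ (D.arcOf p) = y ↔ F p ≠ F (prev p) := by
    intro p
    have key : ∀ a b : ZMod 2, ∀ P : Prop, ∀ _ : Decidable P, a + b = (if P then 1 else 0) →
        (P ↔ (if a = 0 then (0 : ℤ) else 1) ≠ if b = 0 then 0 else 1) := by
      intro a b P _
      by_cases hP : P <;> simp only [hP, if_true, if_false] <;> revert a b <;> decide
    exact key _ _ _ _ (hf p)
  have hFp : ∀ p, F (D.partner p) = F (prev p) := fun p => by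
    simp only [F, prev, D.region_partner]
  have hFp' : ∀ p, F (prev (D.partner p)) = F p := fun p => by
    simp only [F, prev, D.region_partner_sub]
  -- At an end on `y` this records on which side the chain lies with respect to the alternating
  -- orientation. It stays the same all along `y`.
  let S : D.End → ℤ := fun p => D.colour p * (F (prev p) - F p)
  have hSp : ∀ p, S (D.partner p) = S p := by
    intro p
    simp only [S, hFp, hFp', D.colour_partner]
    push_cast
    ring
  have hSarc : ∀ p q, D.arcOf p = D.arcOf q → S p = S q := by
    intro p q h
    rcases D.eq_or_eq_partner h with rfl | rfl
    · rfl
    · exact (hSp p).symm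
  have hprev : ∀ (c : Fin D.crossings) (k : Fin 4), prev (c, k + 1) = (c, k) := fun c k => by
    simp [prev]
  have hSnext : ∀ (c : Fin D.crossings) (k : Fin 4), D.circ ξ (D.arc c k) = y →
      D.circ ξ (D.arc c (k + 1)) = y → S (c, k + 1) = S (c, k) := by
    intro c k h1 h2
    have h1' := (hF (c, k)).1 h1
    have h2' := (hF (c, k + 1)).1 h2
    simp only [S, hprev, D.colour_add_one] at h2' ⊢
    rcases hF01 (c, k) with h | h <;> rcases hF01 (prev (c, k)) with h' | h' <;>
      rcases hF01 (c, k + 1) with h'' | h'' <;> simp [h, h', h''] at h1' h2' ⊢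
  have hSturn : ∀ p, D.circ ξ (D.arcOf p) = y → S (D.turn ξ p) = S p := by
    rintro ⟨c, k⟩ h
    have h' : D.circ ξ (D.arcOf (D.turn ξ (c, k))) = y := by rw [D.circ_turn, h]
    by_cases hc : ξ c = true <;> fin_cases k <;> simp [turn, hc, arcOf] at h h' ⊢
    · exact (hSnext c 3 h' h).symm
    · exact hSnext c 1 h h'
    · exact (hSnext c 1 h' h).symm
    · exact hSnext c 3 h h'
    · exact hSnext c 0 h h'
    · exact (hSnext c 0 h' h).symm
    · exact hSnext c 2 h h'
    · exact (hSnext c 2 h' h).symm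
  obtain ⟨s, hs⟩ : ∃ s, ∀ p, D.circ ξ (D.arcOf p) = y → S p = s := by
    by_cases hex : ∃ p0, D.circ ξ (D.arcOf p0) = y
    · obtain ⟨p0, hp0⟩ := hex
      refine ⟨S p0, fun p hp => ?_⟩
      let G : Fin D.arcs → Prop := fun e =>
        D.circ ξ e = y → ∀ q, D.arcOf q = e → S q = S p0
      have hGq : ∀ q, D.circ ξ (D.arcOf q) = y → (G (D.arcOf q) ↔ S q = S p0) := fun q hq =>
        ⟨fun h => h hq q rfl, fun h _ r hr => (hSarc r q hr).trans h⟩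
      have hG : ∀ q, G (D.arcOf (D.turn ξ q)) = G (D.arcOf q) := by
        intro q
        by_cases hq : D.circ ξ (D.arcOf q) = y
        · rw [hGq q hq, hGq _ (by rw [D.circ_turn, hq]), hSturn q hq]
        · have hq' : D.circ ξ (D.arcOf (D.turn ξ q)) ≠ y := by rwa [D.circ_turn]
          simp only [G, hq, hq', false_imp_iff]
      have := D.eq_of_circ_eq G hG (hp0.trans hp.symm)
      rw [← hGq p hp, ← this]
      exact (hGq p0 hp0).2 rfl
    · exact ⟨0, fun p hp => absurd ⟨p, hp⟩ hex⟩
  -- An arc without ends occurs at no corner, so its value is irrelevant.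
  let pos : Fin D.arcs → ℤ := fun e =>
    if h : ∃ p, D.arcOf p = e then s * (F h.choose + F (prev h.choose)) else 0
  have hpos : ∀ p, pos (D.arcOf p) = s * (F p + F (prev p)) := by
    intro p
    have h : ∃ q, D.arcOf q = D.arcOf p := ⟨p, rfl⟩
    have h1 : pos (D.arcOf p) = s * (F h.choose + F (prev h.choose)) := dif_pos h
    rw [h1]
    rcases D.eq_or_eq_partner h.choose_spec.symm with h2 | h2
    · rw [h2]
    · rw [h2, hFp, hFp', add_comm (F p)]
  refine ⟨pos, fun c k => ?_⟩
  have e1 := hpos (c, k)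
  have e2 := hpos (c, k + 1)
  have f1 := hF (c, k)
  have f2 := hF (c, k + 1)
  have s1 := hs (c, k)
  have s2 := hs (c, k + 1)
  simp only [arcOf, hprev, S, D.colour_add_one] at e1 e2 f1 f2 s1 s2
  rw [e1, e2]
  simp only [f1, f2] at s1 s2 ⊢
  rcases hF01 (c, k) with h | h <;> rcases hF01 (prev (c, k)) with h' | h' <;>
      rcases hF01 (c, k + 1) with h'' | h'' <;> simp [h, h', h''] at s1 s2 ⊢ <;> omega

/-- The basis element of the circle of an arc. -/
def vec (ξ : D.Cube) (e : Fin D.arcs) : D.Circle ξ →₀ ℤ := Finsupp.single (D.circ ξ e) 1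

/-- Each coordinate of the prescribed differences is integrated by `exists_position`, starting from
the base arcs. The resulting function of arcs descends to circles, since the prescribed difference
vanishes at a corner between two arcs of one circle. -/
theorem exists_twist (ξ : D.Cube) : ∃ γ : (D.Circle ξ →₀ ℤ) →ₗ[ℤ] (D.Circle ξ →₀ ℤ),
    (∀ e, γ (D.vec ξ (D.base e)) = D.vec ξ (D.base e)) ∧
    ∀ c k, γ (D.vec ξ (D.arc c k) - D.vec ξ (D.arc c (k + 1))) =
      (D.colour (c, k) : ℤ) • (D.vec ξ (D.arc c k) - D.vec ξ (D.arc c (k + 1))) := by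
  choose pos hpos using D.exists_position ξ
  let g : Fin D.arcs → (D.Circle ξ →₀ ℤ) := fun e =>
    D.vec ξ (D.base e) +
      Finsupp.equivFunOnFinite.symm (fun y => pos y e - pos y (D.base e))
  have hg : ∀ c k, g (D.arc c k) - g (D.arc c (k + 1)) =
      (D.colour (c, k) : ℤ) • (D.vec ξ (D.arc c k) - D.vec ξ (D.arc c (k + 1))) := by
    intro c k
    ext y
    have := hpos y c k
    simp only [g, D.base_arc c (k + 1) k, vec, Finsupp.sub_apply, Finsupp.add_apply,
      Finsupp.smul_apply, Finsupp.single_apply, Finsupp.equivFunOnFinite_symm_apply_apply,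
      smul_eq_mul]
    rw [← this]
    ring
  have hgc : ∀ c k, D.circ ξ (D.arc c k) = D.circ ξ (D.arc c (k + 1)) →
      g (D.arc c k) = g (D.arc c (k + 1)) := by
    intro c k h
    have := hg c k
    rw [vec, vec, h, sub_self, smul_zero] at this
    exact sub_eq_zero.1 this
  have hgt : ∀ p, g (D.arcOf (D.turn ξ p)) = g (D.arcOf p) := by
    rintro ⟨c, k⟩
    have h := D.circ_turn ξ (c, k)
    by_cases hc : ξ c = true <;> fin_cases k <;> simp [turn, hc, arcOf] at h ⊢
    · exact hgc c 3 h
    · exact (hgc c 1 h.symm).symm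
    · exact hgc c 1 h
    · exact (hgc c 3 h.symm).symm
    · exact (hgc c 0 h.symm).symm
    · exact hgc c 0 h
    · exact (hgc c 2 h.symm).symm
    · exact hgc c 2 h
  have hgout : ∀ e, g (Quot.out (D.circ ξ e)) = g e := fun e =>
    D.eq_of_circ_eq g hgt (Quot.out_eq _)
  refine ⟨Finsupp.linearCombination ℤ fun x => g (Quot.out x), fun e => ?_, fun c k => ?_⟩
  · rw [vec, Finsupp.linearCombination_single, one_smul, hgout]
    ext y
    simp [g, D.base_base, vec]
  · rw [map_sub, ← hg]
    simp [vec, hgout]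

def twist (ξ : D.Cube) : (D.Circle ξ →₀ ℤ) →ₗ[ℤ] (D.Circle ξ →₀ ℤ) := (D.exists_twist ξ).choose

theorem twist_base (ξ : D.Cube) (e : Fin D.arcs) :
    D.twist ξ (D.vec ξ (D.base e)) = D.vec ξ (D.base e) := (D.exists_twist ξ).choose_spec.1 e

theorem twist_corner (ξ : D.Cube) (c : Fin D.crossings) (k : Fin 4) :
    D.twist ξ (D.vec ξ (D.arc c k) - D.vec ξ (D.arc c (k + 1))) =
      (D.colour (c, k) : ℤ) • (D.vec ξ (D.arc c k) - D.vec ξ (D.arc c (k + 1))) :=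
  (D.exists_twist ξ).choose_spec.2 c k

variable {D} in
theorem linearMap_ext_vec {ξ : D.Cube} {A : Type*} [AddCommGroup A] [Module ℤ A]
    {f g : (D.Circle ξ →₀ ℤ) →ₗ[ℤ] A} (h : ∀ e, f (D.vec ξ e) = g (D.vec ξ e)) : f = g := by
  ext x
  obtain ⟨e, rfl⟩ := Quot.exists_rep x
  exact h e

theorem twist_comp_twist (ξ : D.Cube) : D.twist ξ ∘ₗ D.twist ξ = LinearMap.id := by
  refine linearMap_ext_vec fun e => ?_
  refine congrFun (eq_of_base (g := fun e => D.twist ξ (D.twist ξ (D.vec ξ e)))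
    (h := fun e => D.vec ξ e) (fun e => ?_) (fun c k => ?_)) e
  · simp only [twist_base]
  · rw [← map_sub, ← map_sub, twist_corner, map_smul, twist_corner, smul_smul, ← Units.val_mul,
      Int.units_mul_self, Units.val_one, one_smul]

variable {D}

theorem IsEdge.twist_sub {c : Fin D.crossings} {ξ ξ' : D.Cube} (h : D.IsEdge c ξ ξ') :
    D.twist ξ' (D.vec ξ' (D.arc c 1) - D.vec ξ' (D.arc c 3)) =
      (D.colour (c, 0) : ℤ) • (D.vec ξ' (D.arc c 1) - D.vec ξ' (D.arc c 3)) := by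
  have h3 : D.vec ξ' (D.arc c 3) = D.vec ξ' (D.arc c 0) := by
    rw [vec, vec, (circ_of_true h.apply_true).2]
  have := D.twist_corner ξ' c 0
  rw [zero_add] at this
  rw [h3, ← neg_sub, map_neg, this, smul_neg]

theorem circ_carry (ξ ξ' : D.Cube) (e : Fin D.arcs) :
    ∃ e', D.circ ξ e' = D.circ ξ e ∧ D.carry ξ ξ' (D.circ ξ e) = D.circ ξ' e' :=
  ⟨Quot.out (D.circ ξ e), Quot.out_eq _, rfl⟩

theorem IsEdge.carry_of_ne {c : Fin D.crossings} {ξ ξ' : D.Cube} (h : D.IsEdge c ξ ξ')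
    {e : Fin D.arcs} (h0 : D.circ ξ e ≠ D.circ ξ (D.arc c 0))
    (h2 : D.circ ξ e ≠ D.circ ξ (D.arc c 2)) :
    D.carry ξ ξ' (D.circ ξ e) = D.circ ξ' e := by
  obtain ⟨e', h1, h3⟩ := circ_carry ξ ξ' e
  rw [h3, ← h.circ_eq_iff h0 h2, h1]

theorem IsEdge.carry_of_eq {c : Fin D.crossings} {ξ ξ' : D.Cube} (h : D.IsEdge c ξ ξ')
    {e : Fin D.arcs} (he : D.circ ξ e = D.circ ξ (D.arc c 0) ∨ D.circ ξ e = D.circ ξ (D.arc c 2)) :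
    D.carry ξ ξ' (D.circ ξ e) = D.circ ξ' (D.arc c 1) ∨
      D.carry ξ ξ' (D.circ ξ e) = D.circ ξ' (D.arc c 3) := by
  obtain ⟨e', h1, h3⟩ := circ_carry ξ ξ' e
  rw [h3, ← h.mem_iff, h1]
  exact he

theorem IsEdge.lmapDomain_sub_mem {c : Fin D.crossings} {ξ ξ' : D.Cube} (h : D.IsEdge c ξ ξ')
    (e : Fin D.arcs) :
    Finsupp.lmapDomain ℤ ℤ (D.carry ξ ξ') (D.vec ξ e) - D.vec ξ' e ∈
      Submodule.span ℤ {D.vec ξ' (D.arc c 1) - D.vec ξ' (D.arc c 3)} := by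
  have hv : Finsupp.mapDomain (D.carry ξ ξ') (D.vec ξ e) =
      Finsupp.single (D.carry ξ ξ' (D.circ ξ e)) 1 := Finsupp.mapDomain_single
  rw [Finsupp.lmapDomain_apply, hv]
  by_cases he : D.circ ξ e = D.circ ξ (D.arc c 0) ∨ D.circ ξ e = D.circ ξ (D.arc c 2)
  · have hd := Submodule.mem_span_singleton_self (R := ℤ)
      (D.vec ξ' (D.arc c 1) - D.vec ξ' (D.arc c 3))
    simp only [vec] at hd ⊢
    rcases h.carry_of_eq he with h1 | h1 <;> rcases (h.mem_iff e).1 he with h2 | h2 <;>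
      rw [h1, h2]
    · simp
    · exact hd
    · simpa using Submodule.neg_mem _ hd
    · simp
  · rw [not_or] at he
    rw [h.carry_of_ne he.1 he.2]
    simp [vec]

/-- Modulo the split vector, which the twist preserves up to sign, `carry` takes the circle of each
arc to the new circle of that arc. Both twists obey the same rules at base arcs and corners, so they
correspond. At a merge the split vector is zero and the twists commute with `carry` exactly. -/
theorem IsEdge.twist_lmapDomain {c : Fin D.crossings} {ξ ξ' : D.Cube} (h : D.IsEdge c ξ ξ')
    (x : D.Circle ξ →₀ ℤ) :
    (D.twist ξ' ∘ₗ Finsupp.lmapDomain ℤ ℤ (D.carry ξ ξ')) x -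
      (Finsupp.lmapDomain ℤ ℤ (D.carry ξ ξ') ∘ₗ D.twist ξ) x ∈
      Submodule.span ℤ {D.vec ξ' (D.arc c 1) - D.vec ξ' (D.arc c 3)} := by
  set L := Finsupp.lmapDomain ℤ ℤ (D.carry ξ ξ') with hL
  set S := Submodule.span ℤ {D.vec ξ' (D.arc c 1) - D.vec ξ' (D.arc c 3)} with hS
  have hLv : ∀ e, S.mkQ (L (D.vec ξ e)) = S.mkQ (D.vec ξ' e) := fun e =>
    (Submodule.Quotient.eq S).2 (h.lmapDomain_sub_mem e)
  have hST : ∀ v ∈ S, D.twist ξ' v ∈ S := by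
    intro v hv
    obtain ⟨r, rfl⟩ := Submodule.mem_span_singleton.1 hv
    rw [map_smul, h.twist_sub]
    exact S.smul_mem _ (S.smul_mem _ (Submodule.mem_span_singleton_self _))
  have hTL : ∀ e, S.mkQ (D.twist ξ' (L (D.vec ξ e))) = S.mkQ (D.twist ξ' (D.vec ξ' e)) := by
    intro e
    refine (Submodule.Quotient.eq S).2 ?_
    rw [← map_sub]
    exact hST _ (h.lmapDomain_sub_mem e)
  suffices hE : S.mkQ ∘ₗ D.twist ξ' ∘ₗ L = S.mkQ ∘ₗ L ∘ₗ D.twist ξ from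
    (Submodule.Quotient.eq S).1 (LinearMap.congr_fun hE x)
  refine linearMap_ext_vec fun e => ?_
  refine congrFun (eq_of_base (g := fun e => (S.mkQ ∘ₗ D.twist ξ' ∘ₗ L) (D.vec ξ e))
    (h := fun e => (S.mkQ ∘ₗ L ∘ₗ D.twist ξ) (D.vec ξ e)) (fun e => ?_) (fun c k => ?_)) e
  · simp only [LinearMap.comp_apply]
    rw [hTL, twist_base, twist_base, hLv]
  · simp only [LinearMap.comp_apply]
    rw [hTL, hTL, ← map_sub, ← map_sub, twist_corner, ← map_sub, ← map_sub, ← map_sub,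
      twist_corner, map_smul, map_smul, map_smul, map_sub, map_sub, map_sub, hLv, hLv]

variable (D) in
/-- The automorphism of the exterior algebra given by the twist. -/
def oddTwist (ξ : D.Cube) : D.OddModule ξ ≃ₗ[ℤ] D.OddModule ξ :=
  LinearEquiv.ofInvolutive (ExteriorAlgebra.map (D.twist ξ)).toLinearMap fun v => by
    rw [AlgHom.toLinearMap_apply, AlgHom.toLinearMap_apply, ← AlgHom.comp_apply,
      ExteriorAlgebra.map_comp_map, twist_comp_twist, ExteriorAlgebra.map_id, AlgHom.id_apply]

theorem oddTwist_apply (ξ : D.Cube) (v : D.OddModule ξ) :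
    D.oddTwist ξ v = ExteriorAlgebra.map (D.twist ξ) v := rfl

theorem circ_tail (arrow : Fin D.crossings → Bool) (c : Fin D.crossings) (ξ : D.Cube) :
    D.circ ξ (D.arc c (D.tail arrow c)) = D.circ ξ (D.arc c (D.tail arrow c + 2)) ↔
      D.circ ξ (D.arc c 0) = D.circ ξ (D.arc c 2) := by
  unfold tail
  split
  · exact eq_comm
  · rfl

/-- The sign by which the twist changes a saddle. -/
def twistSign (D : LinkDiagram) (ξ : D.Cube) (c : Fin D.crossings) : ℤˣ :=
  if D.circ ξ (D.arc c 0) = D.circ ξ (D.arc c 2) then D.colour (c, 0) else 1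

/-- In a split the twist scales the split vector by the colour of the crossing, and the failure of
the twists to commute with `carry` is annihilated by multiplication by that vector. -/
theorem IsEdge.oddTwist_oddEdge {c : Fin D.crossings} {ξ ξ' : D.Cube} (h : D.IsEdge c ξ ξ')
    (arrow : Fin D.crossings → Bool) (v : D.OddModule ξ) :
    D.oddTwist ξ' (D.oddEdge arrow c ξ ξ' v) =
      (D.twistSign ξ c : ℤ) • D.oddEdge arrow c ξ ξ' (D.oddTwist ξ v) := by
  by_cases hs : D.circ ξ (D.arc c 0) = D.circ ξ (D.arc c 2)
  · simp only [oddEdge, circ_tail, hs, ne_eq, not_true_eq_false, if_false, twistSign, if_true,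
      LinearMap.comp_apply, LinearMap.mulLeft_apply, AlgHom.toLinearMap_apply, oddTwist_apply,
      ← map_sub, map_mul, ExteriorAlgebra.map_apply_ι]
    have hd : D.twist ξ' (Finsupp.single (D.circ ξ' (D.arc c (D.tail arrow c + 1))) 1 -
        Finsupp.single (D.circ ξ' (D.arc c (D.tail arrow c + 3))) 1) =
        (D.colour (c, 0) : ℤ) • (Finsupp.single (D.circ ξ' (D.arc c (D.tail arrow c + 1))) 1 -
        Finsupp.single (D.circ ξ' (D.arc c (D.tail arrow c + 3))) 1) := by
      have := h.twist_sub
      simp only [vec] at this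
      unfold tail
      split
      · rw [← neg_sub, map_neg, smul_neg]
        exact congrArg Neg.neg this
      · exact this
    rw [hd, map_smul, smul_mul_assoc]
    congr 1
    have hspan : ∀ x, (D.twist ξ' ∘ₗ Finsupp.lmapDomain ℤ ℤ (D.carry ξ ξ')) x -
      (Finsupp.lmapDomain ℤ ℤ (D.carry ξ ξ') ∘ₗ D.twist ξ) x ∈
      Submodule.span ℤ {Finsupp.single (D.circ ξ' (D.arc c (D.tail arrow c + 1))) (1 : ℤ) -
        Finsupp.single (D.circ ξ' (D.arc c (D.tail arrow c + 3))) 1} := by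
      intro x
      have := h.twist_lmapDomain x
      simp only [vec] at this
      unfold tail
      split
      · rw [← neg_sub, ← Set.neg_singleton, Submodule.span_neg]
        exact this
      · exact this
    have := ExteriorAlgebra.ι_mul_map_congr hspan v
    rw [← ExteriorAlgebra.map_comp_map, ← ExteriorAlgebra.map_comp_map] at this
    exact this
  · have hd : D.vec ξ' (D.arc c 1) - D.vec ξ' (D.arc c 3) = 0 := by
      have := not_not.1 (mt h.circ_ne_iff.2 hs)
      rw [vec, vec, this, sub_self]
    simp only [oddEdge, circ_tail, hs, ne_eq, not_false_eq_true, if_true, twistSign, if_false,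
      AlgHom.toLinearMap_apply, oddTwist_apply, Units.val_one, one_smul]
    rw [← AlgHom.comp_apply, ← AlgHom.comp_apply, ExteriorAlgebra.map_comp_map,
      ExteriorAlgebra.map_comp_map]
    congr 2
    ext1 x
    ext1
    have := h.twist_lmapDomain (Finsupp.single x 1)
    rw [hd, Submodule.span_zero_singleton, Submodule.mem_bot, sub_eq_zero] at this
    exact this

/-! ### Ladybugs -/

theorem IsLadybug.mem {ξ ξ₁ : D.Cube} {c c' : Fin D.crossings} (hl : D.IsLadybug ξ c c')
    (h : D.IsEdge c ξ ξ₁) (k : Fin 4) (hk : k = 0 ∨ k = 2) :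
    D.circ ξ₁ (D.arc c' k) = D.circ ξ₁ (D.arc c 1) ∨
      D.circ ξ₁ (D.arc c' k) = D.circ ξ₁ (D.arc c 3) := by
  obtain ⟨h1, h2, h3⟩ := hl
  rw [← h.2] at h3
  rw [← h.mem_iff]
  have : D.circ ξ (D.arc c' k) = D.circ ξ (D.arc c' 2) := by
    rcases hk with rfl | rfl
    exacts [h2, rfl]
  rw [this]
  by_contra! hne
  exact h3 ((h.circ_eq_iff hne.1 hne.2 _).1 h2)

/-- The two circles created at `c` are the ones that meet at `c'`. The twist scales their difference
by the colour of `(c, 0)`, as seen at the type 1 resolution of `c`, and by that of `(c', 1)`, as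
seen at the type 0 resolution of `c'`. -/
theorem IsLadybug.colour {ξ ξ₁ : D.Cube} {c c' : Fin D.crossings} (hl : D.IsLadybug ξ c c')
    (h : D.IsEdge c ξ ξ₁) (hcc : c ≠ c') (h' : ξ c' = false) :
    D.colour (c', 0) = -D.colour (c, 0) := by
  have hne := hl.2.2
  rw [← h.2] at hne
  have hf := circ_of_false ((h.apply_of_ne hcc.symm).trans h')
  have h12 := D.twist_corner ξ₁ c' 1
  have hd := h.twist_sub
  have hd0 : D.vec ξ₁ (D.arc c' 0) - D.vec ξ₁ (D.arc c' 2) ≠ 0 := by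
    rw [sub_ne_zero, vec, vec, ne_eq, Finsupp.single_left_inj one_ne_zero]
    exact hne
  have e1 : D.vec ξ₁ (D.arc c' 1) = D.vec ξ₁ (D.arc c' 0) := by rw [vec, vec, hf.1]
  have hcol : D.colour (c', 1) = -D.colour (c', 0) := D.colour_add_one c' 0
  simp only [Fin.reduceAdd, e1, hcol] at h12
  have hd' : D.twist ξ₁ (D.vec ξ₁ (D.arc c' 0) - D.vec ξ₁ (D.arc c' 2)) =
      (D.colour (c, 0) : ℤ) • (D.vec ξ₁ (D.arc c' 0) - D.vec ξ₁ (D.arc c' 2)) := by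
    rcases hl.mem h 0 (Or.inl rfl) with h0 | h0 <;> rcases hl.mem h 2 (Or.inr rfl) with h2 | h2
    · exact absurd (h0.trans h2.symm) hne
    · simpa only [vec, h0, h2] using hd
    · rw [← neg_sub, map_neg, smul_neg]
      simpa only [vec, h0, h2] using congrArg Neg.neg hd
    · exact absurd (h0.trans h2.symm) hne
  rw [h12] at hd'
  have := smul_left_injective ℤ hd0 hd'
  exact (neg_eq_iff_eq_neg.1 (Units.ext this))

/-- After both saddles the arcs at `c` lie on a single circle, whereas a split as the last saddle
would separate them. -/
theorem IsLadybug.not_split {ξ ξ₁ ξ₂ ξ₁₂ : D.Cube} {c c' : Fin D.crossings}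
    (hl : D.IsLadybug ξ c c')
    (h1 : D.IsEdge c ξ ξ₁) (h12 : D.IsEdge c' ξ₁ ξ₁₂) (h21 : D.IsEdge c ξ₂ ξ₁₂) :
    D.circ ξ₂ (D.arc c 0) ≠ D.circ ξ₂ (D.arc c 2) := by
  intro hs
  have hne := hl.2.2
  rw [← h1.2] at hne
  have hm0 := hl.mem h1 0 (Or.inl rfl)
  have hm2 := hl.mem h1 2 (Or.inr rfl)
  have hs' := h21.circ_ne_iff.1 hs
  have hm' := not_not.1 (mt h12.circ_ne_iff.2 hne)
  have key : ∀ k, k = 1 ∨ k = 3 → D.circ ξ₁₂ (D.arc c k) = D.circ ξ₁₂ (D.arc c' 3) := by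
    intro k hk
    have : D.circ ξ₁ (D.arc c k) = D.circ ξ₁ (D.arc c' 0) ∨
        D.circ ξ₁ (D.arc c k) = D.circ ξ₁ (D.arc c' 2) := by
      rcases hk with rfl | rfl <;> rcases hm0 with h | h <;> rcases hm2 with h' | h' <;>
        first
        | exact Or.inl h.symm
        | exact Or.inr h'.symm
        | exact absurd (h.trans h'.symm) hne
    rcases (h12.mem_iff _).1 this with h | h
    · exact h.trans hm'
    · exact h
  exact hs' ((key 1 (Or.inl rfl)).trans (key 3 (Or.inr rfl)).symm)

end LinkDiagram

end
-- Signs of permutations of factors, and monomial bases.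
noncomputable section

/-! ### Changing the order of the factors of a product -/

section Reordering

variable {I : Type*}

/-- The product of `lam x y` over all pairs whose order is reversed from `r` to `r'`. -/
def invProd [Fintype I] {R : Type*} [CommMonoid R] (r r' : I → ℕ) (lam : I → I → R) : R :=
  ∏ x, ∏ y, if r x < r y ∧ r' y < r' x then lam x y else 1

theorem invProd_mul [Fintype I] {R : Type*} [CommMonoid R] (r r' : I → ℕ) (lam mu : I → I → R) :
    invProd r r' (fun x y => lam x y * mu x y) = invProd r r' lam * invProd r r' mu := by
  simp only [invProd, ← Finset.prod_mul_distrib]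
  refine Finset.prod_congr rfl fun x _ => Finset.prod_congr rfl fun y _ => ?_
  split <;> simp

theorem map_invProd [Fintype I] {R S : Type*} [CommMonoid R] [CommMonoid S] (f : R →* S) (r r' : I → ℕ)
    (lam : I → I → R) : f (invProd r r' lam) = invProd r r' fun x y => f (lam x y) := by
  simp only [invProd, map_prod]
  refine Finset.prod_congr rfl fun x _ => Finset.prod_congr rfl fun y _ => ?_
  split <;> simp

theorem invProd_one [Fintype I] {R : Type*} [CommMonoid R] (r r' : I → ℕ) :
    invProd r r' (fun _ _ => (1 : R)) = 1 := by
  simp [invProd]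

theorem exists_sorted_list [Fintype I] (r : I → ℕ) (hr : Function.Injective r) :
    ∃ l : List I, l.Pairwise (fun x y => r x < r y) ∧ ∀ x, x ∈ l := by
  let le : I → I → Bool := fun x y => decide (r x ≤ r y)
  have h1 := List.pairwise_mergeSort (le := le) (by simpa [le] using fun a b c => le_trans)
    (by simpa [le] using fun a b => le_total _ _) Finset.univ.toList
  have h2 : ((Finset.univ : Finset I).toList.mergeSort le).Nodup :=
    (List.mergeSort_perm _ _).nodup_iff.2 (Finset.nodup_toList _)
  refine ⟨_, (h1.and h2).imp ?_, fun x => (List.mergeSort_perm _ _).mem_iff.2 (by simp)⟩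
  intro x y hxy
  simp only [le, decide_eq_true_eq] at hxy
  exact lt_of_le_of_ne hxy.1 fun h => hxy.2 (hr h)

variable {N : Type*} [AddCommGroup N]

theorem nodup_of_pairwise_lt {r : I → ℕ} {l : List I} (h : l.Pairwise (fun x y => r x < r y)) :
    l.Nodup := h.imp fun hxy e => absurd hxy (by simp [e])

/-- A function of lists that is multiplied by `lam x y` when the first two entries are exchanged. -/
structure IsReorderable (lam : I → I → ℤ) (Φ : List I → N) : Prop where
  swap : ∀ x y l, x ≠ y → Φ (x :: y :: l) = lam x y • Φ (y :: x :: l)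
  cons : ∀ x l l' (c : ℤ), l.Perm l' → Φ l = c • Φ l' → Φ (x :: l) = c • Φ (x :: l')

variable [DecidableEq I] {lam : I → I → ℤ} {Φ : List I → N}

theorem IsReorderable.move_front (hΦ : IsReorderable lam Φ) {r : I → ℕ} (m : I) :
    ∀ {l : List I}, l.Pairwise (fun x y => r x < r y) → m ∈ l →
      Φ l = (∏ x ∈ (l.erase m).toFinset, if r x < r m then lam x m else 1) • Φ (m :: l.erase m) := by
  intro l
  induction l with
  | nil => intro _ h; simp at h
  | cons x l ih =>
    intro hl hm
    rw [List.pairwise_cons] at hl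
    by_cases hx : x = m
    · subst hx
      rw [List.erase_cons_head, Finset.prod_eq_one, one_smul]
      intro y hy
      rw [if_neg]
      have := hl.1 y (List.mem_toFinset.1 hy)
      omega
    · have hm' : m ∈ l := by
        rcases List.mem_cons.1 hm with h | h
        · exact absurd h.symm hx
        · exact h
      have hnd : x ∉ (l.erase m).toFinset := by
        intro h
        have := hl.1 x (List.mem_of_mem_erase (List.mem_toFinset.1 h))
        omega
      rw [List.erase_cons_tail (by simpa using hx), List.toFinset_cons,
        Finset.prod_insert hnd, if_pos (hl.1 m hm'),
        hΦ.cons x l (m :: l.erase m) _ (List.perm_cons_erase hm') (ih hl.2 hm'),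
        hΦ.swap x m _ hx, smul_smul, mul_comm]

/-- Induction on the target list: its first element is pulled to the front, past the elements that
precede it in the order `r`. They all follow it in `r'`, so these are exactly the reversed pairs
with this element. -/
theorem IsReorderable.eq_smul_aux (hΦ : IsReorderable lam Φ) {r r' : I → ℕ} :
    ∀ {l' l : List I}, l.Perm l' → l.Pairwise (fun x y => r x < r y) →
      l'.Pairwise (fun x y => r' x < r' y) →
      Φ l = (∏ x ∈ l'.toFinset, ∏ y ∈ l'.toFinset,
        if r x < r y ∧ r' y < r' x then lam x y else 1) • Φ l' := by
  intro l'
  induction l' with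
  | nil => intro l h _ _; simp [h.eq_nil]
  | cons m t ih =>
    intro l hp hl hl'
    rw [List.pairwise_cons] at hl'
    have hm : m ∈ l := hp.mem_iff.2 List.mem_cons_self
    have hpt : (l.erase m).Perm t := by simpa using hp.erase m
    have hfin : (l.erase m).toFinset = t.toFinset := List.toFinset_eq_of_perm _ _ hpt
    have hmt : m ∉ t.toFinset := by
      intro h
      have := hl'.1 m (List.mem_toFinset.1 h)
      omega
    have h1 := hΦ.move_front m hl hm
    have h2 := hΦ.cons m _ _ _ hpt (ih hpt (hl.sublist List.erase_sublist) hl'.2)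
    rw [h1, h2, hfin, smul_smul, List.toFinset_cons, Finset.prod_insert hmt,
      Finset.prod_insert hmt, if_neg (by omega), one_mul]
    congr 1
    have e1 : (∏ y ∈ t.toFinset, if r m < r y ∧ r' y < r' m then lam m y else 1) = 1 := by
      refine Finset.prod_eq_one fun y hy => if_neg ?_
      have := hl'.1 y (List.mem_toFinset.1 hy)
      omega
    rw [e1, one_mul, ← Finset.prod_mul_distrib]
    refine Finset.prod_congr rfl fun x hx => ?_
    have := hl'.1 x (List.mem_toFinset.1 hx)
    rw [Finset.prod_insert hmt]
    simp only [this, and_true]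

theorem IsReorderable.eq_smul [Fintype I] (hΦ : IsReorderable lam Φ) {r r' : I → ℕ} {l l' : List I}
    (hl : l.Pairwise (fun x y => r x < r y)) (hl' : l'.Pairwise (fun x y => r' x < r' y))
    (hm : ∀ x, x ∈ l) (hm' : ∀ x, x ∈ l') : Φ l = invProd r r' lam • Φ l' := by
  have hp : l.Perm l' := (List.perm_ext_iff_of_nodup (nodup_of_pairwise_lt hl)
    (nodup_of_pairwise_lt hl')).2 fun x => by simp [hm, hm']
  have hu : l'.toFinset = Finset.univ := by ext x; simp [hm']
  rw [hΦ.eq_smul_aux hp hl hl', hu]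
  rfl

end Reordering

/-! ### Monomials of an exterior algebra -/

section Wedge

variable {I : Type*}

/-- The factor of a basis element at `x`: the generator, if the label is `v₋`. -/
def wedgeFactor (s : I → Bool) (x : I) : ExteriorAlgebra ℤ (I →₀ ℤ) :=
  if s x then 1 else ExteriorAlgebra.ι ℤ (Finsupp.single x 1)

def wedge (s : I → Bool) (l : List I) : ExteriorAlgebra ℤ (I →₀ ℤ) := (l.map (wedgeFactor s)).prod

theorem wedge_cons (s : I → Bool) (x : I) (l : List I) :
    wedge s (x :: l) = wedgeFactor s x * wedge s l := by
  simp [wedge]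

theorem wedge_isReorderable [Fintype I] (s : I → Bool) :
    IsReorderable (fun x y => if s x = false ∧ s y = false then -1 else 1) (wedge s) := by
  constructor
  · intro x y l _
    simp only [wedge_cons, ← mul_assoc]
    rw [← smul_mul_assoc]
    congr 1
    unfold wedgeFactor
    by_cases hx : s x <;> by_cases hy : s y <;> simp [hx, hy]
    exact eq_neg_of_add_eq_zero_left (ExteriorAlgebra.ι_add_mul_swap _ _)
  · intro x l l' c _ h
    rw [wedge_cons, wedge_cons, h, mul_smul_comm]

theorem wedge_eq_filter (s : I → Bool) (l : List I) :
    wedge s l = ((l.filter fun x => !s x).map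
      fun x => ExteriorAlgebra.ι ℤ (Finsupp.single x (1 : ℤ))).prod := by
  induction l with
  | nil => rfl
  | cons x l ih =>
    rw [wedge_cons, ih, wedgeFactor]
    by_cases hx : s x <;> simp [hx]

/-- The monomials with factors in a fixed order form a basis of the exterior algebra. -/
theorem exists_wedge_equiv [Fintype I] [DecidableEq I] (r : I → ℕ) (hr : Function.Injective r) :
    ∃ W : ((I → Bool) → ℤ) ≃ₗ[ℤ] ExteriorAlgebra ℤ (I →₀ ℤ), ∀ s (l : List I),
      l.Pairwise (fun x y => r x < r y) → (∀ x, x ∈ l) → W (Pi.single s 1) = wedge s l := by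
  let _ : LinearOrder I := LinearOrder.lift' r hr
  let b : Module.Basis I ℤ (I →₀ ℤ) := Finsupp.basisSingleOne
  let e : (I → Bool) ≃ Finset I :=
    { toFun := fun s => Finset.univ.filter fun x => s x = false
      invFun := fun S x => decide (x ∉ S)
      left_inv := fun s => by ext x; simp
      right_inv := fun S => by ext x; simp }
  refine ⟨(b.ExteriorAlgebra.reindex e.symm).equivFun.symm, fun s l hl hm => ?_⟩
  rw [Module.Basis.equivFun_symm_apply]
  simp only [Pi.single_apply, ite_smul, one_smul, zero_smul, Finset.sum_ite_eq', Finset.mem_univ,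
    if_true, Module.Basis.reindex_apply, Equiv.symm_symm]
  rw [ExteriorAlgebra.basis_apply, wedge_eq_filter]
  change ExteriorAlgebra.ιMulti ℤ _ _ = _
  rw [ExteriorAlgebra.ιMulti_apply]
  have hL : (l.filter fun x => !s x) = List.ofFn ((e s).orderEmbOfFin rfl) := by
    refine List.SortedLT.eq_of_mem_iff ?_ ?_ fun x => ?_
    · exact List.sortedLT_iff_pairwise.2 (hl.filter _)
    · exact List.sortedLT_ofFn_iff.2 (OrderEmbedding.strictMono _)
    · have := Finset.range_orderEmbOfFin (e s) rfl
      rw [List.mem_ofFn, ← Set.mem_range, this]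
      simp [e, hm]
  rw [hL, List.map_ofFn]
  rfl

end Wedge

/-! ### The sign of a word in two letters -/

/-- The power of `w` given by the number of pairs of a letter `true` before a letter `false`. -/
def mixSign (w : ℤˣ) : List Bool → ℤˣ
  | [] => 1
  | true :: l => w ^ l.count false * mixSign w l
  | false :: l => mixSign w l

theorem mixSign_isReorderable {I : Type*} [Fintype I] (w : ℤˣ) (s : I → Bool) :
    IsReorderable (fun x y => if s x = s y then 1 else (w : ℤ))
      (fun l => (mixSign w (l.map s) : ℤ)) := by
  constructor
  · intro x y l _
    have hw : (w : ℤ) * w = 1 := by rw [← Units.val_mul, Int.units_mul_self]; rfl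
    by_cases hx : s x <;> by_cases hy : s y <;> simp [hx, hy, mixSign, pow_succ]
    · ring
    · linear_combination (-(w : ℤ) ^ (List.count false (l.map s)) * mixSign w (l.map s)) * hw
  · intro x l l' c hp h
    by_cases hx : s x
    · simp only [List.map_cons, hx, mixSign, (hp.map s).count_eq, Units.val_mul, smul_eq_mul] at h ⊢
      rw [h]
      ring
    · simpa only [List.map_cons, hx, mixSign] using h

end
-- Lists of circles near a saddle, and the gauge signs.
noncomputable section

namespace LinkDiagram

variable (D : LinkDiagram)

/-! ### The circles that do not take part in a saddle -/

/-- The smallest arcs of the circles different from `a` and `b`. -/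
def restArcs (ξ : D.Cube) (a b : D.Circle ξ) : List (Fin D.arcs) :=
  (Finset.univ.filter fun e =>
    (D.circ ξ e ≠ a ∧ D.circ ξ e ≠ b) ∧ ∀ e', D.circ ξ e' = D.circ ξ e → e ≤ e').sort (· ≤ ·)

theorem mem_restArcs {ξ : D.Cube} {a b : D.Circle ξ} {e : Fin D.arcs} :
    e ∈ D.restArcs ξ a b ↔
      (D.circ ξ e ≠ a ∧ D.circ ξ e ≠ b) ∧ ∀ e', D.circ ξ e' = D.circ ξ e → e ≤ e' := by
  simp [restArcs]

theorem exists_min_arc (ξ : D.Cube) (x : D.Circle ξ) :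
    ∃ e, D.circ ξ e = x ∧ ∀ e', D.circ ξ e' = x → e ≤ e' := by
  obtain ⟨e, he⟩ := Quot.exists_rep x
  have hne : (Finset.univ.filter fun e' => D.circ ξ e' = x).Nonempty :=
    ⟨e, Finset.mem_filter.2 ⟨Finset.mem_univ _, he⟩⟩
  obtain ⟨m, hm, hmin⟩ := Finset.exists_min_image _ id hne
  exact ⟨m, (Finset.mem_filter.1 hm).2,
    fun e' he' => hmin e' (Finset.mem_filter.2 ⟨Finset.mem_univ _, he'⟩)⟩

/-- The circles in the order `frontOrder a b`. -/
def frontList (ξ : D.Cube) (a b : D.Circle ξ) : List (D.Circle ξ) :=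
  (if a = b then [a] else [a, b]) ++ (D.restArcs ξ a b).map (D.circ ξ)

theorem mem_frontList (ξ : D.Cube) (a b x : D.Circle ξ) : x ∈ D.frontList ξ a b := by
  by_cases ha : x = a
  · subst ha
    by_cases h : x = b <;> simp [frontList, h]
  by_cases hb : x = b
  · subst hb
    by_cases h : a = x <;> simp [frontList, h]
  obtain ⟨e, he, hmin⟩ := D.exists_min_arc ξ x
  refine List.mem_append_right _ (List.mem_map.2 ⟨e, D.mem_restArcs.2 ?_, he⟩)
  rw [he]
  exact ⟨⟨ha, hb⟩, hmin⟩

theorem frontOrder_of_mem {ξ : D.Cube} {a b : D.Circle ξ} {e : Fin D.arcs}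
    (h : e ∈ D.restArcs ξ a b) : D.frontOrder a b (D.circ ξ e) = 2 + e := by
  obtain ⟨⟨ha, hb⟩, hmin⟩ := D.mem_restArcs.1 h
  rw [frontOrder, if_neg ha, if_neg hb]
  congr 1
  apply le_antisymm
  · exact Nat.sInf_le ⟨e, rfl, rfl⟩
  · refine le_csInf ⟨_, e, rfl, rfl⟩ ?_
    rintro _ ⟨e', he', rfl⟩
    exact hmin e' he'

theorem frontList_pairwise (ξ : D.Cube) (a b : D.Circle ξ) :
    (D.frontList ξ a b).Pairwise (fun x y => D.frontOrder a b x < D.frontOrder a b y) := by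
  have ha : D.frontOrder a b a = 0 := by simp [frontOrder]
  rw [frontList, List.pairwise_append]
  refine ⟨?_, ?_, ?_⟩
  · split
    · simp
    · rename_i h
      simp [frontOrder, Ne.symm h]
  · rw [List.pairwise_map]
    have hs : (D.restArcs ξ a b).Pairwise (· < ·) :=
      List.sortedLT_iff_pairwise.1 (Finset.sortedLT_sort _)
    refine hs.imp_of_mem fun {e e'} he he' hlt => ?_
    rw [D.frontOrder_of_mem he, D.frontOrder_of_mem he']
    exact Nat.add_lt_add_left hlt 2
  · intro x hx y hy
    obtain ⟨e, he, rfl⟩ := List.mem_map.1 hy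
    rw [D.frontOrder_of_mem he]
    have hx' : x = a ∨ x = b := by
      split at hx
      · exact Or.inl (by simpa using hx)
      · simpa using hx
    have : D.frontOrder a b x ≤ 1 := by
      rcases hx' with rfl | rfl
      · simp [ha]
      · unfold frontOrder
        split
        · simp
        · simp
    omega

variable {D}

section EdgeLists

variable {c : Fin D.crossings} {ξ ξ' : D.Cube}

theorem IsEdge.rest_iff (h : D.IsEdge c ξ ξ') (arrow : Fin D.crossings → Bool)
    (e : Fin D.arcs) :
    (D.circ ξ e ≠ D.circ ξ (D.arc c (D.tail arrow c)) ∧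
      D.circ ξ e ≠ D.circ ξ (D.arc c (D.tail arrow c + 2))) ↔
    (D.circ ξ' e ≠ D.circ ξ' (D.arc c (D.tail arrow c + 1)) ∧
      D.circ ξ' e ≠ D.circ ξ' (D.arc c (D.tail arrow c + 3))) := by
  have := not_congr (h.mem_iff e)
  rw [not_or, not_or] at this
  unfold tail
  split
  · exact and_comm.trans (this.trans and_comm)
  · exact this

theorem IsEdge.rest_circ_iff (h : D.IsEdge c ξ ξ') (arrow : Fin D.crossings → Bool)
    {e : Fin D.arcs}
    (he : D.circ ξ e ≠ D.circ ξ (D.arc c (D.tail arrow c)) ∧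
      D.circ ξ e ≠ D.circ ξ (D.arc c (D.tail arrow c + 2))) (e' : Fin D.arcs) :
    D.circ ξ e' = D.circ ξ e ↔ D.circ ξ' e' = D.circ ξ' e := by
  revert he
  unfold tail
  split
  · exact fun he => h.circ_eq_iff he.2 he.1 e'
  · exact fun he => h.circ_eq_iff he.1 he.2 e'

theorem IsEdge.tail_ne_iff (h : D.IsEdge c ξ ξ') (arrow : Fin D.crossings → Bool) :
    D.circ ξ (D.arc c (D.tail arrow c)) = D.circ ξ (D.arc c (D.tail arrow c + 2)) ↔
      D.circ ξ' (D.arc c (D.tail arrow c + 1)) ≠ D.circ ξ' (D.arc c (D.tail arrow c + 3)) := by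
  rw [circ_tail, h.circ_ne_iff]
  unfold tail
  split
  · exact ne_comm
  · rfl

theorem IsEdge.restArcs_eq (h : D.IsEdge c ξ ξ') (arrow : Fin D.crossings → Bool) :
    D.restArcs ξ' (D.circ ξ' (D.arc c (D.tail arrow c + 1)))
      (D.circ ξ' (D.arc c (D.tail arrow c + 3))) =
    D.restArcs ξ (D.circ ξ (D.arc c (D.tail arrow c)))
      (D.circ ξ (D.arc c (D.tail arrow c + 2))) := by
  unfold restArcs
  congr 1
  ext e
  simp only [Finset.mem_filter, Finset.mem_univ, true_and, ← h.rest_iff arrow e]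
  exact and_congr_right fun he => forall_congr' fun e' => by rw [h.rest_circ_iff arrow he]

theorem IsEdge.rest_labels_iff (h : D.IsEdge c ξ ξ') (arrow : Fin D.crossings → Bool)
    (s : D.Labeling ξ) (s' : D.Labeling ξ') :
    (∀ e, D.circ ξ e ≠ D.circ ξ (D.arc c (D.tail arrow c)) →
      D.circ ξ e ≠ D.circ ξ (D.arc c (D.tail arrow c + 2)) →
        s (D.circ ξ e) = s' (D.circ ξ' e)) ↔
    (D.restArcs ξ (D.circ ξ (D.arc c (D.tail arrow c)))
      (D.circ ξ (D.arc c (D.tail arrow c + 2)))).map (fun e => s' (D.circ ξ' e)) =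
    (D.restArcs ξ (D.circ ξ (D.arc c (D.tail arrow c)))
      (D.circ ξ (D.arc c (D.tail arrow c + 2)))).map fun e => s (D.circ ξ e) := by
  rw [List.map_inj_left]
  constructor
  · intro hs e he
    have := (D.mem_restArcs.1 he).1
    exact (hs e this.1 this.2).symm
  · intro hs e h0 h2
    obtain ⟨m, hm, hmin⟩ := D.exists_min_arc ξ (D.circ ξ e)
    have hm' : D.circ ξ' m = D.circ ξ' e := (h.rest_circ_iff arrow ⟨h0, h2⟩ m).1 hm
    rw [← hm, ← hm']
    refine (hs m (D.mem_restArcs.2 ?_)).symm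
    rw [hm]
    exact ⟨⟨h0, h2⟩, hmin⟩

end EdgeLists

/-! ### The gauge transformation -/

/-- It depends only on the numbers of labels, so permutations of factors do not affect it. The
product of the two numbers compensates what `mixSign` gains in merges; the binomial coefficient,
which merges leave unchanged, makes the signs of splits independent of the labels. -/
def homSign (w : ℤˣ) (m : List Bool) : ℤˣ :=
  w ^ (m.count true * m.count false + (m.count false).choose 2)

def gauge (w : ℤˣ) (m : List Bool) : ℤˣ := mixSign w m * homSign w m

theorem gauge_mul_gauge_of_perm (w : ℤˣ) {m m' : List Bool} (h : m.Perm m') :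
    gauge w m * gauge w m' = mixSign w m * mixSign w m' := by
  have : homSign w m = homSign w m' := by simp only [homSign, h.count_eq]
  rw [gauge, gauge, this, mul_mul_mul_comm, Int.units_mul_self, mul_one]

/-- The coefficients of the split, for the value `p` of `XY`. -/
def splitCoeff (p : ℤ) : Bool → Bool → Bool → ℤ
  | true, false, true => 1
  | true, true, false => p
  | false, false, false => 1
  | _, _, _ => 0

theorem splitCoeff_one : splitCoeff 1 = evenSplit := by
  ext a b c
  cases a <;> cases b <;> cases c <;> rfl

theorem units_pow_two_mul_add (w : ℤˣ) (k d : ℕ) : w ^ (2 * k + d) = w ^ d := by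
  rw [pow_add, pow_mul, pow_two, Int.units_mul_self, one_pow, one_mul]

theorem gauge_mul_gauge (w : ℤˣ) {m m₁ m₂ : List Bool} {i j : ℕ} (k d : ℕ)
    (h1 : mixSign w m₁ = w ^ i * mixSign w m) (h2 : mixSign w m₂ = w ^ j * mixSign w m)
    (h : i + (m₁.count true * m₁.count false + (m₁.count false).choose 2) +
      (j + (m₂.count true * m₂.count false + (m₂.count false).choose 2)) = 2 * k + d) :
    gauge w m₁ * gauge w m₂ = w ^ d := by
  rw [← units_pow_two_mul_add w k d, ← h, gauge, gauge, homSign, homSign, h1, h2]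
  simp only [pow_add]
  generalize w ^ (List.count true m₁ * List.count false m₁) = x₁
  generalize w ^ (List.count true m₂ * List.count false m₂) = x₂
  generalize w ^ (List.count false m₁).choose 2 = y₁
  generalize w ^ (List.count false m₂).choose 2 = y₂
  calc _ = w ^ i * (x₁ * y₁) * (w ^ j * (x₂ * y₂)) * (mixSign w m * mixSign w m) := by ac_rfl
    _ = _ := by rw [Int.units_mul_self, mul_one]

theorem choose_two_succ (n : ℕ) : (n + 1).choose 2 = n + n.choose 2 := by
  rw [Nat.choose_succ_succ', Nat.choose_one_right]

theorem gauge_merge_tt (w : ℤˣ) (m : List Bool) :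
    gauge w (true :: true :: m) * gauge w (true :: m) = 1 := by
  rw [← pow_zero w]
  refine gauge_mul_gauge w (m := m) (i := 2 * m.count false) (j := m.count false)
    (3 * m.count false + m.count true * m.count false + (m.count false).choose 2) 0 ?_ ?_ ?_
  · simp only [mixSign, List.count_cons_of_ne (b := true) (a := false) (by decide), two_mul,
      pow_add, mul_assoc]
  · simp [mixSign]
  · simp
    ring

theorem gauge_merge_tf (w : ℤˣ) (m : List Bool) :
    gauge w (true :: false :: m) * gauge w (false :: m) = 1 := by
  rw [← pow_zero w]
  refine gauge_mul_gauge w (m := m) (i := m.count false + 1) (j := 0)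
    (2 * m.count false + m.count true * m.count false + m.count true +
      (m.count false).choose 2 + 1) 0 ?_ ?_ ?_
  · simp [mixSign]
  · simp [mixSign]
  · simp [choose_two_succ]
    ring

/-- The result is the value of XZ, the coefficient of this term of the merge. -/
theorem gauge_merge_ft (w : ℤˣ) (m : List Bool) :
    gauge w (false :: true :: m) * gauge w (false :: m) = w := by
  refine (gauge_mul_gauge w (m := m) (i := m.count false) (j := 0)
    (2 * m.count false + m.count true * m.count false + m.count true +
      (m.count false).choose 2) 1 ?_ ?_ ?_).trans (pow_one w)
  · simp [mixSign]
  · simp [mixSign]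
  · simp [choose_two_succ]
    ring

/-- The exponent is the number of circles before the split. The same power occurs for all three
terms of the split, so it is a sign of the edge; the additional `w` at the second term is the
quotient of YZ by XY. -/
theorem gauge_split_tft (w : ℤˣ) (m : List Bool) :
    gauge w (true :: m) * gauge w (false :: true :: m) =
      w ^ (m.length + 1) := by
  refine gauge_mul_gauge w (m := m) (i := m.count false) (j := m.count false)
    (2 * m.count false + m.count true * m.count false + (m.count false).choose 2) _ ?_ ?_ ?_
  · simp [mixSign]
  · simp [mixSign]
  · simp [choose_two_succ]
    rw [← List.count_true_add_count_false m]
    ring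

theorem gauge_split_ttf (w : ℤˣ) (m : List Bool) :
    gauge w (true :: m) * gauge w (true :: false :: m) =
      w ^ (m.length + 1) * w := by
  rw [← pow_succ]
  refine gauge_mul_gauge w (m := m) (i := m.count false) (j := m.count false + 1)
    (2 * m.count false + m.count true * m.count false + (m.count false).choose 2) _ ?_ ?_ ?_
  · simp [mixSign]
  · simp [mixSign]
  · simp [choose_two_succ]
    rw [← List.count_true_add_count_false m]
    ring

theorem gauge_split_fff (w : ℤˣ) (m : List Bool) :
    gauge w (false :: m) * gauge w (false :: false :: m) =
      w ^ (m.length + 1) := by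
  refine gauge_mul_gauge w (m := m) (i := 0) (j := 0)
    (m.count true * m.count false + m.count true + (m.count false).choose 2 + m.count false)
    _ ?_ ?_ ?_
  · simp [mixSign]
  · simp [mixSign]
  · simp [choose_two_succ]
    rw [← List.count_true_add_count_false m]
    ring

end LinkDiagram

end
-- Specialized saddles depend on XY only, up to gauge and edge signs.
noncomputable section

namespace LinkDiagram

variable {D : LinkDiagram}

/-! ### Specializations of the coefficient ring -/

/-- A specialization of the coefficients, with the values of `X`, `Y` and `Z`. -/
structure IsSpecialization (φ : ChronoRing →+* ℤ) (x y z : ℤˣ) : Prop where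
  map_X : φ ChronoRing.X = x
  map_Y : φ ChronoRing.Y = y
  map_Z : φ ChronoRing.Z = z

variable {φ : ChronoRing →+* ℤ} {x y z : ℤˣ}

/-- The first sign ignores the labels, the second is the exchange rule of `mixSign`, and only the
third distinguishes the even theory from the odd one. -/
theorem IsSpecialization.map_lam (hφ : IsSpecialization φ x y z) (p q : Bool) :
    φ (ChronoRing.lam (chDeg p) (chDeg q)) =
      x * ((if p = q then 1 else ((x * z : ℤˣ) : ℤ)) *
        if p = false ∧ q = false then ((x * y : ℤˣ) : ℤ) else 1) := by
  have hx : (x : ℤ) * x = 1 := by rw [← Units.val_mul, Int.units_mul_self]; rfl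
  have hz : (z : ℤ) * z = 1 := by rw [← Units.val_mul, Int.units_mul_self]; rfl
  have hX := hφ.map_X
  have hY := hφ.map_Y
  have hZ := hφ.map_Z
  rw [ChronoRing.X] at hX
  rw [ChronoRing.Y] at hY
  rw [ChronoRing.Z] at hZ
  have hZ' : φ (ChronoRing.mono 0 0 (-1)) = z := by
    have h1 : φ (ChronoRing.mono 0 0 (-1) * ChronoRing.mono 0 0 1) = 1 := by
      rw [ChronoRing.mono_mul]
      simp [ChronoRing.mono_zero]
    rw [map_mul, hZ] at h1
    calc φ (ChronoRing.mono 0 0 (-1)) = φ (ChronoRing.mono 0 0 (-1)) * z * z := by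
          rw [mul_assoc, hz, mul_one]
      _ = z := by rw [h1, one_mul]
  cases p <;> cases q <;>
    simp [ChronoRing.lam, chDeg, hX, hY, hZ, hZ', ← mul_assoc, hx]

/-- The sign of the exchange of two factors, for the value `p` of `XY`. -/
def labelSign {I : Type*} (p : ℤ) (s : I → Bool) (i j : I) : ℤ :=
  if s i = false ∧ s j = false then p else 1

theorem IsSpecialization.map_reorder (hφ : IsSpecialization φ x y z) {ξ : D.Cube}
    (r r' : D.Circle ξ → ℕ) (s : D.Labeling ξ) :
    φ (D.reorder r r' s) = (invProd r r' (fun _ _ => x) : ℤˣ) *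
      (invProd r r' (fun i j => if s i = s j then 1 else ((x * z : ℤˣ) : ℤ)) *
        invProd r r' (labelSign ((x * y : ℤˣ) : ℤ) s)) := by
  have h1 : D.reorder r r' s = invProd r r' fun i j => ChronoRing.lam (chDeg (s i)) (chDeg (s j)) := by
    unfold reorder invProd
    refine Finset.prod_congr rfl fun i _ => Finset.prod_congr rfl fun j _ => ?_
    congr
  have h2 : ((invProd r r' (fun _ _ => x) : ℤˣ) : ℤ) = invProd r r' fun _ _ => (x : ℤ) :=
    map_invProd (Units.coeHom ℤ) r r' fun _ _ => x
  rw [h1, h2, ← invProd_mul, ← invProd_mul]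
  refine (map_invProd (φ : ChronoRing →* ℤ) r r' _).trans ?_
  congr 1
  ext i j
  exact hφ.map_lam _ _

theorem map_saddleEntry {R S : Type} [CommRing R] [CommRing S] (f : R →+* S)
    (μ Δ : Bool → Bool → Bool → R) (t : Fin 4) (c : Fin D.crossings) (ξ ξ' : D.Cube)
    (s : D.Labeling ξ) (s' : D.Labeling ξ') :
    f (D.saddleEntry μ Δ t c ξ ξ' s s') =
      D.saddleEntry (fun i j k => f (μ i j k)) (fun i j k => f (Δ i j k)) t c ξ ξ' s s' := by
  simp only [saddleEntry]
  split_ifs <;> simp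

/-! ### Reduction to the cases of the even and the odd theory -/

section Reduction

variable (D)
variable (order : ∀ ξ : D.Cube, D.Circle ξ → ℕ) (arrow : Fin D.crossings → Bool)

/-- The order before a saddle, with the circles that take part in front. -/
abbrev frontSrc (c : Fin D.crossings) (ξ : D.Cube) : D.Circle ξ → ℕ :=
  D.frontOrder (D.circ ξ (D.arc c (D.tail arrow c))) (D.circ ξ (D.arc c (D.tail arrow c + 2)))

/-- The order after a saddle, with the circles that take part in front. -/
abbrev frontTgt (c : Fin D.crossings) (ξ' : D.Cube) : D.Circle ξ' → ℕ :=
  D.frontOrder (D.circ ξ' (D.arc c (D.tail arrow c + 1)))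
    (D.circ ξ' (D.arc c (D.tail arrow c + 3)))

abbrev listSrc (c : Fin D.crossings) (ξ : D.Cube) : List (D.Circle ξ) :=
  D.frontList ξ (D.circ ξ (D.arc c (D.tail arrow c))) (D.circ ξ (D.arc c (D.tail arrow c + 2)))

abbrev listTgt (c : Fin D.crossings) (ξ' : D.Cube) : List (D.Circle ξ') :=
  D.frontList ξ' (D.circ ξ' (D.arc c (D.tail arrow c + 1)))
    (D.circ ξ' (D.arc c (D.tail arrow c + 3)))

/-- The matrix entries of saddles for `X = Z = 1` and `Y = p`. -/
def redEntry (p : ℤ) (c : Fin D.crossings) (ξ ξ' : D.Cube) (s : D.Labeling ξ)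
    (s' : D.Labeling ξ') : ℤ :=
  invProd (order ξ) (D.frontSrc arrow c ξ) (labelSign p s) *
    D.saddleEntry evenMerge (splitCoeff p) (D.tail arrow c) c ξ ξ' s s' *
    invProd (D.frontTgt arrow c ξ') (order ξ') (labelSign p s')

/-- All signs that do not depend on labels: one `x` for each pair of circles reversed before or
after the saddle, and the power of `w` from the gauge of a split. The value of Y does not enter,
which is decisive on the exceptional faces. -/
def edgeSign (x w : ℤˣ) (ξ : D.Cube) (c : Fin D.crossings) : ℤˣ :=
  invProd (order ξ) (D.frontSrc arrow c ξ) (fun _ _ => x) *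
    invProd (D.frontTgt arrow c (Function.update ξ c true)) (order (Function.update ξ c true))
      (fun _ _ => x) *
    if D.circ ξ (D.arc c (D.tail arrow c)) = D.circ ξ (D.arc c (D.tail arrow c + 2))
      then w ^ (D.listSrc arrow c ξ).length else 1

variable {D order}
variable (horder : ∀ ξ, Function.Injective (order ξ))

def orderList (ξ : D.Cube) : List (D.Circle ξ) :=
  (exists_sorted_list (order ξ) (horder ξ)).choose

theorem orderList_pairwise (ξ : D.Cube) :
    (orderList horder ξ).Pairwise fun i j => order ξ i < order ξ j :=
  (exists_sorted_list (order ξ) (horder ξ)).choose_spec.1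

theorem mem_orderList (ξ : D.Cube) (i : D.Circle ξ) : i ∈ orderList horder ξ :=
  (exists_sorted_list (order ξ) (horder ξ)).choose_spec.2 i

def gaugeAt (w : ℤˣ) (ξ : D.Cube) (s : D.Labeling ξ) : ℤˣ := gauge w ((orderList horder ξ).map s)

theorem invProd_eq_gauge {I : Type*} [Fintype I] [DecidableEq I] {r r' : I → ℕ} {l l' : List I}
    (hl : l.Pairwise (fun i j => r i < r j)) (hl' : l'.Pairwise (fun i j => r' i < r' j))
    (hm : ∀ i, i ∈ l) (hm' : ∀ i, i ∈ l') (w : ℤˣ) (s : I → Bool) :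
    invProd r r' (fun i j => if s i = s j then 1 else (w : ℤ)) =
      (gauge w (l.map s) * gauge w (l'.map s) : ℤˣ) := by
  have h := (mixSign_isReorderable w s).eq_smul hl hl' hm hm'
  have hp : l.Perm l' := (List.perm_ext_iff_of_nodup (nodup_of_pairwise_lt hl)
    (nodup_of_pairwise_lt hl')).2 fun x => by simp [hm, hm']
  rw [gauge_mul_gauge_of_perm w (hp.map s), Units.val_mul, h, smul_eq_mul, mul_assoc,
    ← Units.val_mul, Int.units_mul_self, Units.val_one, mul_one]

/-- In the local order, the specialized saddles differ from the standard ones by a gauge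
transformation. -/
theorem IsSpecialization.saddleEntry_eq (hφ : IsSpecialization φ x y z) {c : Fin D.crossings}
    {ξ ξ' : D.Cube} (h : D.IsEdge c ξ ξ') (s : D.Labeling ξ) (s' : D.Labeling ξ') :
    φ (D.saddleEntry chMerge chSplit (D.tail arrow c) c ξ ξ' s s') =
      ((if D.circ ξ (D.arc c (D.tail arrow c)) = D.circ ξ (D.arc c (D.tail arrow c + 2))
        then (x * z) ^ (D.listSrc arrow c ξ).length else 1 : ℤˣ) : ℤ) *
      ((gauge (x * z) ((D.listSrc arrow c ξ).map s) : ℤ) *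
        (gauge (x * z) ((D.listTgt arrow c ξ').map s') : ℤ)) *
      D.saddleEntry evenMerge (splitCoeff ((x * y : ℤˣ) : ℤ)) (D.tail arrow c) c ξ ξ' s s' := by
  rw [map_saddleEntry]
  simp only [saddleEntry, ← Units.val_mul]
  by_cases hs : ∀ e, D.circ ξ e ≠ D.circ ξ (D.arc c (D.tail arrow c)) →
      D.circ ξ e ≠ D.circ ξ (D.arc c (D.tail arrow c + 2)) → s (D.circ ξ e) = s' (D.circ ξ' e)
  · rw [if_pos hs, if_pos hs]
    have hm := (h.rest_labels_iff arrow s s').1 hs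
    have hyz : ((y * z : ℤˣ) : ℤ) = (x * z : ℤˣ) * (x * y : ℤˣ) := by
      rw [← Units.val_mul, mul_mul_mul_comm, Int.units_mul_self, one_mul, mul_comm]
    by_cases hab : D.circ ξ (D.arc c (D.tail arrow c)) = D.circ ξ (D.arc c (D.tail arrow c + 2))
    · have hab' := (h.tail_ne_iff arrow).1 hab
      have e1 : D.listSrc arrow c ξ = [D.circ ξ (D.arc c (D.tail arrow c))] ++
          (D.restArcs ξ (D.circ ξ (D.arc c (D.tail arrow c)))
            (D.circ ξ (D.arc c (D.tail arrow c + 2)))).map (D.circ ξ) := by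
        rw [listSrc, frontList, if_pos hab]
      have e2 : D.listTgt arrow c ξ' = [D.circ ξ' (D.arc c (D.tail arrow c + 1)),
          D.circ ξ' (D.arc c (D.tail arrow c + 3))] ++
          (D.restArcs ξ (D.circ ξ (D.arc c (D.tail arrow c)))
            (D.circ ξ (D.arc c (D.tail arrow c + 2)))).map (D.circ ξ') := by
        rw [listTgt, frontList, if_neg hab', h.restArcs_eq arrow]
      rw [e1, e2]
      simp only [ne_eq, hab, not_true_eq_false, if_false, if_true]
      rw [hab] at hm
      simp only [List.map_map, Function.comp_def, hm, List.map_cons, List.cons_append, List.nil_append, List.length_cons, List.length_map]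
      generalize D.restArcs ξ _ _ = l
      have htft := gauge_split_tft (x * z) (l.map fun e => s (D.circ ξ e))
      have httf := gauge_split_ttf (x * z) (l.map fun e => s (D.circ ξ e))
      have hfff := gauge_split_fff (x * z) (l.map fun e => s (D.circ ξ e))
      rw [List.length_map] at htft httf hfff
      generalize s _ = i
      generalize s' _ = j
      generalize s' _ = k
      cases i <;> cases j <;> cases k <;>
        simp only [chSplit, splitCoeff, map_zero, map_one, mul_zero, mul_one, map_mul, hφ.map_Y,
          hφ.map_Z, htft, httf, hfff, Int.units_mul_self, Units.val_one]
      rw [← mul_assoc, Int.units_mul_self, one_mul, ← Units.val_mul]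
      exact hyz
    · have hab' := not_not.1 (mt (h.tail_ne_iff arrow).2 hab)
      have e1 : D.listSrc arrow c ξ = [D.circ ξ (D.arc c (D.tail arrow c)),
          D.circ ξ (D.arc c (D.tail arrow c + 2))] ++
          (D.restArcs ξ (D.circ ξ (D.arc c (D.tail arrow c)))
            (D.circ ξ (D.arc c (D.tail arrow c + 2)))).map (D.circ ξ) := by
        rw [listSrc, frontList, if_neg hab]
      have e2 : D.listTgt arrow c ξ' = [D.circ ξ' (D.arc c (D.tail arrow c + 1))] ++
          (D.restArcs ξ (D.circ ξ (D.arc c (D.tail arrow c)))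
            (D.circ ξ (D.arc c (D.tail arrow c + 2)))).map (D.circ ξ') := by
        rw [listTgt, frontList, if_pos hab', h.restArcs_eq arrow]
      rw [e1, e2]
      simp only [ne_eq, hab, not_false_eq_true, if_false, if_true]
      simp only [List.map_map, Function.comp_def, hm, List.map_cons, List.cons_append, List.nil_append]
      generalize D.restArcs ξ _ _ = l
      have htt := gauge_merge_tt (x * z) (l.map fun e => s (D.circ ξ e))
      have htf := gauge_merge_tf (x * z) (l.map fun e => s (D.circ ξ e))
      have hft := gauge_merge_ft (x * z) (l.map fun e => s (D.circ ξ e))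
      generalize s _ = i
      generalize s _ = j
      generalize s' _ = k
      cases i <;> cases j <;> cases k <;>
        simp [chMerge, evenMerge, hφ.map_X, hφ.map_Z, htt, htf, hft]
  · rw [if_neg hs, if_neg hs, mul_zero]

/-- The `w` part of a reordering is a quotient of gauge signs, so the gauges of the local orders
cancel and those of the global orders remain. -/
theorem IsSpecialization.genEntry_eq (hφ : IsSpecialization φ x y z) {c : Fin D.crossings}
    {ξ ξ' : D.Cube} (h : D.IsEdge c ξ ξ') (s : D.Labeling ξ) (s' : D.Labeling ξ') :
    φ (D.reorder (order ξ) (D.frontSrc arrow c ξ) s *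
        D.saddleEntry chMerge chSplit (D.tail arrow c) c ξ ξ' s s' *
        D.reorder (D.frontTgt arrow c ξ') (order ξ') s') =
      (D.edgeSign order arrow x (x * z) ξ c * (gaugeAt horder (x * z) ξ s *
        gaugeAt horder (x * z) ξ' s') : ℤˣ) *
      D.redEntry order arrow ((x * y : ℤˣ) : ℤ) c ξ ξ' s s' := by
  have e1 := invProd_eq_gauge (orderList_pairwise horder ξ) (D.frontList_pairwise ξ
    (D.circ ξ (D.arc c (D.tail arrow c))) (D.circ ξ (D.arc c (D.tail arrow c + 2))))
    (mem_orderList horder ξ) (D.mem_frontList ξ _ _) (x * z) s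
  have e2 := invProd_eq_gauge (D.frontList_pairwise ξ'
    (D.circ ξ' (D.arc c (D.tail arrow c + 1))) (D.circ ξ' (D.arc c (D.tail arrow c + 3))))
    (orderList_pairwise horder ξ') (D.mem_frontList ξ' _ _) (mem_orderList horder ξ')
    (x * z) s'
  rw [map_mul, map_mul, hφ.map_reorder, hφ.map_reorder, hφ.saddleEntry_eq arrow h, e1, e2,
    edgeSign, ← h.2, redEntry, gaugeAt, gaugeAt]
  have hg (u : ℤˣ) : (u : ℤ) * u = 1 := by rw [← Units.val_mul, Int.units_mul_self]; rfl
  have h1 := hg (gauge (x * z) ((D.listSrc arrow c ξ).map s))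
  have h2 := hg (gauge (x * z) ((D.listTgt arrow c ξ').map s'))
  simp only [Units.val_mul]
  generalize ((gauge _ ((D.listSrc arrow c ξ).map s) : ℤˣ) : ℤ) = g at *
  generalize ((gauge _ ((D.listTgt arrow c ξ').map s') : ℤˣ) : ℤ) = g' at *
  generalize D.saddleEntry (R := ℤ) _ _ _ _ _ _ _ _ = S
  generalize invProd (order ξ) (D.frontSrc arrow c ξ) (labelSign _ s) = A
  generalize invProd (D.frontTgt arrow c ξ') (order ξ') (labelSign _ s') = B
  generalize ((invProd (order ξ) (D.frontSrc arrow c ξ) (fun _ _ => x) : ℤˣ) : ℤ) = P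
  generalize ((invProd (D.frontTgt arrow c ξ') (order ξ') (fun _ _ => x) : ℤˣ) : ℤ) = Q
  generalize ((gauge _ ((orderList horder ξ).map s) : ℤˣ) : ℤ) = G
  generalize ((gauge _ ((orderList horder ξ').map s') : ℤˣ) : ℤ) = G'
  generalize ((if D.circ ξ (D.arc c (D.tail arrow c)) =
    D.circ ξ (D.arc c (D.tail arrow c + 2)) then _ else _ : ℤˣ) : ℤ) = E
  calc _ = P * Q * E * (G * G') * (A * S * B) * (g * g) * (g' * g') := by ring
    _ = _ := by rw [h1, h2, mul_one, mul_one]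

end Reduction

end LinkDiagram

end
-- The reduced cube is the even cube for p = 1 and the odd cube for p = -1.
noncomputable section

namespace LinkDiagram

variable {D : LinkDiagram}

/-! ### The even case -/

/-- For `p = 1` reordering costs nothing, and the merge and split are symmetric, so the direction of
the arrow is irrelevant. -/
theorem IsEdge.redEntry_one {c : Fin D.crossings} {ξ ξ' : D.Cube} (h : D.IsEdge c ξ ξ')
    (order : ∀ ξ : D.Cube, D.Circle ξ → ℕ) (arrow : Fin D.crossings → Bool) (s : D.Labeling ξ)
    (s' : D.Labeling ξ') :
    D.redEntry order arrow 1 c ξ ξ' s s' = D.saddleEntry evenMerge evenSplit 0 c ξ ξ' s s' := by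
  have h1 {I : Type} [Fintype I] (r r' : I → ℕ) (t : I → Bool) :
      invProd r r' (labelSign 1 t) = 1 := by
    have : labelSign 1 t = fun _ _ => 1 := by
      ext i j
      simp [labelSign]
    rw [this, invProd_one]
  rw [redEntry, h1, h1, one_mul, mul_one, splitCoeff_one]
  unfold tail
  split
  · simp only [saddleEntry, Fin.reduceAdd]
    have hm (i j k : Bool) : evenMerge i j k = evenMerge j i k := by
      revert i j k; decide
    have hs (i j k : Bool) : evenSplit i j k = evenSplit i k j := by
      revert i j k; decide
    refine if_congr ?_ ?_ rfl
    · exact forall_congr' fun e => ⟨fun H h0 h2 => H h2 h0, fun H h2 h0 => H h0 h2⟩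
    · by_cases hab : D.circ ξ (D.arc c 0) = D.circ ξ (D.arc c 2)
      · simp only [hab, ne_eq, not_true_eq_false, if_false]
        exact hs _ _ _
      · have := not_not.1 (mt h.circ_ne_iff.2 hab)
        simp only [hab, Ne.symm hab, ne_eq, not_false_eq_true, if_true]
        rw [hm, this]
  · rfl

/-! ### The odd case -/

section Extend

variable {c : Fin D.crossings} {ξ ξ' : D.Cube}

open Classical in
/-- Labels after a saddle that agree with `s` on the circles that do not take part. -/
def extendLabeling (arrow : Fin D.crossings → Bool) (c : Fin D.crossings) {ξ : D.Cube}
    (ξ' : D.Cube) (s : D.Labeling ξ) (i j : Bool) : D.Labeling ξ' := fun x =>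
  if x = D.circ ξ' (D.arc c (D.tail arrow c + 1)) then i
  else if x = D.circ ξ' (D.arc c (D.tail arrow c + 3)) then j
  else s (D.circ ξ (Quot.out x))

theorem IsEdge.extendLabeling_rest (h : D.IsEdge c ξ ξ') (arrow : Fin D.crossings → Bool)
    (s : D.Labeling ξ) (i j : Bool) {e : Fin D.arcs}
    (he : D.circ ξ e ≠ D.circ ξ (D.arc c (D.tail arrow c)) ∧
      D.circ ξ e ≠ D.circ ξ (D.arc c (D.tail arrow c + 2))) :
    extendLabeling arrow c ξ' s i j (D.circ ξ' e) = s (D.circ ξ e) := by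
  have he' := (h.rest_iff arrow e).1 he
  rw [extendLabeling, if_neg he'.1, if_neg he'.2]
  congr 1
  exact (h.rest_circ_iff arrow he _).2 (Quot.out_eq _)

theorem IsEdge.eq_extendLabeling (h : D.IsEdge c ξ ξ') (arrow : Fin D.crossings → Bool)
    {s : D.Labeling ξ} {s' : D.Labeling ξ'}
    (hs : ∀ e, D.circ ξ e ≠ D.circ ξ (D.arc c (D.tail arrow c)) →
      D.circ ξ e ≠ D.circ ξ (D.arc c (D.tail arrow c + 2)) → s (D.circ ξ e) = s' (D.circ ξ' e)) :
    extendLabeling arrow c ξ' s (s' (D.circ ξ' (D.arc c (D.tail arrow c + 1))))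
      (s' (D.circ ξ' (D.arc c (D.tail arrow c + 3)))) = s' := by
  ext x
  obtain ⟨e, rfl⟩ := Quot.exists_rep x
  change extendLabeling arrow c ξ' s _ _ (D.circ ξ' e) = s' (D.circ ξ' e)
  by_cases he : D.circ ξ' e = D.circ ξ' (D.arc c (D.tail arrow c + 1)) ∨
      D.circ ξ' e = D.circ ξ' (D.arc c (D.tail arrow c + 3))
  · by_cases h1 : D.circ ξ' e = D.circ ξ' (D.arc c (D.tail arrow c + 1))
    · rw [extendLabeling, if_pos h1, h1]
    · have h3 := he.resolve_left h1
      rw [extendLabeling, if_neg h1, if_pos h3, h3]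
  · have he' := (h.rest_iff arrow e).2 (not_or.1 he)
    rw [h.extendLabeling_rest arrow _ _ _ he', hs e he'.1 he'.2]

end Extend

/-- The factor of a basis element at the circle `x` with the label `i`. -/
def labelFactor {I : Type*} (i : Bool) (x : I) : ExteriorAlgebra ℤ (I →₀ ℤ) :=
  if i then 1 else ExteriorAlgebra.ι ℤ (Finsupp.single x 1)

theorem wedgeFactor_eq {I : Type*} (s : I → Bool) (x : I) :
    wedgeFactor s x = labelFactor (s x) x := rfl

theorem map_labelFactor {I J : Type*} (f : I → J) (i : Bool) (x : I) :
    ExteriorAlgebra.map (Finsupp.lmapDomain ℤ ℤ f) (labelFactor i x) = labelFactor i (f x) := by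
  cases i <;> simp [labelFactor]

theorem labelFactor_mul_self {I : Type*} (i j : Bool) (x : I) :
    labelFactor i x * labelFactor j x = ∑ k, evenMerge i j k • labelFactor k x := by
  cases i <;> cases j <;> simp [labelFactor, evenMerge]

theorem split_labelFactor {I : Type*} (i : Bool) (x y z : I) (h : z = x ∨ z = y) :
    (ExteriorAlgebra.ι ℤ (Finsupp.single x (1 : ℤ)) - ExteriorAlgebra.ι ℤ (Finsupp.single y 1)) *
      labelFactor i z = ∑ p : Bool × Bool, splitCoeff (-1) i p.1 p.2 •
        (labelFactor p.1 x * labelFactor p.2 y) := by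
  rw [Fintype.sum_prod_type]
  simp only [Fintype.sum_bool]
  cases i
  · rcases h with rfl | rfl
    · have hz := eq_neg_of_add_eq_zero_left (ExteriorAlgebra.ι_add_mul_swap (R := ℤ)
        (Finsupp.single z (1 : ℤ)) (Finsupp.single y 1))
      simp [labelFactor, splitCoeff, sub_mul, hz]
    · simp [labelFactor, splitCoeff, sub_mul]
  · simp only [labelFactor, splitCoeff, if_true, mul_one, one_mul, zero_smul, one_smul, neg_smul,
      Bool.false_eq_true, if_false, zero_add, add_zero]
    abel

section OddEdge

variable {c : Fin D.crossings} {ξ ξ' : D.Cube}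

theorem IsEdge.map_wedge_rest (h : D.IsEdge c ξ ξ') (arrow : Fin D.crossings → Bool)
    (s : D.Labeling ξ) (s' : D.Labeling ξ')
    (hs : ∀ e, D.circ ξ e ≠ D.circ ξ (D.arc c (D.tail arrow c)) →
      D.circ ξ e ≠ D.circ ξ (D.arc c (D.tail arrow c + 2)) → s (D.circ ξ e) = s' (D.circ ξ' e)) :
    ExteriorAlgebra.map (Finsupp.lmapDomain ℤ ℤ (D.carry ξ ξ')) (wedge s
      ((D.restArcs ξ (D.circ ξ (D.arc c (D.tail arrow c)))
        (D.circ ξ (D.arc c (D.tail arrow c + 2)))).map (D.circ ξ))) =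
    wedge s' ((D.restArcs ξ (D.circ ξ (D.arc c (D.tail arrow c)))
        (D.circ ξ (D.arc c (D.tail arrow c + 2)))).map (D.circ ξ')) := by
  rw [wedge, wedge, map_list_prod, List.map_map, List.map_map, List.map_map]
  congr 1
  refine List.map_congr_left fun e he => ?_
  have he' := (D.mem_restArcs.1 he).1
  obtain ⟨e', h1, h2⟩ := D.circ_carry ξ ξ' e
  simp only [Function.comp_apply, wedgeFactor_eq, map_labelFactor]
  rw [h2, (h.rest_circ_iff arrow he' e').1 h1, hs e he'.1 he'.2]

theorem IsEdge.carry_tail (h : D.IsEdge c ξ ξ') (arrow : Fin D.crossings → Bool) {e : Fin D.arcs}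
    (he : D.circ ξ e = D.circ ξ (D.arc c (D.tail arrow c)) ∨
      D.circ ξ e = D.circ ξ (D.arc c (D.tail arrow c + 2))) :
    D.carry ξ ξ' (D.circ ξ e) = D.circ ξ' (D.arc c (D.tail arrow c + 1)) ∨
      D.carry ξ ξ' (D.circ ξ e) = D.circ ξ' (D.arc c (D.tail arrow c + 3)) := by
  obtain ⟨e', h1, h2⟩ := D.circ_carry ξ ξ' e
  rw [h2]
  rw [← h1] at he
  by_contra hne
  rw [not_or] at hne
  have := (h.rest_iff arrow e').2 hne
  exact he.elim this.1 this.2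

/-- The saddles of odd Khovanov homology in the local bases. -/
theorem IsEdge.oddEdge_wedge_front (h : D.IsEdge c ξ ξ') (arrow : Fin D.crossings → Bool)
    (s : D.Labeling ξ) :
    D.oddEdge arrow c ξ ξ' (wedge s (D.listSrc arrow c ξ)) =
      ∑ s' : D.Labeling ξ', D.saddleEntry evenMerge (splitCoeff (-1)) (D.tail arrow c) c ξ ξ' s s' •
        wedge s' (D.listTgt arrow c ξ') := by
  by_cases hab : D.circ ξ (D.arc c (D.tail arrow c)) = D.circ ξ (D.arc c (D.tail arrow c + 2))
  · have hab' := (h.tail_ne_iff arrow).1 hab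
    -- Only labelings that agree with `s` away from the saddle contribute; they are parametrized by
    -- the labels of the two new circles.
    have hsum := Fintype.sum_of_injective
      (fun p : Bool × Bool => extendLabeling arrow c ξ' s p.1 p.2) (fun p q hpq => by
        have e1 := congrFun hpq (D.circ ξ' (D.arc c (D.tail arrow c + 1)))
        have e2 := congrFun hpq (D.circ ξ' (D.arc c (D.tail arrow c + 3)))
        simp only [extendLabeling, if_true, hab'.symm, if_false] at e1 e2
        exact Prod.ext e1 e2)
      (fun p => D.saddleEntry evenMerge (splitCoeff (-1)) (D.tail arrow c) c ξ ξ' s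
        (extendLabeling arrow c ξ' s p.1 p.2) •
          wedge (extendLabeling arrow c ξ' s p.1 p.2) (D.listTgt arrow c ξ'))
      (fun s' => D.saddleEntry evenMerge (splitCoeff (-1)) (D.tail arrow c) c ξ ξ' s s' •
        wedge s' (D.listTgt arrow c ξ')) (fun s' hs' => by
        simp only [saddleEntry]
        rw [if_neg, zero_smul]
        exact fun hs => hs' ⟨(_, _), h.eq_extendLabeling arrow hs⟩) (fun _ => rfl)
    rw [← hsum]
    simp only [oddEdge, hab, ne_eq, not_true_eq_false, if_false, LinearMap.comp_apply,
      LinearMap.mulLeft_apply, AlgHom.toLinearMap_apply]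
    rw [listSrc, frontList, if_pos hab, List.singleton_append, wedge_cons, map_mul, wedgeFactor_eq,
      map_labelFactor, ← mul_assoc, split_labelFactor _ _ _ _ (h.carry_tail arrow (Or.inl rfl)),
      Finset.sum_mul]
    refine Finset.sum_congr rfl fun p _ => ?_
    rw [h.map_wedge_rest arrow s (extendLabeling arrow c ξ' s p.1 p.2) fun e h0 h2 =>
      (h.extendLabeling_rest arrow s _ _ ⟨h0, h2⟩).symm]
    simp only [saddleEntry]
    rw [if_pos fun e h0 h2 => (h.extendLabeling_rest arrow s _ _ ⟨h0, h2⟩).symm,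
      if_neg (not_not.2 hab), listTgt, frontList, if_neg hab', h.restArcs_eq arrow,
      List.cons_append, List.singleton_append, wedge_cons, wedge_cons, wedgeFactor_eq,
      wedgeFactor_eq, smul_mul_assoc, mul_assoc]
    have e1 : extendLabeling arrow c ξ' s p.1 p.2 (D.circ ξ' (D.arc c (D.tail arrow c + 1))) =
        p.1 := by simp [extendLabeling]
    have e2 : extendLabeling arrow c ξ' s p.1 p.2 (D.circ ξ' (D.arc c (D.tail arrow c + 3))) =
        p.2 := by simp [extendLabeling, hab'.symm]
    rw [e1, e2]
  · have hab' := not_not.1 (mt (h.tail_ne_iff arrow).2 hab)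
    have hsum := Fintype.sum_of_injective
      (fun i : Bool => extendLabeling arrow c ξ' s i i) (fun i j hij => by
        have e1 := congrFun hij (D.circ ξ' (D.arc c (D.tail arrow c + 1)))
        simpa only [extendLabeling, if_true] using e1)
      (fun i => D.saddleEntry evenMerge (splitCoeff (-1)) (D.tail arrow c) c ξ ξ' s
        (extendLabeling arrow c ξ' s i i) •
          wedge (extendLabeling arrow c ξ' s i i) (D.listTgt arrow c ξ'))
      (fun s' => D.saddleEntry evenMerge (splitCoeff (-1)) (D.tail arrow c) c ξ ξ' s s' •
        wedge s' (D.listTgt arrow c ξ')) (fun s' hs' => by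
        simp only [saddleEntry]
        rw [if_neg, zero_smul]
        intro hs
        have := h.eq_extendLabeling arrow hs
        rw [← hab'] at this
        exact hs' ⟨_, this⟩) (fun _ => rfl)
    rw [← hsum]
    simp only [oddEdge, hab, ne_eq, not_false_eq_true, if_true, AlgHom.toLinearMap_apply]
    have ha := h.carry_tail arrow (e := D.arc c (D.tail arrow c)) (Or.inl rfl)
    have hb := h.carry_tail arrow (e := D.arc c (D.tail arrow c + 2)) (Or.inr rfl)
    rw [← hab', or_self] at ha hb
    rw [listSrc, frontList, if_neg hab, List.cons_append, List.singleton_append, wedge_cons,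
      wedge_cons, map_mul, map_mul, wedgeFactor_eq, wedgeFactor_eq, map_labelFactor,
      map_labelFactor, ← mul_assoc, ha, hb, labelFactor_mul_self, Finset.sum_mul]
    refine Finset.sum_congr rfl fun i _ => ?_
    rw [h.map_wedge_rest arrow s (extendLabeling arrow c ξ' s i i) fun e h0 h2 =>
      (h.extendLabeling_rest arrow s _ _ ⟨h0, h2⟩).symm]
    simp only [saddleEntry]
    rw [if_pos fun e h0 h2 => (h.extendLabeling_rest arrow s _ _ ⟨h0, h2⟩).symm,
      if_pos hab, listTgt, frontList, if_pos hab', h.restArcs_eq arrow,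
      List.singleton_append, wedge_cons, wedgeFactor_eq, smul_mul_assoc]
    have e1 : extendLabeling arrow c ξ' s i i (D.circ ξ' (D.arc c (D.tail arrow c + 1))) =
        i := by simp [extendLabeling]
    rw [e1]

/-- The reordering factors of `redEntry` at -1 are the signs of permuting the factors of a monomial,
before and after the saddle. -/
theorem IsEdge.oddEdge_wedge (h : D.IsEdge c ξ ξ') {order : ∀ ξ : D.Cube, D.Circle ξ → ℕ}
    (horder : ∀ ξ, Function.Injective (order ξ)) (arrow : Fin D.crossings → Bool)
    (s : D.Labeling ξ) :
    D.oddEdge arrow c ξ ξ' (wedge s (orderList horder ξ)) =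
      ∑ s' : D.Labeling ξ', D.redEntry order arrow (-1) c ξ ξ' s s' •
        wedge s' (orderList horder ξ') := by
  have e1 := (wedge_isReorderable s).eq_smul (orderList_pairwise horder ξ)
    (D.frontList_pairwise ξ (D.circ ξ (D.arc c (D.tail arrow c)))
      (D.circ ξ (D.arc c (D.tail arrow c + 2)))) (mem_orderList horder ξ) (D.mem_frontList ξ _ _)
  rw [e1, map_smul, h.oddEdge_wedge_front, Finset.smul_sum]
  refine Finset.sum_congr rfl fun s' _ => ?_
  have e2 := (wedge_isReorderable s').eq_smul (D.frontList_pairwise ξ'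
    (D.circ ξ' (D.arc c (D.tail arrow c + 1))) (D.circ ξ' (D.arc c (D.tail arrow c + 3))))
    (orderList_pairwise horder ξ') (D.mem_frontList ξ' _ _) (mem_orderList horder ξ')
  rw [e2, smul_smul, smul_smul, redEntry]
  rfl

end OddEdge

variable {order : ∀ ξ : D.Cube, D.Circle ξ → ℕ} (horder : ∀ ξ, Function.Injective (order ξ))

/-- The basis of monomials of the exterior algebra over the circles of a resolution. -/
def oddBasis (ξ : D.Cube) : (D.Labeling ξ → ℤ) ≃ₗ[ℤ] D.OddModule ξ :=
  (exists_wedge_equiv (order ξ) (horder ξ)).choose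

theorem oddBasis_single (ξ : D.Cube) (s : D.Labeling ξ) :
    oddBasis horder ξ (Pi.single s 1) = wedge s (orderList horder ξ) :=
  (exists_wedge_equiv (order ξ) (horder ξ)).choose_spec s _ (orderList_pairwise horder ξ)
    (mem_orderList horder ξ)

end LinkDiagram

end
-- Isomorphisms of cubes up to signs, and their face signs.
noncomputable section

/-! ### Isomorphisms of complexes and of cubes -/

/-- Isomorphic complexes have isomorphic homology; the rings of coefficients may differ. -/
theorem nonempty_homologyAt_equiv {R R' A B C A' B' C' : Type} [CommRing R] [CommRing R']
    [AddCommGroup A] [AddCommGroup B] [AddCommGroup C] [AddCommGroup A'] [AddCommGroup B']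
    [AddCommGroup C'] [Module R A] [Module R B] [Module R C] [Module R' A'] [Module R' B']
    [Module R' C'] {f : A →ₗ[R] B} {g : B →ₗ[R] C} {f' : A' →ₗ[R'] B'} {g' : B' →ₗ[R'] C'}
    (a : A ≃+ A') (b : B ≃+ B') (c : C ≃+ C') (hf : ∀ x, b (f x) = f' (a x))
    (hg : ∀ y, c (g y) = g' (b y)) :
    Nonempty (LinkDiagram.homologyAt f g ≃+ LinkDiagram.homologyAt f' g') := by
  have hk (y : B) : y ∈ LinearMap.ker g ↔ b y ∈ LinearMap.ker g' := by
    rw [LinearMap.mem_ker, LinearMap.mem_ker, ← hg, map_eq_zero_iff c c.injective]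
  let k : LinearMap.ker g ≃+ LinearMap.ker g' :=
    { toFun := fun y => ⟨b y, (hk y).1 y.2⟩
      invFun := fun y => ⟨b.symm y, (hk _).2 (by rw [b.apply_symm_apply]; exact y.2)⟩
      left_inv := fun y => Subtype.ext (b.symm_apply_apply _)
      right_inv := fun y => Subtype.ext (b.apply_symm_apply _)
      map_add' := fun y z => Subtype.ext (map_add b _ _) }
  refine ⟨QuotientAddGroup.congr ((LinearMap.range f).submoduleOf (LinearMap.ker g)).toAddSubgroup
    ((LinearMap.range f').submoduleOf (LinearMap.ker g')).toAddSubgroup k ?_⟩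
  ext y
  constructor
  · rintro ⟨x, ⟨z, hz⟩, rfl⟩
    exact ⟨a z, (hf z).symm.trans (congrArg b hz)⟩
  · rintro ⟨z, hz⟩
    refine ⟨k.symm y, ⟨a.symm z, b.injective ?_⟩, k.apply_symm_apply y⟩
    rw [hf, a.apply_symm_apply, hz]
    exact (b.apply_symm_apply _).symm

namespace LinkDiagram

variable {D : LinkDiagram}

/-- The faces of the cube in the directions `c` and `c'`. -/
structure IsFace (D : LinkDiagram) (ξ ξ₁ ξ₂ ξ₁₂ : D.Cube) (c c' : Fin D.crossings) : Prop where
  ne : c ≠ c'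
  edge₁ : D.IsEdge c ξ ξ₁
  edge₁₂ : D.IsEdge c' ξ₁ ξ₁₂
  edge₂ : D.IsEdge c' ξ ξ₂
  edge₂₁ : D.IsEdge c ξ₂ ξ₁₂

/-- The coboundary of a cochain of signs, on a face. -/
def faceSign (τ : D.Cube → Fin D.crossings → ℤˣ) (ξ ξ₁ ξ₂ : D.Cube) (c c' : Fin D.crossings) : ℤˣ :=
  τ ξ c * τ ξ₁ c' * (τ ξ c' * τ ξ₂ c)

theorem faceSign_mul (τ τ' : D.Cube → Fin D.crossings → ℤˣ) (ξ ξ₁ ξ₂ : D.Cube)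
    (c c' : Fin D.crossings) :
    faceSign (τ * τ') ξ ξ₁ ξ₂ c c' = faceSign τ ξ ξ₁ ξ₂ c c' * faceSign τ' ξ ξ₁ ξ₂ c c' := by
  simp only [faceSign, Pi.mul_apply]
  ac_rfl

theorem exists_isFace {ξ : D.Cube} {c c' : Fin D.crossings} (hne : c ≠ c') (h : ξ c = false)
    (h' : ξ c' = false) : D.IsFace ξ (Function.update ξ c true) (Function.update ξ c' true)
      (Function.update (Function.update ξ c true) c' true) c c' where
  ne := hne
  edge₁ := ⟨h, rfl⟩
  edge₁₂ := ⟨by rw [Function.update_of_ne hne.symm, h'], rfl⟩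
  edge₂ := ⟨h', rfl⟩
  edge₂₁ := ⟨by rw [Function.update_of_ne hne, h], Function.update_comm hne ..⟩

/-- On a cube, every cocycle of signs is a coboundary. -/
theorem exists_vertex_signs (τ : D.Cube → Fin D.crossings → ℤˣ)
    (hτ : ∀ ξ ξ₁ ξ₂ ξ₁₂ c c', D.IsFace ξ ξ₁ ξ₂ ξ₁₂ c c' → faceSign τ ξ ξ₁ ξ₂ c c' = 1) :
    ∃ ρ : D.Cube → ℤˣ, ∀ c ξ ξ', D.IsEdge c ξ ξ' → τ ξ c = ρ ξ * ρ ξ' := by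
  suffices H : ∀ S : Finset (Fin D.crossings), ∃ ρ : D.Cube → ℤˣ,
      ∀ c ∈ S, ∀ ξ ξ', D.IsEdge c ξ ξ' → τ ξ c = ρ ξ * ρ ξ' by
    obtain ⟨ρ, hρ⟩ := H Finset.univ
    exact ⟨ρ, fun c => hρ c (Finset.mem_univ c)⟩
  intro S
  induction S using Finset.induction_on with
  | empty => exact ⟨fun _ => 1, by simp⟩
  | insert a S ha ih =>
    obtain ⟨ρ, hρ⟩ := ih
    -- Where `ξ a` is true, this equals τ ξ₀ a · ρ ξ₀ for the neighbour ξ₀ with `a` reset. Edges in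
    -- direction `a` then have the right sign by construction, and the edges parallel to those
    -- already treated have it by the cocycle condition.
    refine ⟨fun ξ => ρ ξ * if ξ a = true then τ (Function.update ξ a false) a *
      (ρ (Function.update ξ a false) * ρ ξ) else 1, fun c hc ξ ξ' h => ?_⟩
    have hsq (u : ℤˣ) : u * u = 1 := Int.units_mul_self u
    by_cases hca : c = a
    · subst hca
      obtain ⟨h0, rfl⟩ := h
      have : Function.update ξ c false = ξ := by rw [← h0, Function.update_eq_self]
      simp only [h0, Bool.false_eq_true, if_false, Function.update_self, if_true,
        Function.update_idem, this, mul_one]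
      calc τ ξ c = τ ξ c * (ρ ξ * ρ ξ) * (ρ (Function.update ξ c true) *
            ρ (Function.update ξ c true)) := by rw [hsq, hsq, mul_one, mul_one]
        _ = _ := by ac_rfl
    · have hcS := (Finset.mem_insert.1 hc).resolve_left hca
      have h1 := hρ c hcS ξ ξ' h
      obtain ⟨h0, rfl⟩ := h
      simp only [Function.update_of_ne (Ne.symm hca)]
      by_cases hξ : ξ a = true
      · simp only [hξ, if_true]
        obtain ⟨ξ0, hξ0⟩ : ∃ ξ0, ξ0 = Function.update ξ a false := ⟨_, rfl⟩
        have hξ' : ξ = Function.update ξ0 a true := by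
          rw [hξ0, Function.update_idem, ← hξ, Function.update_eq_self]
        have e1 : ξ0 a = false := by rw [hξ0, Function.update_self]
        have e2 : ξ0 c = false := by rw [hξ0, Function.update_of_ne hca, h0]
        have hf := exists_isFace hca e2 e1
        have h2 := hρ c hcS _ _ hf.edge₁
        have h3 := hτ _ _ _ _ _ _ hf
        rw [faceSign, ← hξ', h1, h2] at h3
        rw [Function.update_comm hca, ← hξ0, h1]
        generalize ρ (Function.update ξ0 c true) = r1 at *
        generalize ρ (Function.update ξ c true) = r2 at *
        generalize ρ ξ = r3 at *
        generalize ρ ξ0 = r4 at *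
        generalize τ ξ0 a = r5 at *
        generalize τ _ a = r6 at *
        rcases Int.units_eq_one_or r1 with rfl | rfl <;> rcases Int.units_eq_one_or r2 with rfl | rfl <;>
          rcases Int.units_eq_one_or r3 with rfl | rfl <;> rcases Int.units_eq_one_or r4 with rfl | rfl <;>
          rcases Int.units_eq_one_or r5 with rfl | rfl <;> rcases Int.units_eq_one_or r6 with rfl | rfl <;>
          revert h3 <;> decide
      · simp only [hξ, Bool.false_eq_true, if_false, mul_one, h1]

section Intertwine

variable {V V' V'' : D.Cube → Type} [∀ ξ, AddCommGroup (V ξ)] [∀ ξ, AddCommGroup (V' ξ)]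
  [∀ ξ, AddCommGroup (V'' ξ)]

/-- Isomorphisms between the modules of two cubes that commute with the edge maps up to signs. -/
def Intertwines (G : ∀ ξ, V ξ ≃ₗ[ℤ] V' ξ)
    (edge : Fin D.crossings → ∀ ξ ξ' : D.Cube, V ξ →ₗ[ℤ] V ξ')
    (edge' : Fin D.crossings → ∀ ξ ξ' : D.Cube, V' ξ →ₗ[ℤ] V' ξ')
    (η : D.Cube → Fin D.crossings → ℤˣ) : Prop :=
  ∀ c ξ ξ', D.IsEdge c ξ ξ' → ∀ v, G ξ' (edge c ξ ξ' v) = (η ξ c : ℤ) • edge' c ξ ξ' (G ξ v)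

variable {G : ∀ ξ, V ξ ≃ₗ[ℤ] V' ξ} {G' : ∀ ξ, V' ξ ≃ₗ[ℤ] V'' ξ}
  {edge : Fin D.crossings → ∀ ξ ξ' : D.Cube, V ξ →ₗ[ℤ] V ξ'}
  {edge' : Fin D.crossings → ∀ ξ ξ' : D.Cube, V' ξ →ₗ[ℤ] V' ξ'}
  {edge'' : Fin D.crossings → ∀ ξ ξ' : D.Cube, V'' ξ →ₗ[ℤ] V'' ξ'}
  {η η' ε ε' : D.Cube → Fin D.crossings → ℤˣ}

theorem Intertwines.trans (h : Intertwines G edge edge' η) (h' : Intertwines G' edge' edge'' η') :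
    Intertwines (fun ξ => (G ξ).trans (G' ξ)) edge edge'' (η * η') := by
  intro c ξ ξ' he v
  rw [LinearEquiv.trans_apply, LinearEquiv.trans_apply, h c ξ ξ' he, map_smul, h' c ξ ξ' he,
    smul_smul, Pi.mul_apply, Pi.mul_apply, Units.val_mul]

/-- The condition `δε = -ψ` for a cube with integral coefficients. -/
def Anticommutes (edge : Fin D.crossings → ∀ ξ ξ' : D.Cube, V ξ →ₗ[ℤ] V ξ')
    (ε : D.Cube → Fin D.crossings → ℤˣ) : Prop :=
  ∀ ξ ξ₁ ξ₂ ξ₁₂ c c', D.IsFace ξ ξ₁ ξ₂ ξ₁₂ c c' → ∀ v,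
    ((ε ξ c * ε ξ₁ c' : ℤˣ) : ℤ) • edge c' ξ₁ ξ₁₂ (edge c ξ ξ₁ v) =
      -(((ε ξ c' * ε ξ₂ c : ℤˣ) : ℤ) • edge c ξ₂ ξ₁₂ (edge c' ξ ξ₂ v))

theorem Anticommutes.eq_faceSign (h : Anticommutes edge ε) {ξ ξ₁ ξ₂ ξ₁₂ : D.Cube}
    {c c' : Fin D.crossings} (hf : D.IsFace ξ ξ₁ ξ₂ ξ₁₂ c c') (v : V ξ) :
    edge c ξ₂ ξ₁₂ (edge c' ξ ξ₂ v) =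
      (-faceSign ε ξ ξ₁ ξ₂ c c' : ℤˣ) • edge c' ξ₁ ξ₁₂ (edge c ξ ξ₁ v) := by
  have h1 := congrArg (fun w => ((ε ξ c' * ε ξ₂ c : ℤˣ) : ℤ) • w) (h _ _ _ _ _ _ hf v)
  simp only [smul_neg, smul_smul, ← Units.val_mul, Int.units_mul_self, Units.val_one,
    one_smul] at h1
  rw [eq_comm, neg_eq_iff_eq_neg] at h1
  rw [h1, faceSign, mul_comm (ε ξ c * ε ξ₁ c'), Units.smul_def, Units.val_neg, neg_smul]

theorem Anticommutes.transport (h : Anticommutes edge ε) (hG : Intertwines G edge edge' η) :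
    Anticommutes edge' (ε * η) := by
  intro ξ ξ₁ ξ₂ ξ₁₂ c c' hf v
  obtain ⟨v, rfl⟩ := (G ξ).surjective v
  have h1 := congrArg (G ξ₁₂) (h _ _ _ _ _ _ hf v)
  rw [map_smul, map_neg, map_smul, hG _ _ _ hf.edge₁₂, hG _ _ _ hf.edge₁, hG _ _ _ hf.edge₂₁,
    hG _ _ _ hf.edge₂, map_smul, map_smul, smul_smul, smul_smul, smul_smul, smul_smul] at h1
  simp only [Pi.mul_apply, Units.val_mul] at h1 ⊢
  rw [mul_mul_mul_comm, mul_comm (η ξ c : ℤ), ← mul_assoc, h1, mul_mul_mul_comm (ε ξ c' : ℤ),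
    mul_comm (η ξ c' : ℤ), ← mul_assoc]

/-- Both assignments express one composition through the other by a sign; two different signs would
make a vector equal to its negative. -/
theorem Anticommutes.faceSign_eq (h : Anticommutes edge ε) (h' : Anticommutes edge ε')
    {ξ ξ₁ ξ₂ ξ₁₂ : D.Cube} {c c' : Fin D.crossings} (hf : D.IsFace ξ ξ₁ ξ₂ ξ₁₂ c c') {v : V ξ}
    (hv : edge c' ξ₁ ξ₁₂ (edge c ξ ξ₁ v) ≠ -edge c' ξ₁ ξ₁₂ (edge c ξ ξ₁ v)) :
    faceSign ε ξ ξ₁ ξ₂ c c' = faceSign ε' ξ ξ₁ ξ₂ c c' := by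
  have h1 := (h.eq_faceSign hf v).symm.trans (h'.eq_faceSign hf v)
  rcases Int.units_eq_one_or (faceSign ε ξ ξ₁ ξ₂ c c') with e | e <;>
    rcases Int.units_eq_one_or (faceSign ε' ξ ξ₁ ξ₂ c c') with e' | e' <;>
    rw [e, e'] at h1 ⊢
  · rw [neg_neg, one_smul, Units.neg_smul, one_smul] at h1
    exact absurd h1.symm hv
  · rw [neg_neg, one_smul, Units.neg_smul, one_smul] at h1
    exact absurd h1 hv

open Classical in
theorem differential_apply {R : Type} [CommRing R] {V : D.Cube → Type} [∀ ξ, AddCommGroup (V ξ)]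
    [∀ ξ, Module R (V ξ)] (edge : Fin D.crossings → ∀ ξ ξ' : D.Cube, V ξ →ₗ[R] V ξ')
    (ε : D.Cube → Fin D.crossings → Rˣ) (i j : ℤ) (v : ∀ ξ : D.Level i, V ξ) (ξ' : D.Level j) :
    D.differential edge ε i j v ξ' = ∑ ξ : D.Level i, ∑ c : Fin D.crossings,
      if D.IsEdge c ξ ξ' then ((ε ξ c : Rˣ) : R) • edge c ξ ξ' (v ξ) else 0 := by
  simp only [differential, LinearMap.pi_apply, LinearMap.sum_apply]
  refine Finset.sum_congr rfl fun ξ _ => Finset.sum_congr rfl fun c _ => ?_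
  split_ifs <;> rfl

/-- Cubes that are isomorphic up to signs have isomorphic homology, if the signs match on faces. -/
theorem Intertwines.nonempty_homology_equiv (hG : Intertwines G edge edge' η)
    (hτ : ∀ ξ ξ₁ ξ₂ ξ₁₂ c c', D.IsFace ξ ξ₁ ξ₂ ξ₁₂ c c' →
      faceSign (ε * η) ξ ξ₁ ξ₂ c c' = faceSign ε' ξ ξ₁ ξ₂ c c') (i : ℤ) :
    Nonempty (homologyAt (D.differential edge ε (i - 1) i) (D.differential edge ε i (i + 1)) ≃+
      homologyAt (D.differential edge' ε' (i - 1) i) (D.differential edge' ε' i (i + 1))) := by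
  obtain ⟨ρ, hρ⟩ := exists_vertex_signs (ε * η * ε') fun ξ ξ₁ ξ₂ ξ₁₂ c c' hf => by
    rw [faceSign_mul, hτ _ _ _ _ _ _ hf, Int.units_mul_self]
  let H (j : ℤ) : (∀ ξ : D.Level j, V ξ) ≃+ (∀ ξ : D.Level j, V' ξ) :=
    AddEquiv.piCongrRight fun ξ =>
      ((G ξ).trans (LinearEquiv.smulOfUnit (ρ ξ) : V' ξ ≃ₗ[ℤ] V' ξ)).toAddEquiv
  have hH (j k : ℤ) (v : ∀ ξ : D.Level j, V ξ) :
      H k (D.differential edge ε j k v) = D.differential edge' ε' j k (H j v) := by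
    classical
    ext ξ'
    have hH' (l : ℤ) (u : ∀ ξ : D.Level l, V ξ) (ξ : D.Level l) :
        H l u ξ = (ρ ξ : ℤ) • G ξ (u ξ) := rfl
    rw [differential_apply, hH', differential_apply, map_sum, Finset.smul_sum]
    refine Finset.sum_congr rfl fun ξ _ => ?_
    rw [map_sum, Finset.smul_sum]
    refine Finset.sum_congr rfl fun c _ => ?_
    split_ifs with he
    · rw [map_smul, hG _ _ _ he, hH', map_smul, smul_smul, smul_smul, smul_smul]
      congr 1
      have := hρ _ _ _ he
      simp only [Pi.mul_apply] at this
      rw [← Units.val_mul, ← Units.val_mul, ← Units.val_mul]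
      congr 1
      have hsq (u : ℤˣ) : u * u = 1 := Int.units_mul_self u
      calc ρ ξ' * ε ξ c * η ξ c = ρ ξ' * (ε ξ c * η ξ c * ε' ξ c) * ε' ξ c := by
            rw [mul_assoc (ρ _) _ (ε' ξ c), mul_assoc _ (ε' ξ c) (ε' ξ c), hsq, mul_one,
              ← mul_assoc]
        _ = ε' ξ c * ρ ξ := by
            rw [this, mul_comm (ρ ξ), ← mul_assoc, hsq, one_mul, mul_comm]
    · rw [map_zero, smul_zero]
  exact nonempty_homologyAt_equiv (H (i - 1)) (H i) (H (i + 1)) (hH _ _) (hH _ _)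

end Intertwine

end LinkDiagram

end
-- Tensoring with the integers specializes the coefficients.
noncomputable section

/-- The action of a commutative ring on the integers, as a homomorphism. -/
def scalarHom (R : Type*) [CommRing R] [Module R ℤ] : R →+* ℤ where
  toFun r := r • (1 : ℤ)
  map_one' := one_smul R 1
  map_mul' r r' := by
    have h : r' • (1 : ℤ) = (r' • (1 : ℤ)) • (1 : ℤ) := by simp
    rw [mul_smul, h, smul_comm r, ← h, smul_eq_mul, mul_comm]
  map_zero' := zero_smul R 1
  map_add' r r' := add_smul r r' 1

theorem smul_eq_scalarHom_mul {R : Type*} [CommRing R] [Module R ℤ] (r : R) (m : ℤ) :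
    r • m = scalarHom R r * m := by
  have h : m = m • (1 : ℤ) := by simp
  conv_lhs => rw [h, smul_comm r]
  rw [smul_eq_mul, mul_comm]
  rfl

theorem exists_isSpecialization (φ : ChronoRing →+* ℤ) :
    ∃ x y z : ℤˣ, LinkDiagram.IsSpecialization φ x y z := by
  have hu (a b : ChronoRing) (h : a * b = 1) : ∃ u : ℤˣ, φ a = u :=
    ⟨⟨φ a, φ b, by rw [← map_mul, h, map_one], by rw [← map_mul, mul_comm, h, map_one]⟩, rfl⟩
  have hX : ChronoRing.X * ChronoRing.X = 1 := by
    rw [← ChronoRing.mono_zero, ChronoRing.X, ChronoRing.mono_mul]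
    simp only [ChronoRing.mono, Int.cast_add, Int.cast_one, Int.cast_zero, zero_add]
    rfl
  have hY : ChronoRing.Y * ChronoRing.Y = 1 := by
    rw [← ChronoRing.mono_zero, ChronoRing.Y, ChronoRing.mono_mul]
    simp only [ChronoRing.mono, Int.cast_add, Int.cast_one, Int.cast_zero, zero_add]
    rfl
  have hZ : ChronoRing.Z * ChronoRing.mono 0 0 (-1) = 1 := by
    rw [← ChronoRing.mono_zero, ChronoRing.Z, ChronoRing.mono_mul]
    simp
  obtain ⟨x, hx⟩ := hu _ _ hX
  obtain ⟨y, hy⟩ := hu _ _ hY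
  obtain ⟨z, hz⟩ := hu _ _ hZ
  exact ⟨x, y, z, hx, hy, hz⟩

/-- The endomorphism of the group of monomials that identifies `Y` with `X`. -/
def monomialFold : ChronoMonomial →* ChronoMonomial where
  toFun m := (m.1 * m.2.1, 1, m.2.2)
  map_one' := by simp
  map_mul' m m' := by
    simp only [Prod.fst_mul, Prod.snd_mul, Prod.mk_mul_mk, mul_one, mul_mul_mul_comm]

namespace LinkDiagram

variable {D : LinkDiagram}

/-- Replacing y by x keeps x and w = xz, hence every `edgeSign`, but makes xy = 1. Each
specialization thus has an even companion with the same edge signs. -/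
theorem IsSpecialization.fold {φ : ChronoRing →+* ℤ} {x y z : ℤˣ}
    (hφ : IsSpecialization φ x y z) :
    IsSpecialization (φ.comp (MonoidAlgebra.mapDomainRingHom ℤ monomialFold)) x x z := by
  have h (a b c : ℤ) : MonoidAlgebra.mapDomainRingHom ℤ monomialFold (ChronoRing.mono a b c) =
      ChronoRing.mono (a + b) 0 c := by
    simp [ChronoRing.mono, monomialFold]
  refine ⟨?_, ?_, ?_⟩ <;> rw [RingHom.comp_apply]
  · rw [ChronoRing.X, h]
    exact hφ.map_X
  · rw [ChronoRing.Y, h]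
    exact hφ.map_X
  · rw [ChronoRing.Z, h]
    exact hφ.map_Z

section Specialize

variable (order : ∀ ξ : D.Cube, D.Circle ξ → ℕ) (arrow : Fin D.crossings → Bool)

/-- The matrix of a saddle of the generalized theory. -/
def genMatrix (c : Fin D.crossings) (ξ ξ' : D.Cube) :
    Matrix (D.Labeling ξ') (D.Labeling ξ) ChronoRing :=
  Matrix.of fun s' s => D.reorder (order ξ) (D.frontSrc arrow c ξ) s *
    D.saddleEntry chMerge chSplit (D.tail arrow c) c ξ ξ' s s' *
    D.reorder (D.frontTgt arrow c ξ') (order ξ') s'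

/-- The saddles of the generalized theory, with specialized coefficients. -/
def specEdge (φ : ChronoRing →+* ℤ) (c : Fin D.crossings) (ξ ξ' : D.Cube) :
    (D.Labeling ξ → ℤ) →ₗ[ℤ] (D.Labeling ξ' → ℤ) :=
  ((genMatrix order arrow c ξ ξ').map φ).mulVecLin

variable {order arrow}

theorem map_genEdge (φ : ChronoRing →+* ℤ) (c : Fin D.crossings) (ξ ξ' : D.Cube)
    (v : D.Labeling ξ → ChronoRing) :
    φ ∘ D.genEdge order arrow c ξ ξ' v = specEdge order arrow φ c ξ ξ' (φ ∘ v) := by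
  ext s
  exact RingHom.map_mulVec φ _ _ _

/-- Specialized signs. -/
def specSign (φ : ChronoRing →+* ℤ) (ε : D.Cube → Fin D.crossings → ChronoRingˣ) (ξ : D.Cube)
    (c : Fin D.crossings) : ℤˣ :=
  Units.map (φ : ChronoRing →* ℤ) (ε ξ c)

theorem coe_specSign (φ : ChronoRing →+* ℤ) (ε : D.Cube → Fin D.crossings → ChronoRingˣ)
    (ξ : D.Cube) (c : Fin D.crossings) :
    (specSign φ ε ξ c : ℤ) = φ (ε ξ c) := rfl

theorem IsSignAssignment.anticommutes_spec {p : ChronoRingˣ} {conv : Bool}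
    {ε : D.Cube → Fin D.crossings → ChronoRingˣ}
    (hε : D.IsSignAssignment (D.genEdge order arrow) p arrow conv ε) (φ : ChronoRing →+* ℤ) :
    Anticommutes (specEdge order arrow φ) (specSign φ ε) := by
  intro ξ ξ₁ ξ₂ ξ₁₂ c c' hf v
  -- Integral vectors lift to the coefficient ring, where the relation is known.
  have hv : v = φ ∘ fun s => ((v s : ℤ) : ChronoRing) := by
    ext s
    simp
  rw [hv, ← map_genEdge, ← map_genEdge, ← map_genEdge, ← map_genEdge]
  have h := LinearMap.congr_fun (hε.anticommute ξ ξ₁ ξ₂ ξ₁₂ c c' hf.ne hf.edge₁ hf.edge₁₂ hf.edge₂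
    hf.edge₂₁) fun s => ((v s : ℤ) : ChronoRing)
  ext s
  have hs := congrArg φ (congrFun h s)
  simp only [LinearMap.smul_apply, LinearMap.neg_apply, LinearMap.comp_apply, Pi.smul_apply,
    Pi.neg_apply, smul_eq_mul, map_mul, map_neg, Units.val_mul] at hs
  simpa only [Units.val_mul, Pi.smul_apply, Pi.neg_apply, Function.comp_apply, smul_eq_mul,
    coe_specSign] using hs

open Classical in
theorem IsSignAssignment.faceSign_spec {conv : Bool} {ε : D.Cube → Fin D.crossings → ChronoRingˣ}
    (hε : D.IsSignAssignment (D.genEdge order arrow) ChronoRing.XYunit arrow conv ε)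
    {φ : ChronoRing →+* ℤ} {x y z : ℤˣ} (hφ : IsSpecialization φ x y z) {ξ ξ₁ ξ₂ ξ₁₂ : D.Cube}
    {c c' : Fin D.crossings} (hf : D.IsFace ξ ξ₁ ξ₂ ξ₁₂ c c') (hl : D.IsLadybug ξ c c') :
    faceSign (specSign φ ε) ξ ξ₁ ξ₂ c c' =
      -(if (D.LadybugTail arrow ξ c c' ↔ conv = true) then 1 else x * y) := by
  have h := congrArg (fun u : ChronoRingˣ => φ u) (hε.ladybug ξ ξ₁ ξ₂ ξ₁₂ c c' hf.ne hf.edge₁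
    hf.edge₁₂ hf.edge₂ hf.edge₂₁ hl)
  have h' : specSign φ ε ξ c * specSign φ ε ξ₁ c' =
      -(if (D.LadybugTail arrow ξ c c' ↔ conv = true) then 1 else x * y) *
        (specSign φ ε ξ c' * specSign φ ε ξ₂ c) := by
    ext
    simp only [Units.val_mul, Units.val_neg, map_neg, map_mul] at h
    simp only [Units.val_mul, coe_specSign, h, Units.val_neg, neg_mul]
    congr 2
    split_ifs
    · simp
    · simp [ChronoRing.XYunit, hφ.map_X, hφ.map_Y]
  rw [faceSign, h', mul_assoc, Int.units_mul_self, mul_one]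

end Specialize

/-! ### Tensor products -/

section Tensor

variable [Module ChronoRing ℤ]

open TensorProduct

open Classical in
/-- Tensoring free modules on labelings with the integers specializes the coefficients. -/
def tensorEquiv (D : LinkDiagram) (i : ℤ) :
    (∀ ξ : D.Level i, D.Labeling ξ → ChronoRing) ⊗[ChronoRing] ℤ ≃+
      (∀ ξ : D.Level i, D.Labeling ξ → ℤ) :=
  ((TensorProduct.congr (LinearEquiv.piCurry ChronoRing
      (fun (ξ : D.Level i) (_ : D.Labeling ξ.1) => ChronoRing)).symm
      (LinearEquiv.refl ChronoRing ℤ)).trans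
    ((TensorProduct.comm ChronoRing _ ℤ).trans
      (TensorProduct.piScalarRight ChronoRing ChronoRing ℤ _))).toAddEquiv.trans
    (LinearEquiv.piCurry ℤ (fun (ξ : D.Level i) (_ : D.Labeling ξ.1) => ℤ)).toAddEquiv

theorem tensorEquiv_tmul (i : ℤ) (v : ∀ ξ : D.Level i, D.Labeling ξ → ChronoRing) (m : ℤ)
    (ξ : D.Level i) :
    D.tensorEquiv i (v ⊗ₜ m) ξ = m • (scalarHom ChronoRing ∘ v ξ) := by
  ext s
  rw [Pi.smul_apply, Function.comp_apply, smul_eq_mul, mul_comm, ← smul_eq_scalarHom_mul]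
  rfl

theorem nonempty_genHomology_equiv (order : ∀ ξ : D.Cube, D.Circle ξ → ℕ)
    (arrow : Fin D.crossings → Bool) (ε : D.Cube → Fin D.crossings → ChronoRingˣ) (i : ℤ) :
    Nonempty (D.genHomology order arrow ε ℤ i ≃+
      homologyAt (D.differential (specEdge order arrow (scalarHom ChronoRing))
        (specSign (scalarHom ChronoRing) ε) (i - 1) i)
        (D.differential (specEdge order arrow (scalarHom ChronoRing))
        (specSign (scalarHom ChronoRing) ε) i (i + 1))) := by
  classical
  have h (j k : ℤ) (w : (∀ ξ : D.Level j, D.Labeling ξ → ChronoRing) ⊗[ChronoRing] ℤ) :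
      D.tensorEquiv k ((D.differential (D.genEdge order arrow) ε j k).rTensor ℤ w) =
        D.differential (specEdge order arrow (scalarHom ChronoRing))
          (specSign (scalarHom ChronoRing) ε) j k (D.tensorEquiv j w) := by
    induction w with
    | zero => simp
    | add v w hv hw => rw [map_add, map_add, hv, hw, map_add, map_add]
    | tmul v m =>
      ext ξ' s
      rw [LinearMap.rTensor_tmul, tensorEquiv_tmul, differential_apply, differential_apply]
      simp only [tensorEquiv_tmul, map_smul, ← map_genEdge, Pi.smul_apply, Function.comp_apply,
        Finset.sum_apply, map_sum, Finset.smul_sum]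
      refine Finset.sum_congr rfl fun ξ _ => Finset.sum_congr rfl fun c _ => ?_
      split_ifs
      · simp only [Pi.smul_apply, smul_eq_mul, map_mul, coe_specSign, Function.comp_apply]
        ring
      · simp
  exact nonempty_homologyAt_equiv (D.tensorEquiv _) (D.tensorEquiv _) (D.tensorEquiv _)
    (h _ _) (h _ _)

end Tensor

end LinkDiagram

end
-- Comparison isomorphisms, and face signs of the even cube.
noncomputable section

namespace LinkDiagram

variable {D : LinkDiagram}

/-! ### Isomorphisms of the specialized cube with the even and odd cubes -/

section Gauge

variable {order : ∀ ξ : D.Cube, D.Circle ξ → ℕ} (horder : ∀ ξ, Function.Injective (order ξ))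
  (arrow : Fin D.crossings → Bool)

def gaugeEquiv (w : ℤˣ) (ξ : D.Cube) : (D.Labeling ξ → ℤ) ≃ₗ[ℤ] (D.Labeling ξ → ℤ) :=
  LinearEquiv.piCongrRight fun s => LinearEquiv.smulOfUnit (gaugeAt horder w ξ s)

variable (order) in
/-- The saddles with the matrix entries `redEntry`. -/
def redEdge (p : ℤ) (c : Fin D.crossings) (ξ ξ' : D.Cube) :
    (D.Labeling ξ → ℤ) →ₗ[ℤ] (D.Labeling ξ' → ℤ) :=
  Matrix.mulVecLin (Matrix.of fun s' s => D.redEntry order arrow p c ξ ξ' s s')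

theorem IsSpecialization.intertwines_gaugeEquiv {φ : ChronoRing →+* ℤ} {x y z : ℤˣ}
    (hφ : IsSpecialization φ x y z) :
    Intertwines (gaugeEquiv horder (x * z)) (specEdge order arrow φ)
      (redEdge order arrow ((x * y : ℤˣ) : ℤ)) (D.edgeSign order arrow x (x * z)) := by
  intro c ξ ξ' h v
  ext s'
  change ((gaugeAt horder (x * z) ξ' s' : ℤˣ) : ℤ) *
      ∑ s, φ (D.reorder (order ξ) (D.frontSrc arrow c ξ) s *
        D.saddleEntry chMerge chSplit (D.tail arrow c) c ξ ξ' s s' *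
        D.reorder (D.frontTgt arrow c ξ') (order ξ') s') * v s =
    (D.edgeSign order arrow x (x * z) ξ c : ℤ) *
      ∑ s, D.redEntry order arrow ((x * y : ℤˣ) : ℤ) c ξ ξ' s s' *
        ((gaugeAt horder (x * z) ξ s : ℤ) * v s)
  rw [Finset.mul_sum, Finset.mul_sum]
  refine Finset.sum_congr rfl fun s _ => ?_
  rw [hφ.genEntry_eq arrow horder h]
  have hg : ((gaugeAt horder (x * z) ξ' s' : ℤˣ) : ℤ) * gaugeAt horder (x * z) ξ' s' = 1 := by
    rw [← Units.val_mul, Int.units_mul_self, Units.val_one]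
  simp only [Units.val_mul]
  linear_combination ((D.edgeSign order arrow x (x * z) ξ c : ℤ) *
    (gaugeAt horder (x * z) ξ s : ℤ) * D.redEntry order arrow (↑x * ↑y) c ξ ξ' s s' * v s) * hg

theorem intertwines_refl_evenEdge :
    Intertwines (fun ξ => LinearEquiv.refl ℤ (D.Labeling ξ → ℤ)) (redEdge order arrow 1)
      D.evenEdge 1 := by
  intro c ξ ξ' h v
  rw [Pi.one_apply, Pi.one_apply, Units.val_one, one_smul]
  simp only [LinearEquiv.refl_apply, redEdge, evenEdge, h.redEntry_one]

theorem intertwines_oddBasis :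
    Intertwines (oddBasis horder) (redEdge order arrow (-1)) (D.oddEdge arrow) 1 := by
  intro c ξ ξ' h v
  rw [Pi.one_apply, Pi.one_apply, Units.val_one, one_smul]
  have H : (oddBasis horder ξ').toLinearMap ∘ₗ redEdge order arrow (-1) c ξ ξ' =
      D.oddEdge arrow c ξ ξ' ∘ₗ (oddBasis horder ξ).toLinearMap := by
    refine LinearMap.pi_ext' fun s => LinearMap.ext_ring ?_
    simp only [LinearMap.comp_apply, LinearMap.single_apply, LinearEquiv.coe_coe]
    rw [oddBasis_single, h.oddEdge_wedge horder]
    have e : redEdge order arrow (-1) c ξ ξ' (Pi.single s 1) =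
        ∑ s', D.redEntry order arrow (-1) c ξ ξ' s s' • (Pi.single s' 1 : D.Labeling ξ' → ℤ) := by
      ext t
      simp [redEdge, Finset.sum_apply, Pi.single_apply]
    rw [e, map_sum]
    exact Finset.sum_congr rfl fun s' _ => by rw [map_smul, oddBasis_single]
  exact LinearMap.congr_fun H v

theorem intertwines_oddTwist :
    Intertwines D.oddTwist (D.oddEdge arrow) (D.oddEdge arrow) D.twistSign :=
  fun _ _ _ h v => h.oddTwist_oddEdge arrow v

open Classical in
/-- The effect of a change of the arrows on the edge maps of the odd theory. -/
def arrowSign (arrow arrow' : Fin D.crossings → Bool) (ξ : D.Cube) (c : Fin D.crossings) : ℤˣ :=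
  if D.circ ξ (D.arc c 0) = D.circ ξ (D.arc c 2) ∧ arrow c ≠ arrow' c then -1 else 1

theorem intertwines_refl_oddEdge (arrow' : Fin D.crossings → Bool) :
    Intertwines (fun ξ => LinearEquiv.refl ℤ (D.OddModule ξ)) (D.oddEdge arrow) (D.oddEdge arrow')
      (arrowSign arrow arrow') := by
  intro c ξ ξ' _ v
  simp only [LinearEquiv.refl_apply]
  by_cases hs : D.circ ξ (D.arc c 0) = D.circ ξ (D.arc c 2)
  · simp only [oddEdge, circ_tail, hs, ne_eq, not_true_eq_false, if_false, LinearMap.comp_apply,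
      LinearMap.mulLeft_apply, arrowSign, true_and]
    unfold tail
    cases arrow c <;> cases arrow' c <;> simp [← neg_mul]
  · simp only [oddEdge, circ_tail, hs, ne_eq, not_false_eq_true, if_true, arrowSign, false_and,
      if_false, Units.val_one, one_smul]

end Gauge

/-! ### Signs on faces of the even cube -/

section EvenFaces

variable {c : Fin D.crossings} {ξ ξ' : D.Cube}

theorem evenEdge_apply (v : D.Labeling ξ → ℤ) (s' : D.Labeling ξ') :
    D.evenEdge c ξ ξ' v s' = ∑ s, D.saddleEntry evenMerge evenSplit 0 c ξ ξ' s s' * v s := rfl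

theorem evenEntry_nonneg (s : D.Labeling ξ) (s' : D.Labeling ξ') :
    0 ≤ D.saddleEntry evenMerge evenSplit 0 c ξ ξ' s s' := by
  have hm (i j k : Bool) : 0 ≤ evenMerge i j k := by revert i j k; decide
  have hs (i j k : Bool) : 0 ≤ evenSplit i j k := by revert i j k; decide
  simp only [saddleEntry]
  split_ifs
  exacts [hm _ _ _, hs _ _ _, le_rfl]

theorem evenEdge_nonneg {v : D.Labeling ξ → ℤ} (hv : 0 ≤ v) : 0 ≤ D.evenEdge c ξ ξ' v :=
  fun s' => Finset.sum_nonneg fun s _ => mul_nonneg (evenEntry_nonneg s s') (hv s)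

/-- Saddles do not annihilate basis elements with at most one label `v₋`. -/
theorem IsEdge.exists_evenEdge_pos (h : D.IsEdge c ξ ξ') {v : D.Labeling ξ → ℤ} (hv : 0 ≤ v)
    {s : D.Labeling ξ} (hs : 0 < v s) {x : D.Circle ξ} (hx : ∀ y, s y = false → y = x) :
    ∃ s', 0 < D.evenEdge c ξ ξ' v s' ∧
      ((∀ y, s y = true) → ∃ x, ∀ y, s' y = false → y = x) := by
  have hpos (s' : D.Labeling ξ') (hs' : 0 < D.saddleEntry evenMerge evenSplit 0 c ξ ξ' s s') :
      0 < D.evenEdge c ξ ξ' v s' := by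
    rw [evenEdge_apply]
    exact Finset.sum_pos' (fun t _ => mul_nonneg (evenEntry_nonneg t s') (hv t))
      ⟨s, Finset.mem_univ s, mul_pos hs' hs⟩
  let ar : Fin D.crossings → Bool := fun _ => false
  have hrest (i j : Bool) (e : Fin D.arcs) (h0 : D.circ ξ e ≠ D.circ ξ (D.arc c 0))
      (h2 : D.circ ξ e ≠ D.circ ξ (D.arc c (0 + 2))) :
      s (D.circ ξ e) = extendLabeling ar c ξ' s i j (D.circ ξ' e) :=
    (h.extendLabeling_rest ar s i j ⟨h0, h2⟩).symm
  have e1 (i j : Bool) : extendLabeling ar c ξ' s i j (D.circ ξ' (D.arc c (0 + 1))) = i :=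
    if_pos rfl
  by_cases hab : D.circ ξ (D.arc c 0) = D.circ ξ (D.arc c (0 + 2))
  · have hab' : D.circ ξ' (D.arc c (0 + 3)) ≠ D.circ ξ' (D.arc c (0 + 1)) :=
      (h.circ_ne_iff.1 hab).symm
    have e3 (i j : Bool) : extendLabeling ar c ξ' s i j (D.circ ξ' (D.arc c (0 + 3))) = j :=
      (if_neg hab').trans (if_pos rfl)
    -- The term of the split with v₋ on the first new circle and the old label on the second one;
    -- its coefficient is 1 for either label.
    refine ⟨extendLabeling ar c ξ' s false (s (D.circ ξ (D.arc c 0))), hpos _ ?_, fun ht => ?_⟩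
    · simp only [saddleEntry]
      rw [if_pos (hrest _ _), if_neg (not_not.2 hab), e1, e3]
      cases s (D.circ ξ (D.arc c 0)) <;> decide
    · refine ⟨D.circ ξ' (D.arc c (D.tail ar c + 1)), fun y hy => ?_⟩
      by_contra hne
      have : extendLabeling ar c ξ' s false (s (D.circ ξ (D.arc c 0))) y = true := by
        rw [extendLabeling, if_neg hne]
        split_ifs <;> exact ht _
      rw [this] at hy
      cases hy
  -- The product of two labels is v₋ as soon as one of them is; the vanishing product of v₋ with v₋
  -- is excluded because `x` is the only circle that may carry v₋.
  · refine ⟨extendLabeling ar c ξ' s (s (D.circ ξ (D.arc c 0)) && s (D.circ ξ (D.arc c 2)))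
      (s (D.circ ξ (D.arc c 0)) && s (D.circ ξ (D.arc c 2))), hpos _ ?_, fun ht => ?_⟩
    · simp only [saddleEntry]
      rw [if_pos (hrest _ _), if_pos hab, e1]
      have hne : s (D.circ ξ (D.arc c 0)) = true ∨ s (D.circ ξ (D.arc c 2)) = true := by
        by_contra hn
        simp only [not_or, Bool.not_eq_true] at hn
        exact hab ((hx _ hn.1).trans (hx _ hn.2).symm)
      change 0 < evenMerge _ (s (D.circ ξ (D.arc c 2))) _
      generalize s (D.circ ξ (D.arc c 0)) = i at *
      generalize s (D.circ ξ (D.arc c 2)) = j at *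
      revert i j
      decide
    · refine ⟨D.circ ξ' (D.arc c 1), fun y hy => ?_⟩
      have : extendLabeling ar c ξ' s (s (D.circ ξ (D.arc c 0)) && s (D.circ ξ (D.arc c 2)))
          (s (D.circ ξ (D.arc c 0)) && s (D.circ ξ (D.arc c 2))) y = true := by
        rw [extendLabeling]
        split_ifs <;> simp [ht]
      rw [this] at hy
      cases hy

/-- The cube of even Khovanov homology commutes. -/
theorem Anticommutes.faceSign_even {ε : D.Cube → Fin D.crossings → ℤˣ}
    (hε : Anticommutes D.evenEdge ε) {ξ ξ₁ ξ₂ ξ₁₂ : D.Cube} {c c' : Fin D.crossings}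
    (hf : D.IsFace ξ ξ₁ ξ₂ ξ₁₂ c c') : faceSign ε ξ ξ₁ ξ₂ c c' = -1 := by
  classical
  -- If the sign were 1, one composition would be the negative of the other. But both are
  -- nonnegative on the element with all labels v₊, and one of them has a positive coefficient
  -- there.
  refine (Int.units_eq_one_or _).resolve_left fun h1 => ?_
  have h0 : (0 : D.Labeling ξ → ℤ) ≤ Pi.single (fun _ => true) 1 := by
    intro s
    rw [Pi.single_apply]
    split_ifs <;> simp
  obtain ⟨s₁, hs₁, hx⟩ := hf.edge₁.exists_evenEdge_pos h0 (s := fun _ => true)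
    (by simp) (x := D.circ ξ (D.arc c 0)) (by simp)
  obtain ⟨x, hx⟩ := hx fun _ => rfl
  obtain ⟨s₁₂, hs₁₂, -⟩ := hf.edge₁₂.exists_evenEdge_pos (evenEdge_nonneg h0) hs₁ hx
  have h2 := congrFun (hε.eq_faceSign hf (Pi.single (fun _ => true) 1)) s₁₂
  have h3 := evenEdge_nonneg (c := c) (ξ' := ξ₁₂) (evenEdge_nonneg (c := c') (ξ' := ξ₂) h0) s₁₂
  rw [h1, Units.neg_smul, one_smul, Pi.neg_apply] at h2
  rw [h2, Pi.zero_apply] at h3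
  linarith

theorem evenSign_update {ξ : D.Cube} {c : Fin D.crossings} (h : ξ c = false)
    (c' : Fin D.crossings) :
    D.evenSign (Function.update ξ c true) c' = D.evenSign ξ c' * if c < c' then -1 else 1 := by
  unfold evenSign
  split_ifs with hcc
  · have e : (Finset.univ.filter fun d => d < c' ∧ Function.update ξ c true d = true) =
        insert c (Finset.univ.filter fun d => d < c' ∧ ξ d = true) := by
      ext d
      by_cases hd : d = c
      · subst hd
        simp [hcc]
      · simp [hd]
    rw [e, Finset.card_insert_of_notMem (by simp [h]), pow_succ]
  · rw [mul_one]
    congr 2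
    ext d
    by_cases hd : d = c
    · subst hd
      simp [hcc]
    · simp [hd]

theorem faceSign_evenSign {ξ ξ₁ ξ₂ ξ₁₂ : D.Cube} {c c' : Fin D.crossings}
    (hf : D.IsFace ξ ξ₁ ξ₂ ξ₁₂ c c') : faceSign D.evenSign ξ ξ₁ ξ₂ c c' = -1 := by
  rw [faceSign, hf.edge₁.2, hf.edge₂.2, evenSign_update hf.edge₁.1, evenSign_update hf.edge₂.1]
  have e : (if c < c' then (-1 : ℤˣ) else 1) * (if c' < c then (-1 : ℤˣ) else 1) = -1 := by
    rcases lt_or_gt_of_ne hf.ne with h | h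
    · simp [h, h.le]
    · simp [h, h.le]
  have hsq (u : ℤˣ) : u * u = 1 := Int.units_mul_self u
  calc _ = (D.evenSign ξ c * D.evenSign ξ c) * (D.evenSign ξ c' * D.evenSign ξ c') *
        ((if c < c' then (-1 : ℤˣ) else 1) * (if c' < c then (-1 : ℤˣ) else 1)) := by ac_rfl
    _ = -1 := by rw [hsq, hsq, e, one_mul, one_mul]

end EvenFaces

end LinkDiagram

end
-- Face signs of the odd cube, and the final comparison.
noncomputable section

/-- A criterion for the linear independence of two vectors, in the exterior algebra. -/
theorem ExteriorAlgebra.ι_mul_ι_ne_zero {R M : Type*} [CommRing R] [Nontrivial R] [AddCommGroup M]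
    [Module R M] {u v : M} (f g : M →ₗ[R] R) (hfu : f u = 1) (hgu : g u = 0) (hgv : g v = 1) :
    ExteriorAlgebra.ι R u * ExteriorAlgebra.ι R v ≠ 0 := by
  let A : M [⋀^Fin 2]→ₗ[R] R :=
    (Matrix.detRowAlternating (n := Fin 2) (R := R)).compLinearMap (LinearMap.pi ![f, g])
  have h : ExteriorAlgebra.liftAlternating (R := R) (Pi.single 2 A : ∀ i, M [⋀^Fin i]→ₗ[R] R)
      (ExteriorAlgebra.ι R u * ExteriorAlgebra.ι R v) = 1 := by
    have e : ExteriorAlgebra.ι R u * ExteriorAlgebra.ι R v =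
        ExteriorAlgebra.ιMulti R 2 ![u, v] := by
      simp [ExteriorAlgebra.ιMulti_apply]
    rw [e, ExteriorAlgebra.liftAlternating_apply_ιMulti, Pi.single_eq_same]
    change Matrix.det (Matrix.of fun i => LinearMap.pi ![f, g] (![u, v] i)) = 1
    rw [Matrix.det_fin_two]
    simp [hfu, hgu, hgv]
  intro h0
  rw [h0, map_zero] at h
  exact zero_ne_one h

namespace LinkDiagram

variable {D : LinkDiagram}

/-! ### Signs on faces of the odd cube -/

section OddFaces

variable {c : Fin D.crossings} {ξ ξ' : D.Cube}

/-- The difference of the circles on the two sides of an arrow. -/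
def splitVector (arrow : Fin D.crossings → Bool) (c : Fin D.crossings) (ξ' : D.Cube) :
    D.Circle ξ' →₀ ℤ :=
  Finsupp.single (D.circ ξ' (D.arc c (D.tail arrow c + 1))) 1 -
    Finsupp.single (D.circ ξ' (D.arc c (D.tail arrow c + 3))) 1

theorem oddEdge_of_ne (arrow : Fin D.crossings → Bool)
    (h : D.circ ξ (D.arc c 0) ≠ D.circ ξ (D.arc c 2)) (v : D.OddModule ξ) :
    D.oddEdge arrow c ξ ξ' v =
      ExteriorAlgebra.map (Finsupp.lmapDomain ℤ ℤ (D.carry ξ ξ')) v := by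
  simp only [oddEdge, ne_eq, circ_tail, h, not_false_eq_true, if_true, AlgHom.toLinearMap_apply]

theorem oddEdge_of_eq (arrow : Fin D.crossings → Bool)
    (h : D.circ ξ (D.arc c 0) = D.circ ξ (D.arc c 2)) (v : D.OddModule ξ) :
    D.oddEdge arrow c ξ ξ' v = ExteriorAlgebra.ι ℤ (splitVector arrow c ξ') *
      ExteriorAlgebra.map (Finsupp.lmapDomain ℤ ℤ (D.carry ξ ξ')) v := by
  simp only [oddEdge, ne_eq, circ_tail, h, not_true_eq_false, if_false, LinearMap.comp_apply,
    LinearMap.mulLeft_apply, AlgHom.toLinearMap_apply, splitVector, map_sub]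

theorem IsEdge.splitVector_ne (h : D.IsEdge c ξ ξ') (arrow : Fin D.crossings → Bool)
    (hs : D.circ ξ (D.arc c 0) = D.circ ξ (D.arc c 2)) :
    D.circ ξ' (D.arc c (D.tail arrow c + 1)) ≠ D.circ ξ' (D.arc c (D.tail arrow c + 3)) :=
  (h.tail_ne_iff arrow).1 ((circ_tail arrow c ξ).2 hs)

theorem ι_single_sub_single_ne_zero {I : Type*} {i j : I} (h : i ≠ j) :
    ExteriorAlgebra.ι ℤ (Finsupp.single i (1 : ℤ) - Finsupp.single j 1) ≠ 0 := by
  rw [Ne, ExteriorAlgebra.ι_eq_zero_iff, sub_eq_zero]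
  exact fun H => h (Finsupp.single_left_injective one_ne_zero H)

/-- The two circles created at `c` can be identified only if they are the two circles merged at
`c'`; then both strands at `c'` belong to the circle that is split at `c`, and the face is
exceptional. -/
theorem IsFace.carry_ne {ξ ξ₁ ξ₂ ξ₁₂ : D.Cube} {c c' : Fin D.crossings}
    (hf : D.IsFace ξ ξ₁ ξ₂ ξ₁₂ c c') (hl : ¬ D.IsLadybug ξ c c')
    (hs : D.circ ξ (D.arc c 0) = D.circ ξ (D.arc c 2))
    (hm : D.circ ξ₁ (D.arc c' 0) ≠ D.circ ξ₁ (D.arc c' 2)) (arrow : Fin D.crossings → Bool) :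
    D.carry ξ₁ ξ₁₂ (D.circ ξ₁ (D.arc c (D.tail arrow c + 1))) ≠
      D.carry ξ₁ ξ₁₂ (D.circ ξ₁ (D.arc c (D.tail arrow c + 3))) := by
  have hne := hf.edge₁.splitVector_ne arrow hs
  intro heq
  obtain ⟨e, he, he'⟩ := D.circ_carry ξ₁ ξ₁₂ (D.arc c (D.tail arrow c + 1))
  obtain ⟨d, hd, hd'⟩ := D.circ_carry ξ₁ ξ₁₂ (D.arc c (D.tail arrow c + 3))
  rw [he', hd'] at heq
  have key (a b : Fin D.arcs) (hab : D.circ ξ₁ a ≠ D.circ ξ₁ b)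
      (hab' : D.circ ξ₁₂ a = D.circ ξ₁₂ b) :
      D.circ ξ₁ b = D.circ ξ₁ (D.arc c' 0) ∨ D.circ ξ₁ b = D.circ ξ₁ (D.arc c' 2) := by
    by_contra hb
    rw [not_or] at hb
    exact hab ((hf.edge₁₂.circ_eq_iff hb.1 hb.2 a).2 hab')
  have h1 := key e d (by rwa [he, hd]) heq
  have h3 := key d e (by rw [he, hd]; exact hne.symm) heq.symm
  rw [hd] at h1
  rw [he] at h3
  have hmem (k : Fin 4) (hk : D.circ ξ₁ (D.arc c' k) = D.circ ξ₁ (D.arc c (D.tail arrow c + 1)) ∨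
      D.circ ξ₁ (D.arc c' k) = D.circ ξ₁ (D.arc c (D.tail arrow c + 3))) :
      D.circ ξ (D.arc c' k) = D.circ ξ (D.arc c 0) := by
    have : D.circ ξ (D.arc c' k) = D.circ ξ (D.arc c (D.tail arrow c)) ∨
        D.circ ξ (D.arc c' k) = D.circ ξ (D.arc c (D.tail arrow c + 2)) := by
      by_contra H
      have H' := (hf.edge₁.rest_iff arrow (D.arc c' k)).1 (not_or.1 H)
      exact hk.elim H'.1 H'.2
    have ht := (circ_tail arrow c ξ).2 hs
    rw [← ht, or_self] at this
    rw [this]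
    unfold tail
    split
    · exact hs.symm
    · rfl
  have h0 : D.circ ξ₁ (D.arc c' 0) = D.circ ξ₁ (D.arc c (D.tail arrow c + 1)) ∨
      D.circ ξ₁ (D.arc c' 0) = D.circ ξ₁ (D.arc c (D.tail arrow c + 3)) := by
    rcases h3 with h3 | h3
    · exact Or.inl h3.symm
    · exact Or.inr ((h1.resolve_right fun h => hne (h3.trans h.symm)).symm)
  have h2 : D.circ ξ₁ (D.arc c' 2) = D.circ ξ₁ (D.arc c (D.tail arrow c + 1)) ∨
      D.circ ξ₁ (D.arc c' 2) = D.circ ξ₁ (D.arc c (D.tail arrow c + 3)) := by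
    rcases h3 with h3 | h3
    · exact Or.inr ((h1.resolve_left fun h => hne (h3.trans h.symm)).symm)
    · exact Or.inl h3.symm
  refine hl ⟨hs, (hmem 0 h0).trans (hmem 2 h2).symm, ?_⟩
  rwa [← hf.edge₁.2]

/-- The composition of two saddles of the odd theory vanishes only on the exceptional faces. -/
theorem IsFace.oddEdge_oddEdge_ne_zero {ξ ξ₁ ξ₂ ξ₁₂ : D.Cube} {c c' : Fin D.crossings}
    (hf : D.IsFace ξ ξ₁ ξ₂ ξ₁₂ c c') (hl : ¬ D.IsLadybug ξ c c') (arrow : Fin D.crossings → Bool) :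
    D.oddEdge arrow c' ξ₁ ξ₁₂ (D.oddEdge arrow c ξ ξ₁ 1) ≠ 0 := by
  by_cases hs : D.circ ξ (D.arc c 0) = D.circ ξ (D.arc c 2)
  · rw [oddEdge_of_eq arrow hs, map_one, mul_one]
    by_cases hm : D.circ ξ₁ (D.arc c' 0) = D.circ ξ₁ (D.arc c' 2)
    · rw [oddEdge_of_eq arrow hm, ExteriorAlgebra.map_apply_ι]
      have hne := hf.edge₁.splitVector_ne arrow hs
      have hne' := hf.edge₁₂.splitVector_ne arrow hm
      have hret (e e' : Fin D.arcs) (h : D.circ ξ₁₂ e = D.circ ξ₁₂ e') :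
          D.circ ξ₁ e = D.circ ξ₁ e' := by
        by_cases he' : D.circ ξ₁ e' = D.circ ξ₁ (D.arc c' 0) ∨
            D.circ ξ₁ e' = D.circ ξ₁ (D.arc c' 2)
        · have he := (hf.edge₁₂.mem_iff e').1 he'
          rw [← h, ← hf.edge₁₂.mem_iff e, ← hm, or_self] at he
          rw [← hm, or_self] at he'
          rw [he, he']
        · rw [not_or] at he'
          exact (hf.edge₁₂.circ_eq_iff he'.1 he'.2 e).2 h
      classical
      let a := D.circ ξ₁ (D.arc c (D.tail arrow c + 1))
      -- This functional sums the coordinates over the circles that come from `a`. It vanishes on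
      -- the second split vector, whose two circles come from one circle, and it is 1 on the image
      -- of the first.
      let g : D.Circle ξ₁₂ → ℤ := fun x => if ∃ e, D.circ ξ₁₂ e = x ∧ D.circ ξ₁ e = a then 1 else 0
      have hg (e : Fin D.arcs) : g (D.circ ξ₁₂ e) = if D.circ ξ₁ e = a then 1 else 0 := by
        refine if_congr ⟨?_, fun h => ⟨e, rfl, h⟩⟩ rfl rfl
        rintro ⟨e', h1, h2⟩
        rw [← hret _ _ h1, h2]
      refine ExteriorAlgebra.ι_mul_ι_ne_zero
        (Finsupp.lapply (D.circ ξ₁₂ (D.arc c' (D.tail arrow c' + 1))))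
        (Finsupp.linearCombination ℤ g) ?_ ?_ ?_
      · simp [splitVector, hne'.symm]
      · have : D.circ ξ₁ (D.arc c' (D.tail arrow c' + 1)) =
            D.circ ξ₁ (D.arc c' (D.tail arrow c' + 3)) := by
          have h0 := circ_of_false hf.edge₁₂.1
          unfold tail
          split
          · exact (h0.2.symm.trans (hm.symm.trans h0.1))
          · exact (h0.1.symm.trans (hm.trans h0.2))
        rw [splitVector, map_sub, Finsupp.linearCombination_single, Finsupp.linearCombination_single,
          hg, hg, this, sub_self]
      · obtain ⟨e, he, he'⟩ := D.circ_carry ξ₁ ξ₁₂ (D.arc c (D.tail arrow c + 1))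
        obtain ⟨d, hd, hd'⟩ := D.circ_carry ξ₁ ξ₁₂ (D.arc c (D.tail arrow c + 3))
        rw [splitVector, map_sub, map_sub, Finsupp.lmapDomain_apply, Finsupp.lmapDomain_apply,
          Finsupp.mapDomain_single, Finsupp.mapDomain_single, Finsupp.linearCombination_single,
          Finsupp.linearCombination_single, he', hd', hg, hg, he, hd, if_pos rfl,
          if_neg hne.symm, smul_zero, sub_zero, one_smul]
    · rw [oddEdge_of_ne arrow hm, ExteriorAlgebra.map_apply_ι, splitVector, map_sub,
        Finsupp.lmapDomain_apply, Finsupp.lmapDomain_apply, Finsupp.mapDomain_single,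
        Finsupp.mapDomain_single]
      exact ι_single_sub_single_ne_zero (hf.carry_ne hl hs hm arrow)
  · rw [oddEdge_of_ne arrow hs, map_one]
    by_cases hm : D.circ ξ₁ (D.arc c' 0) = D.circ ξ₁ (D.arc c' 2)
    · rw [oddEdge_of_eq arrow hm, map_one, mul_one]
      exact ι_single_sub_single_ne_zero (hf.edge₁₂.splitVector_ne arrow hm)
    · rw [oddEdge_of_ne arrow hm, map_one]
      exact one_ne_zero

/-- The exterior algebra is free on monomials, so it has no 2-torsion; the order only serves to
choose the basis. -/
theorem OddModule.ne_neg {ξ : D.Cube} {order : ∀ ξ : D.Cube, D.Circle ξ → ℕ}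
    (horder : ∀ ξ, Function.Injective (order ξ)) {v : D.OddModule ξ} (hv : v ≠ 0) : v ≠ -v := by
  intro h
  have h1 := congrArg (oddBasis horder ξ).symm h
  rw [map_neg] at h1
  refine hv ((oddBasis horder ξ).symm.map_eq_zero_iff.1 (funext fun s => ?_))
  have := congrFun h1 s
  rw [Pi.neg_apply] at this
  rw [Pi.zero_apply]
  omega

open Classical in
-- Each reversal of an arrow of the face exchanges the two types of faces and changes the sign of
-- exactly one of the two splits.
theorem faceSign_arrowSign (arrow arrow' : Fin D.crossings → Bool) {ξ ξ₁ ξ₂ ξ₁₂ : D.Cube}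
    {c c' : Fin D.crossings} (hf : D.IsFace ξ ξ₁ ξ₂ ξ₁₂ c c') (hl : D.IsLadybug ξ c c') :
    faceSign (arrowSign arrow arrow') ξ ξ₁ ξ₂ c c' =
      if (D.LadybugTail arrow ξ c c' ↔ D.LadybugTail arrow' ξ c c') then 1 else -1 := by
  have h3 := hl.2.2
  rw [← hf.edge₁.2] at h3
  have hns := hl.not_split hf.edge₁ hf.edge₁₂ hf.edge₂₁
  have hm0 := hl.mem hf.edge₁ 0 (Or.inl rfl)
  have hm2 := hl.mem hf.edge₁ 2 (Or.inr rfl)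
  have h13 := hf.edge₁.circ_ne_iff.1 hl.1
  have h20 : D.circ ξ₁ (D.arc c' 2) = D.circ ξ₁ (D.arc c 1) ↔
      ¬ D.circ ξ₁ (D.arc c' 0) = D.circ ξ₁ (D.arc c 1) := by
    refine ⟨fun h h' => h3 (h'.trans h.symm), fun h => hm2.resolve_right fun h' => ?_⟩
    exact h3 ((hm0.resolve_left h).trans h'.symm)
  have h03 : D.circ ξ₁ (D.arc c' 0) = D.circ ξ₁ (D.arc c 3) ↔
      ¬ D.circ ξ₁ (D.arc c' 0) = D.circ ξ₁ (D.arc c 1) :=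
    ⟨fun h h' => h13 (h'.symm.trans h), fun h => hm0.resolve_left h⟩
  have h23 : D.circ ξ₁ (D.arc c' 2) = D.circ ξ₁ (D.arc c 3) ↔
      D.circ ξ₁ (D.arc c' 0) = D.circ ξ₁ (D.arc c 1) := by
    refine ⟨fun h => hm0.resolve_right fun h' => h3 (h'.trans h.symm), fun h => ?_⟩
    exact hm2.resolve_left fun h' => h3 (h.trans h'.symm)
  have hLT (ar : Fin D.crossings → Bool) : D.LadybugTail ar ξ c c' ↔
      (D.circ ξ₁ (D.arc c' 0) = D.circ ξ₁ (D.arc c 1) ↔ ar c = ar c') := by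
    rw [LadybugTail, ← hf.edge₁.2]
    unfold tail
    cases ar c <;> cases ar c' <;> simp [h20, h03, h23]
  rw [hLT, hLT]
  simp only [faceSign, arrowSign, hl.1, hl.2.1, hns, h3, true_and, false_and, if_false, mul_one]
  by_cases hP : D.circ ξ₁ (D.arc c' 0) = D.circ ξ₁ (D.arc c 1) <;> simp only [hP] <;>
    generalize arrow c = a1 <;> generalize arrow c' = a2 <;> generalize arrow' c = a3 <;>
    generalize arrow' c' = a4 <;> revert a1 a2 a3 a4 <;> simp

/-- The face starts with two splits and ends with two merges, so only the colours of the two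
crossings enter, and they are opposite. -/
theorem faceSign_twistSign {ξ ξ₁ ξ₂ ξ₁₂ : D.Cube} {c c' : Fin D.crossings}
    (hf : D.IsFace ξ ξ₁ ξ₂ ξ₁₂ c c') (hl : D.IsLadybug ξ c c') :
    faceSign D.twistSign ξ ξ₁ ξ₂ c c' = -1 := by
  have h3 := hl.2.2
  rw [← hf.edge₁.2] at h3
  have hns := hl.not_split hf.edge₁ hf.edge₁₂ hf.edge₂₁
  simp only [faceSign, twistSign, hl.1, hl.2.1, hns, h3, if_true, if_false, mul_one]
  rw [hl.colour hf.edge₁ hf.ne hf.edge₂.1, mul_neg, Int.units_mul_self]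

theorem IsSignAssignment.anticommutes {arrow : Fin D.crossings → Bool} {conv : Bool}
    {ε : D.Cube → Fin D.crossings → ℤˣ}
    (hε : D.IsSignAssignment (D.oddEdge arrow) (-1) arrow conv ε) :
    Anticommutes (D.oddEdge arrow) ε := fun _ _ _ _ _ _ hf v =>
  LinearMap.congr_fun (hε.anticommute _ _ _ _ _ _ hf.ne hf.edge₁ hf.edge₁₂ hf.edge₂ hf.edge₂₁) v

open Classical in
theorem IsSignAssignment.faceSign_odd {arrow : Fin D.crossings → Bool} {conv : Bool}
    {ε : D.Cube → Fin D.crossings → ℤˣ}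
    (hε : D.IsSignAssignment (D.oddEdge arrow) (-1) arrow conv ε) {ξ ξ₁ ξ₂ ξ₁₂ : D.Cube}
    {c c' : Fin D.crossings} (hf : D.IsFace ξ ξ₁ ξ₂ ξ₁₂ c c') (hl : D.IsLadybug ξ c c') :
    faceSign ε ξ ξ₁ ξ₂ c c' = -(if (D.LadybugTail arrow ξ c c' ↔ conv = true) then 1 else -1) := by
  rw [faceSign, hε.ladybug _ _ _ _ _ _ hf.ne hf.edge₁ hf.edge₁₂ hf.edge₂ hf.edge₂₁ hl, neg_mul,
    mul_assoc, Int.units_mul_self, mul_one]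

end OddFaces

/-! ### The comparison -/

section Comparison

variable {order : ∀ ξ : D.Cube, D.Circle ξ → ℕ} {arrow : Fin D.crossings → Bool} {conv : Bool}
  {ε : D.Cube → Fin D.crossings → ChronoRingˣ} {φ : ChronoRing →+* ℤ} {x y z : ℤˣ}

theorem IsSpecialization.intertwines_even (hφ : IsSpecialization φ x y z)
    (horder : ∀ ξ, Function.Injective (order ξ)) (arrow : Fin D.crossings → Bool)
    (hxy : x * y = 1) :
    Intertwines (fun ξ => (gaugeEquiv horder (x * z) ξ).trans (LinearEquiv.refl ℤ _))
      (specEdge order arrow φ) D.evenEdge (D.edgeSign order arrow x (x * z)) := by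
  have h := hφ.intertwines_gaugeEquiv horder arrow
  rw [hxy] at h
  have := h.trans (intertwines_refl_evenEdge arrow)
  rwa [mul_one] at this

theorem IsSpecialization.intertwines_odd (hφ : IsSpecialization φ x y z)
    (horder : ∀ ξ, Function.Injective (order ξ)) (arrow arrow' : Fin D.crossings → Bool)
    (hxy : x * y = -1) :
    Intertwines (fun ξ => ((gaugeEquiv horder (x * z) ξ).trans (oddBasis horder ξ)).trans
      (LinearEquiv.refl ℤ _)) (specEdge order arrow φ) (D.oddEdge arrow')
      (D.edgeSign order arrow x (x * z) * arrowSign arrow arrow') := by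
  have h := hφ.intertwines_gaugeEquiv horder arrow
  rw [hxy] at h
  have := (h.trans (intertwines_oddBasis horder arrow)).trans
    (intertwines_refl_oddEdge arrow arrow')
  rwa [mul_one] at this

/-- The signs of the gauge transformation do not matter on exceptional faces. -/
theorem IsSpecialization.faceSign_edgeSign (hφ : IsSpecialization φ x y z)
    (horder : ∀ ξ, Function.Injective (order ξ))
    (hε : D.IsSignAssignment (D.genEdge order arrow) ChronoRing.XYunit arrow conv ε)
    {ξ ξ₁ ξ₂ ξ₁₂ : D.Cube} {c c' : Fin D.crossings} (hf : D.IsFace ξ ξ₁ ξ₂ ξ₁₂ c c')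
    (hl : D.IsLadybug ξ c c') :
    faceSign (D.edgeSign order arrow x (x * z)) ξ ξ₁ ξ₂ c c' = 1 := by
  -- In the even companion, with y replaced by x, both admissible values of ψ become 1, so the sign
  -- assignment contributes -1. Since the total is -1 as well, nothing is left for `edgeSign`.
  have h := ((hε.anticommutes_spec _).transport (hφ.fold.intertwines_even horder arrow
    (Int.units_mul_self x))).faceSign_even hf
  rw [faceSign_mul, hε.faceSign_spec hφ.fold hf hl, Int.units_mul_self, ite_self, neg_mul,
    one_mul, neg_inj] at h
  exact h

theorem IsSpecialization.nonempty_even_equiv (hφ : IsSpecialization φ x y z)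
    (horder : ∀ ξ, Function.Injective (order ξ))
    (hε : D.IsSignAssignment (D.genEdge order arrow) ChronoRing.XYunit arrow conv ε)
    (hxy : x * y = 1) (i : ℤ) :
    Nonempty (homologyAt (D.differential (specEdge order arrow φ) (specSign φ ε) (i - 1) i)
      (D.differential (specEdge order arrow φ) (specSign φ ε) i (i + 1)) ≃+ D.evenHomology i) := by
  have hG := hφ.intertwines_even horder arrow hxy
  refine hG.nonempty_homology_equiv (fun ξ ξ₁ ξ₂ ξ₁₂ c c' hf => ?_) i
  rw [((hε.anticommutes_spec φ).transport hG).faceSign_even hf, faceSign_evenSign hf]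

theorem IsSpecialization.nonempty_odd_equiv (hφ : IsSpecialization φ x y z)
    (horder : ∀ ξ, Function.Injective (order ξ))
    (hε : D.IsSignAssignment (D.genEdge order arrow) ChronoRing.XYunit arrow conv ε)
    {arrow' : Fin D.crossings → Bool} {conv' : Bool} {ε' : D.Cube → Fin D.crossings → ℤˣ}
    (hε' : D.IsSignAssignment (D.oddEdge arrow') (-1) arrow' conv' ε') (hxy : x * y = -1) (i : ℤ) :
    Nonempty (homologyAt (D.differential (specEdge order arrow φ) (specSign φ ε) (i - 1) i)
      (D.differential (specEdge order arrow φ) (specSign φ ε) i (i + 1)) ≃+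
      D.oddHomology arrow' ε' i) := by
  have hgen := hε.anticommutes_spec φ
  have hG := hφ.intertwines_odd horder arrow arrow' hxy
  -- Off the exceptional faces, anticommutativity alone fixes the sign.
  have hcase {ξ ξ₁ ξ₂ ξ₁₂ : D.Cube} {c c' : Fin D.crossings} (hf : D.IsFace ξ ξ₁ ξ₂ ξ₁₂ c c')
      {η : D.Cube → Fin D.crossings → ℤˣ} (hη : Anticommutes (D.oddEdge arrow') η)
      (hl : ¬ D.IsLadybug ξ c c') : faceSign η ξ ξ₁ ξ₂ c c' = faceSign ε' ξ ξ₁ ξ₂ c c' :=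
    hη.faceSign_eq hε'.anticommutes hf
      (OddModule.ne_neg horder (hf.oddEdge_oddEdge_ne_zero hl arrow'))
  by_cases hconv : conv = conv'
  · refine hG.nonempty_homology_equiv (fun ξ ξ₁ ξ₂ ξ₁₂ c c' hf => ?_) i
    by_cases hl : D.IsLadybug ξ c c'
    · rw [faceSign_mul, faceSign_mul, hε.faceSign_spec hφ hf hl,
        hφ.faceSign_edgeSign horder hε hf hl, faceSign_arrowSign arrow arrow' hf hl,
        hε'.faceSign_odd hf hl, hxy, hconv]
      split_ifs <;> first | rfl | (exfalso; tauto)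
    · exact hcase hf (hgen.transport hG) hl
  -- For opposite conventions the twist supplies the missing -1 on every exceptional face.
  · have hG' := hG.trans (intertwines_oddTwist arrow')
    refine hG'.nonempty_homology_equiv (fun ξ ξ₁ ξ₂ ξ₁₂ c c' hf => ?_) i
    by_cases hl : D.IsLadybug ξ c c'
    · rw [faceSign_mul, faceSign_mul, faceSign_mul, hε.faceSign_spec hφ hf hl,
        hφ.faceSign_edgeSign horder hε hf hl, faceSign_arrowSign arrow arrow' hf hl,
        faceSign_twistSign hf hl, hε'.faceSign_odd hf hl, hxy]
      have hc : conv = true ↔ ¬ conv' = true := by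
        revert hconv
        cases conv <;> cases conv' <;> simp
      split_ifs <;> first | rfl | (exfalso; tauto)
    · exact hcase hf (hgen.transport hG') hl

end Comparison

end LinkDiagram

end
theorem mainTheorem5 (D : LinkDiagram)
    -- choices in the generalized Khovanov complex: orders of circles, arrows, signs
    (order : ∀ ξ : D.Cube, D.Circle ξ → ℕ) (horder : ∀ ξ, Function.Injective (order ξ))
    (arrow : Fin D.crossings → Bool) (conv : Bool)
    (ε : D.Cube → Fin D.crossings → ChronoRingˣ)
    (hε : D.IsSignAssignment (D.genEdge order arrow) ChronoRing.XYunit arrow conv ε)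
    -- choices in the odd Khovanov complex: arrows, signs
    (arrow' : Fin D.crossings → Bool) (conv' : Bool)
    (ε' : D.Cube → Fin D.crossings → ℤˣ)
    (hε' : D.IsSignAssignment (D.oddEdge arrow') (-1) arrow' conv' ε')
    -- a module structure on the integers
    [Module ChronoRing ℤ] (i : ℤ) :
    ((∀ m : ℤ, (ChronoRing.X * ChronoRing.Y) • m = m) →
      Nonempty (D.genHomology order arrow ε ℤ i ≃+ D.evenHomology i)) ∧
    ((¬ ∀ m : ℤ, (ChronoRing.X * ChronoRing.Y) • m = m) →
      Nonempty (D.genHomology order arrow ε ℤ i ≃+ D.oddHomology arrow' ε' i)) := by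

  obtain ⟨x, y, z, hφ⟩ := exists_isSpecialization (scalarHom ChronoRing)
  obtain ⟨e⟩ := LinkDiagram.nonempty_genHomology_equiv order arrow ε i
  have hxy : (∀ m : ℤ, (ChronoRing.X * ChronoRing.Y) • m = m) ↔ x * y = 1 := by
    simp only [smul_eq_scalarHom_mul, map_mul, hφ.map_X, hφ.map_Y, ← Units.val_mul]
    refine ⟨fun h => Units.ext ?_, fun h m => by rw [h, Units.val_one, one_mul]⟩
    simpa using h 1
  rw [hxy]
  refine ⟨fun h => ?_, fun h => ?_⟩
  · obtain ⟨e'⟩ := hφ.nonempty_even_equiv horder hε h i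
    exact ⟨e.trans e'⟩
  · obtain ⟨e'⟩ := hφ.nonempty_odd_equiv horder hε hε'
      ((Int.units_eq_one_or _).resolve_left h) i
    exact ⟨e.trans e'⟩
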